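/- Let $Z=(Z_t)_{t\ge 0}$, $Z_0=0$, be a real Lévy process with càdlàg paths and characteristic triplet $(b,\sigma,\Pi)$, that is, $$\mathbb E\big(e^{i\xi Z_t}\big)=\exp\Big(t\Big[ib\xi-\tfrac12\sigma^2\xi^2+\int_{\mathbb R}\big(e^{i\xi y}-1-i\xi y\mathbf 1_{\{|y|\le 1\}}\big)\,\Pi(dy)\Big]\Big),\qquad \Pi(\{0\})=0,\quad \int_{\mathbb R}(1\wedge y^2)\,\Pi(dy)<\infty .$$ Assume that $\sigma>0$, that $\mathbb E(e^{\theta Z_1})<\infty$ for some $\theta>0$, and that $Z_1$ is integrable with $\mathbb E(Z_1)=0$. Let $c>0$, $r\in\mathbb R$, and $Z^c_t=Z_t-ct$. For $x>0$ let $\tau_x=\inf\{s>0: x+Z^c_s\le 0\}$, and let $$\mathcal L^*f(x)=\tfrac12\sigma^2f''(x)-bf'(x)+\int_{\mathbb R}\big(f(x-y)-f(x)+yf'(x)\mathbf 1_{\{|y|\le1\}}\big)\,\Pi(dy).$$ A probability measure $\nu$ on $(0,\infty)$ is a *quasi-stationary distribution (QSD) for $Z^c$ with eigenvalue $-r$*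 if, with $\mathbb P_\nu(Z^c_t\in A,\tau>t):=\int \mathbb P(x+Z^c_t\in A,\ \tau_x>t)\,\nu(dx)$, for all $t\ge0$ and all Borel sets $A$, $$\mathbb P_\nu(Z^c_t\in A\mid \tau>t)=\nu(A)\qquad\text{and}\qquad \mathbb P_\nu(Z^c_t\in A,\ \tau>t)=e^{-rt}\nu(A).$$ A function $w:\mathbb R\to\mathbb R$ is (the profile of) a *traveling wave with speed $c$* if $u(t,x)=w(x-ct)$ together with $\gamma(t)=ct$ is a classical solution of the generalized Durrett–Remenik free-boundary problem with branching parameter $r$ and initial condition $u(0,x)=w(x)$, $x\ge 0$: $$\frac{\partial u}{\partial t}(t,x)=\mathcal L^*u(t,\cdot)(x)+r\,u(t,x)\quad (t>0,\ x>\gamma(t)),\qquad \int_{\gamma(t)}^\infty u(t,y)\,dy=1,\qquad u(t,x)=0\quad (t\ge 0,\ x\le\gamma(t)).$$ Here "classical" means that, for $t>0$, $u(t,\cdot)$ is continuous on $\mathbb R$ (so that it vanishes continuously at the free boundary), is $C^2$ on $(\gamma(t),\infty)$, and that the integral in $\mathcal L^*u(t,\cdot)(x)$ converges absolutely for $x>\gamma(t)$.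 Then, for every measure $\nu$ on $\mathbb R$: 1. $\nu$ is a QSD for $Z^c$ with eigenvalue $-r$ if and only if $\nu$ has a nonnegative Lebesgue density $w$ that is a traveling wave with speed $c$. 2. If $w$ is a continuous nonnegative Lebesgue density of $\nu$, then $\nu$ is a QSD for $Z^c$ with eigenvalue $-r$ if and only if $w$ is a traveling wave with speed $c$. 3. In both cases of 2, $w$ is $C^2$ on $(0,\infty)$, the integral in $\mathcal L^*w(x)$ converges absolutely for every $x>0$, and $\mathcal L^*w+cw'+rw=0$ on $(0,\infty)$. -/

import Mathlib

open MeasureTheory ProbabilityTheory Filter Topology Set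
open scoped NNReal ENNReal

noncomputable section

/-- A real-valued Lévy process (started at `0`): independent and stationary increments and,
almost surely, right-continuous paths with left limits. -/
structure IsLevyProcess {Ω : Type*} [MeasurableSpace Ω] (Z : ℝ≥0 → Ω → ℝ) (P : Measure Ω) :
    Prop where
  measurable : ∀ t, Measurable (Z t)
  start_zero : ∀ᵐ ω ∂P, Z 0 ω = 0
  indep_increments : HasIndepIncrements Z P
  stationary_increments : ∀ s t, IdentDistrib (fun ω => Z (s + t) ω - Z s ω) (Z t) P P
  cadlag : ∀ᵐ ω ∂P, ∀ t : ℝ≥0,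
    ContinuousWithinAt (fun s => Z s ω) (Ici t) t ∧
      ∃ l : ℝ, Tendsto (fun s => Z s ω) (𝓝[<] t) (𝓝 l)

/-- A Lévy (jump) measure: no mass at `0` and `∫ (1 ∧ y²) Λ(dy) < ∞`. -/
def IsLevyMeasure (Λ : Measure ℝ) : Prop :=
  Λ {0} = 0 ∧ ∫⁻ y, ENNReal.ofReal (min 1 (y ^ 2)) ∂Λ < ∞

/-- The truncation `y 1_{|y| ≤ 1}` used to compensate the small jumps. -/
def truncJump (y : ℝ) : ℝ := if |y| ≤ 1 then y else 0

/-- The Lévy–Khintchine exponent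
`i b ξ - σ² ξ² / 2 + ∫ (e^{iξy} - 1 - iξy 1_{|y| ≤ 1}) Λ(dy)`. -/
def levyExponent (b σ : ℝ) (Λ : Measure ℝ) (ξ : ℝ) : ℂ :=
  Complex.I * b * ξ - (σ : ℂ) ^ 2 * (ξ : ℂ) ^ 2 / 2 +
    ∫ y : ℝ, (Complex.exp (Complex.I * ξ * y) - 1 - Complex.I * ξ * (truncJump y : ℂ)) ∂Λ

/-- The process `Z` has characteristic triplet `(b, σ, Λ)`. -/
def HasLevyTriplet {Ω : Type*} [MeasurableSpace Ω] (Z : ℝ≥0 → Ω → ℝ) (P : Measure Ω)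
    (b σ : ℝ) (Λ : Measure ℝ) : Prop :=
  ∀ (t : ℝ≥0) (ξ : ℝ), charFun (P.map (Z t)) ξ = Complex.exp ((t : ℝ) * levyExponent b σ Λ ξ)

/-- The drifted process `Z^c_t = Z_t - c t`. -/
def drifted {Ω : Type*} (Z : ℝ≥0 → Ω → ℝ) (c : ℝ) : ℝ≥0 → Ω → ℝ :=
  fun t ω => Z t ω - c * t

/-- The absorption time `τ = inf {s > 0 : x + Y_s ≤ 0}` (`∞` if there is no such time) of the
process `x + Y`, i.e. of the process `Y` started at `x`. -/
def absorptionTime {Ω : Type*} (Y : ℝ≥0 → Ω → ℝ) (x : ℝ) (ω : Ω) : ℝ≥0∞ :=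
  ⨅ (s : ℝ≥0) (_ : 0 < s ∧ x + Y s ω ≤ 0), (s : ℝ≥0∞)

/-- `P_ν(Y_t ∈ A, τ > t) = ∫ P(x + Y_t ∈ A, τ_x > t) ν(dx)`: the law at time `t` of the spatially
homogeneous process `Y`, with initial distribution `ν`, killed when it leaves `(0, ∞)`. -/
def killedLaw {Ω : Type*} [MeasurableSpace Ω] (Y : ℝ≥0 → Ω → ℝ) (P : Measure Ω)
    (ν : Measure ℝ) (t : ℝ≥0) (A : Set ℝ) : ℝ≥0∞ :=
  ∫⁻ x, P {ω | x + Y t ω ∈ A ∧ (t : ℝ≥0∞) < absorptionTime Y x ω} ∂ν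

/-- `ν` is a quasi-stationary distribution, on `(0, ∞)`, of the process `Y` killed when it leaves
`(0, ∞)`: `P_ν(Y_t ∈ A | τ > t) = ν(A)` for all `t`. -/
structure IsQSD {Ω : Type*} [MeasurableSpace Ω] (Y : ℝ≥0 → Ω → ℝ) (P : Measure Ω)
    (ν : Measure ℝ) : Prop where
  isProbabilityMeasure : IsProbabilityMeasure ν
  supported : ν (Iic 0) = 0
  conditioned : ∀ (t : ℝ≥0) (A : Set ℝ), MeasurableSet A →
    killedLaw Y P ν t A / killedLaw Y P ν t univ = ν A

/-- `ν` is a quasi-stationary distribution of `Y` with eigenvalue `-r`: in addition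
`ν P_t = e^{-rt} ν` for the killed semigroup `(P_t)`. -/
structure IsQSDWithEigenvalue {Ω : Type*} [MeasurableSpace Ω] (Y : ℝ≥0 → Ω → ℝ) (P : Measure Ω)
    (ν : Measure ℝ) (r : ℝ) : Prop extends IsQSD Y P ν where
  eigenvalue : ∀ (t : ℝ≥0) (A : Set ℝ), MeasurableSet A →
    killedLaw Y P ν t A = ENNReal.ofReal (Real.exp (-r * t)) * ν A

/-- The integrand of the jump part of the adjoint generator,
`f(x - y) - f(x) + y f'(x) 1_{|y| ≤ 1}`. -/
def adjointJumpIntegrand (f : ℝ → ℝ) (x y : ℝ) : ℝ :=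
  f (x - y) - f x + truncJump y * deriv f x

/-- The adjoint `L*` of the generator of the Lévy process with triplet `(b, σ, Λ)`:
`L* f(x) = σ²/2 f''(x) - b f'(x) + ∫ (f(x - y) - f(x) + y f'(x) 1_{|y| ≤ 1}) Λ(dy)`. -/
def adjointGenerator (b σ : ℝ) (Λ : Measure ℝ) (f : ℝ → ℝ) (x : ℝ) : ℝ :=
  σ ^ 2 / 2 * deriv (deriv f) x - b * deriv f x + ∫ y, adjointJumpIntegrand f x y ∂Λ

/-- `(γ, u)` is a (classical) solution of the generalized Durrett–Remenik free-boundary problem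
with branching parameter `r` and initial condition `u₀`. Classical: for `t > 0` the function
`u(t, ·)` is continuous on the whole line (in particular it vanishes continuously at the free
boundary `γ(t)`), is `C²` to the right of `γ(t)`, and the integral in `L*u` converges there. -/
structure IsDurrettRemenikSolution (b σ : ℝ) (Λ : Measure ℝ) (r : ℝ) (u₀ : ℝ → ℝ)
    (γ : ℝ → ℝ) (u : ℝ → ℝ → ℝ) : Prop where
  continuous : ∀ t, 0 < t → Continuous (u t)
  contDiffOn : ∀ t, 0 < t → ContDiffOn ℝ 2 (u t) (Ioi (γ t))
  integrable : ∀ t, 0 < t → ∀ x, γ t < x → Integrable (adjointJumpIntegrand (u t) x) Λ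
  equation : ∀ t, 0 < t → ∀ x, γ t < x →
    HasDerivAt (fun s => u s x) (adjointGenerator b σ Λ (u t) x + r * u t x) t
  mass : ∀ t, 0 ≤ t → ∫ y in Ioi (γ t), u t y = 1
  vanish : ∀ t, 0 ≤ t → ∀ x, x ≤ γ t → u t x = 0
  initial : ∀ x, 0 ≤ x → u 0 x = u₀ x

/-- `u(t, x) = w(x - ct)` is a traveling-wave solution with speed `c` of the generalized
Durrett–Remenik problem: the free boundary, started at `0`, is `γ(t) = ct`. -/
def IsTravelingWave (b σ : ℝ) (Λ : Measure ℝ) (r c : ℝ) (w : ℝ → ℝ) : Prop :=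
  IsDurrettRemenikSolution b σ Λ r w (fun t => c * t) (fun t x => w (x - c * t))

/-- `w` solves `L*w + c w' + r w = 0` on `(0, ∞)`, in the classical sense. -/
def SolvesProfileEquation (b σ : ℝ) (Λ : Measure ℝ) (r c : ℝ) (w : ℝ → ℝ) : Prop :=
  ContDiffOn ℝ 2 w (Ioi 0) ∧
    ∀ x, 0 < x → Integrable (adjointJumpIntegrand w x) Λ ∧
      adjointGenerator b σ Λ w x + c * deriv w x + r * w x = 0

/-- `w` is a nonnegative density of `ν` with respect to Lebesgue measure. -/
def IsDensityOf (w : ℝ → ℝ) (ν : Measure ℝ) : Prop :=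
  Measurable w ∧ (∀ x, 0 ≤ w x) ∧ ν = volume.withDensity (fun x => ENNReal.ofReal (w x))

end

open scoped FourierTransform

/-! The process `Z^c` has triplet `(b - c, σ, Λ)`; let `Ψ` be its exponent, `p t` its law at time
`t` and `L*` its adjoint generator, so that the profile equation becomes `L*w + r w = 0` on `(0,
∞)`. On the whole line the right object is a finite measure `μ = L*ν + r ν`, the rate at which mass
leaves `(0, ∞)`. Being a QSD and being a wave both say that `μ` is a positive measure carried by
`(-∞, 0]`. In Fourier variables this reads `μ̂ = ν̂ (Ψ + r)`, and `μ` appears as the limit of the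
excess `ν ∗ p t - e^{-rt} ν` divided by `t`. Killing is always handled on dyadic grids: one step
convolves with `p h` and restricts to `(0, ∞)`. Right-continuity of the paths, together with `ν`
having no atoms, makes the grid laws converge to the killed law
(`IsLevyProcess.tendsto_iterate_killedStep`).

From a QSD to a wave. Killing only removes mass, so the excess is a positive measure; it has mass `1
- e^{-rt}`, and normalized it converges weakly by Lévy's continuity theorem. To add mass above `δ >
0`, a path must first be killed and then climb by `δ`, which costs a second factor of order `t`;
hence `μ` does not charge `(0, ∞)` (`IsKilledEigenmeasure.exists_exitMeasure`). The Gaussian part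
makes `Ψ` grow quadratically. Up to a `C²` function, the density is then minus the convolution of
`μ` with a kernel that is singular only at `0`, and at `x > 0` a measure on `(-∞, 0]` never sees
this singularity (`exists_regular_density`). Integration by parts against test functions gives the
pointwise equation.

From a wave to a QSD. The profile vanishes continuously at `0` and is nonnegative, so a smooth
convex truncation of it is `C²` on the line. Convexity gives Kato's inequality
(`le_adjointGenerator_softPos`), hence `L*w + r w ≥ 0` weakly on the whole line, hence `e^{-rt} ν ≤
ν ∗ p t`. The equation on `(0, ∞)` places `μ` on `(-∞, 0]`. One killed step therefore multiplies `ν`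
by `e^{-rh}` up to an error of mass `O(h)`, concentrated near `0`. Over the `t / h` steps these
errors are not summably small by themselves, but the Gaussian part drives a path started near `0`
below `0` almost at once (`IsLevyProcess.exists_staysAbove_le`), so nearly all of this error is
killed and its total contribution tends to zero (`IsLevyProcess.tendsto_sum_excess`). -/

/-! ### Lévy measures, truncation and Taylor bounds. -/

theorem IsLevyMeasure.integrable_min {Λ : Measure ℝ} (hΛ : IsLevyMeasure Λ) :
    Integrable (fun y : ℝ => min 1 (y ^ 2)) Λ := by
  refine ⟨by fun_prop, ?_⟩
  rw [hasFiniteIntegral_iff_ofReal (ae_of_all _ fun y => by positivity)]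
  exact hΛ.2

theorem IsLevyMeasure.measure_le_abs_lt_top {Λ : Measure ℝ} (hΛ : IsLevyMeasure Λ) {δ : ℝ}
    (hδ : 0 < δ) : Λ {y | δ ≤ |y|} < ∞ := by
  have hpos : 0 < min 1 (δ ^ 2) := by positivity
  refine lt_of_le_of_lt (measure_mono ?_) (hΛ.integrable_min.measure_ge_lt_top hpos)
  intro y hy
  have hy' : δ ^ 2 ≤ y ^ 2 := by
    rw [← sq_abs y]; exact pow_le_pow_left₀ hδ.le hy 2
  exact min_le_min le_rfl hy'

theorem IsLevyMeasure.sigmaFinite {Λ : Measure ℝ} (hΛ : IsLevyMeasure Λ) : SigmaFinite Λ := by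
  refine ⟨⟨⟨fun n : ℕ => {y | 1 / ((n : ℝ) + 1) ≤ |y|} ∪ {0}, fun _ => trivial, fun n => ?_, ?_⟩⟩⟩
  · refine (measure_union_le _ _).trans_lt ?_
    rw [hΛ.1, add_zero]
    exact hΛ.measure_le_abs_lt_top (by positivity)
  · refine eq_univ_of_forall fun y => ?_
    rcases eq_or_ne y 0 with rfl | hy
    · exact mem_iUnion.2 ⟨0, by simp⟩
    · obtain ⟨n, hn⟩ := exists_nat_one_div_lt (abs_pos.2 hy)
      exact mem_iUnion.2 ⟨n, Or.inl hn.le⟩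

theorem measurable_truncJump : Measurable truncJump :=
  Measurable.ite (measurableSet_le (by fun_prop) (by fun_prop)) measurable_id measurable_const

theorem truncJump_of_le {y : ℝ} (hy : |y| ≤ 1) : truncJump y = y := if_pos hy

theorem truncJump_of_lt {y : ℝ} (hy : 1 < |y|) : truncJump y = 0 := if_neg hy.not_ge

theorem min_one_sq_of_le {y : ℝ} (hy : |y| ≤ 1) : min 1 (y ^ 2) = y ^ 2 :=
  min_eq_right ((sq_le_one_iff_abs_le_one y).2 hy)

theorem min_one_sq_of_lt {y : ℝ} (hy : 1 < |y|) : min 1 (y ^ 2) = 1 :=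
  min_eq_left ((one_lt_sq_iff_one_lt_abs y).2 hy).le

/-- Second order Taylor bound. -/
theorem norm_taylor_sub_le {E : Type*} [NormedAddCommGroup E] [NormedSpace ℝ E]
    {g g' g'' : ℝ → E} {x y M : ℝ}
    (h1 : ∀ z ∈ uIcc x (x + y), HasDerivAt g (g' z) z)
    (h2 : ∀ z ∈ uIcc x (x + y), HasDerivAt g' (g'' z) z)
    (hM : ∀ z ∈ uIcc x (x + y), ‖g'' z‖ ≤ M) :
    ‖g (x + y) - g x - y • g' x‖ ≤ M * y ^ 2 := by
  have hx : x ∈ uIcc x (x + y) := left_mem_uIcc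
  have hxy : x + y ∈ uIcc x (x + y) := right_mem_uIcc
  have hcv : Convex ℝ (uIcc x (x + y)) := convex_uIcc _ _
  have hM0 : 0 ≤ M := (norm_nonneg _).trans (hM x hx)
  have key : ∀ z ∈ uIcc x (x + y), ‖g' z - g' x‖ ≤ M * |y| := by
    intro z hz
    have := hcv.norm_image_sub_le_of_norm_hasDerivWithin_le
      (fun u hu => (h2 u hu).hasDerivWithinAt) hM hx hz
    refine this.trans (mul_le_mul_of_nonneg_left ?_ hM0)
    have := abs_sub_left_of_mem_uIcc hz
    simpa using this
  have hd : ∀ z ∈ uIcc x (x + y),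
      HasDerivWithinAt (fun u => g u - u • g' x) (g' z - g' x) (uIcc x (x + y)) z := by
    intro z hz
    have := (h1 z hz).fun_sub ((hasDerivAt_id' z).smul_const (g' x))
    simpa only [one_smul] using this.hasDerivWithinAt
  have := hcv.norm_image_sub_le_of_norm_hasDerivWithin_le hd key hx hxy
  have e : g (x + y) - (x + y) • g' x - (g x - x • g' x) = g (x + y) - g x - y • g' x := by
    rw [add_smul]; abel
  rw [e] at this
  refine this.trans (le_of_eq ?_)
  rw [add_sub_cancel_left, Real.norm_eq_abs, mul_assoc, abs_mul_abs_self, sq]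

/-- Bound for the compensated increment of a bounded `C²` function. -/
theorem norm_compensated_le {E : Type*} [NormedAddCommGroup E] [NormedSpace ℝ E]
    {g g' g'' : ℝ → E} {M : ℝ} (h1 : ∀ z, HasDerivAt g (g' z) z)
    (h2 : ∀ z, HasDerivAt g' (g'' z) z) (hM0 : ∀ z, ‖g z‖ ≤ M)
    (hM : ∀ z, ‖g'' z‖ ≤ M) (x y : ℝ) :
    ‖g (x + y) - g x - truncJump y • g' x‖ ≤ 2 * M * min 1 (y ^ 2) := by
  have hM' : 0 ≤ M := (norm_nonneg _).trans (hM 0)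
  rcases le_or_gt |y| 1 with hy | hy
  · rw [truncJump_of_le hy, min_one_sq_of_le hy]
    refine (norm_taylor_sub_le (fun z _ => h1 z) (fun z _ => h2 z) (fun z _ => hM z)).trans ?_
    nlinarith [sq_nonneg y, mul_nonneg hM' (sq_nonneg y)]
  · rw [truncJump_of_lt hy, min_one_sq_of_lt hy, zero_smul, sub_zero, mul_one, two_mul]
    exact (norm_sub_le _ _).trans (add_le_add (hM0 _) (hM0 _))

/-! ### Size and growth of the Lévy–Khintchine exponent. -/

/-- The integrand of the jump part of the Lévy–Khintchine exponent. -/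
noncomputable def jumpChar (ξ y : ℝ) : ℂ :=
  Complex.exp (Complex.I * ξ * y) - 1 - Complex.I * ξ * (truncJump y : ℂ)

theorem hasDerivAt_cexp_mul (a : ℂ) (y : ℝ) :
    HasDerivAt (fun y : ℝ => Complex.exp (a * y)) (a * Complex.exp (a * y)) y := by
  have := ((Complex.ofRealCLM.hasDerivAt (x := y)).const_mul a).cexp
  simpa [mul_comm] using this

theorem norm_cexp_I_mul (ξ y : ℝ) : ‖Complex.exp (Complex.I * ξ * y)‖ = 1 := by
  have : Complex.I * ξ * y = ((ξ * y : ℝ) : ℂ) * Complex.I := by push_cast; ring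
  rw [this, Complex.norm_exp_ofReal_mul_I]

theorem norm_jumpChar_le (ξ y : ℝ) : ‖jumpChar ξ y‖ ≤ 2 * (1 + ξ ^ 2) * min 1 (y ^ 2) := by
  have h1 : ∀ z : ℝ, HasDerivAt (fun y : ℝ => Complex.exp (Complex.I * ξ * y))
      (Complex.I * ξ * Complex.exp (Complex.I * ξ * z)) z := hasDerivAt_cexp_mul _
  have h2 := fun z => (h1 z).const_mul (Complex.I * ξ)
  have := norm_compensated_le (M := 1 + ξ ^ 2) h1 h2
    (fun z => by rw [norm_cexp_I_mul]; nlinarith [sq_nonneg ξ])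
    (fun z => by
      rw [norm_mul, norm_mul (Complex.I * ξ), norm_cexp_I_mul, norm_mul, Complex.norm_I,
        Complex.norm_real, Real.norm_eq_abs, one_mul, mul_one, abs_mul_abs_self]
      nlinarith [sq_nonneg ξ]) 0 y
  refine le_trans (le_of_eq ?_) this
  congr 1
  simp [jumpChar]
  ring

theorem measurable_jumpChar : Measurable (fun q : ℝ × ℝ => jumpChar q.1 q.2) := by
  unfold jumpChar
  have := measurable_truncJump
  fun_prop

theorem measurable_jumpChar_right (ξ : ℝ) : Measurable (jumpChar ξ) := by
  unfold jumpChar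
  have := measurable_truncJump
  fun_prop

theorem integrable_jumpChar {Λ : Measure ℝ} (hΛ : IsLevyMeasure Λ) (ξ : ℝ) :
    Integrable (jumpChar ξ) Λ :=
  (hΛ.integrable_min.const_mul (2 * (1 + ξ ^ 2))).mono'
    (measurable_jumpChar_right ξ).aestronglyMeasurable (ae_of_all _ fun y => norm_jumpChar_le ξ y)

theorem levyExponent_eq (b σ : ℝ) (Λ : Measure ℝ) (ξ : ℝ) :
    levyExponent b σ Λ ξ = Complex.I * b * ξ - (σ : ℂ) ^ 2 * (ξ : ℂ) ^ 2 / 2 +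
      ∫ y, jumpChar ξ y ∂Λ := rfl

theorem re_jumpChar (ξ y : ℝ) : (jumpChar ξ y).re = Real.cos (ξ * y) - 1 := by
  have : Complex.I * ξ * y = ((ξ * y : ℝ) : ℂ) * Complex.I := by push_cast; ring
  unfold jumpChar
  rw [this, Complex.sub_re, Complex.sub_re, Complex.exp_ofReal_mul_I_re]
  simp

/-- Jumps contribute `cos (ξ y) - 1 ≤ 0` to the real part and the drift contributes nothing, so the
Gaussian term is an upper bound. This coercivity is the source of absolute continuity and of all the
smoothing below. -/
theorem re_levyExponent_le {Λ : Measure ℝ} (hΛ : IsLevyMeasure Λ) (b σ ξ : ℝ) :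
    (levyExponent b σ Λ ξ).re ≤ - (σ ^ 2 * ξ ^ 2 / 2) := by
  rw [levyExponent_eq, Complex.add_re, Complex.sub_re]
  have h1 : (∫ y, jumpChar ξ y ∂Λ).re ≤ 0 := by
    have : (∫ y, jumpChar ξ y ∂Λ).re = ∫ y, (jumpChar ξ y).re ∂Λ :=
      (integral_re (integrable_jumpChar hΛ ξ)).symm
    rw [this]
    refine integral_nonpos fun y => ?_
    rw [re_jumpChar]
    simpa using Real.cos_le_one (ξ * y)
  have h2 : (Complex.I * b * ξ).re = 0 := by simp
  have h3 : ((σ : ℂ) ^ 2 * (ξ : ℂ) ^ 2 / 2).re = σ ^ 2 * ξ ^ 2 / 2 := by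
    have : ((σ : ℂ) ^ 2 * (ξ : ℂ) ^ 2 / 2) = ((σ ^ 2 * ξ ^ 2 / 2 : ℝ) : ℂ) := by push_cast; rfl
    rw [this, Complex.ofReal_re]
  rw [h2, h3]
  linarith

theorem re_levyExponent_nonpos {Λ : Measure ℝ} (hΛ : IsLevyMeasure Λ) (b σ ξ : ℝ) :
    (levyExponent b σ Λ ξ).re ≤ 0 :=
  (re_levyExponent_le hΛ b σ ξ).trans (by have : 0 ≤ σ ^ 2 * ξ ^ 2 / 2 := by positivity
                                          linarith)

theorem measurable_levyExponent {Λ : Measure ℝ} (hΛ : IsLevyMeasure Λ) (b σ : ℝ) :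
    Measurable (levyExponent b σ Λ) := by
  have := hΛ.sigmaFinite
  have h : Measurable fun ξ : ℝ => ∫ y, jumpChar ξ y ∂Λ :=
    (measurable_jumpChar.stronglyMeasurable.integral_prod_right (ν := Λ)).measurable
  have h2 : Measurable fun ξ : ℝ => Complex.I * b * ξ - (σ : ℂ) ^ 2 * (ξ : ℂ) ^ 2 / 2 := by
    fun_prop
  exact h2.add h

theorem norm_integral_jumpChar_le {Λ : Measure ℝ} (hΛ : IsLevyMeasure Λ) (ξ : ℝ) :
    ‖∫ y, jumpChar ξ y ∂Λ‖ ≤ 2 * (∫ y, min 1 (y ^ 2) ∂Λ) * (1 + ξ ^ 2) := by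
  refine (norm_integral_le_of_norm_le (hΛ.integrable_min.const_mul (2 * (1 + ξ ^ 2)))
    (ae_of_all _ fun y => norm_jumpChar_le ξ y)).trans (le_of_eq ?_)
  rw [integral_const_mul]; ring

theorem exists_norm_levyExponent_le {Λ : Measure ℝ} (hΛ : IsLevyMeasure Λ) (b σ : ℝ) :
    ∃ C, 0 ≤ C ∧ ∀ ξ, ‖levyExponent b σ Λ ξ‖ ≤ C * (1 + ξ ^ 2) := by
  refine ⟨|b| + σ ^ 2 + 2 * ∫ y, min 1 (y ^ 2) ∂Λ, ?_, fun ξ => ?_⟩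
  · have : 0 ≤ ∫ y, min 1 (y ^ 2) ∂Λ := integral_nonneg fun y => by positivity
    positivity
  · rw [levyExponent_eq]
    refine (norm_add_le _ _).trans ?_
    have h1 := norm_integral_jumpChar_le hΛ ξ
    have h2 : ‖Complex.I * b * ξ - (σ : ℂ) ^ 2 * (ξ : ℂ) ^ 2 / 2‖ ≤
        |b| * |ξ| + σ ^ 2 * ξ ^ 2 / 2 := by
      refine (norm_sub_le _ _).trans (le_of_eq ?_)
      simp
    have h3 : |b| * |ξ| ≤ |b| * (1 + ξ ^ 2) := by
      gcongr
      nlinarith [sq_abs ξ, sq_nonneg (|ξ| - 1), sq_nonneg |ξ|]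
    nlinarith [sq_nonneg σ, sq_nonneg ξ, mul_nonneg (sq_nonneg σ) (sq_nonneg ξ)]

/-- The Gaussian part dominates the exponent at high frequencies. -/
theorem tendsto_levyExponent_div_sq {Λ : Measure ℝ} (hΛ : IsLevyMeasure Λ) (b σ ξ : ℝ) :
    Tendsto (fun h : ℝ => ((h ^ 2 : ℝ) : ℂ) * levyExponent b σ Λ (ξ / h)) (𝓝[>] 0)
      (𝓝 (-((σ : ℂ) ^ 2 * (ξ : ℂ) ^ 2 / 2))) := by
  have hj : Tendsto (fun h : ℝ => ∫ y, ((h ^ 2 : ℝ) : ℂ) * jumpChar (ξ / h) y ∂Λ) (𝓝[>] 0)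
      (𝓝 (∫ _, (0 : ℂ) ∂Λ)) := by
    refine tendsto_integral_filter_of_dominated_convergence
      (fun y => 2 * (1 + ξ ^ 2) * min 1 (y ^ 2)) ?_ ?_ (hΛ.integrable_min.const_mul _) ?_
    · exact Eventually.of_forall fun h =>
        ((measurable_jumpChar_right (ξ / h)).const_mul _).aestronglyMeasurable
    · filter_upwards [Ioo_mem_nhdsGT (zero_lt_one (α := ℝ))] with h hh
      refine ae_of_all _ fun y => ?_
      rw [norm_mul, Complex.norm_real, Real.norm_of_nonneg (sq_nonneg h)]
      refine (mul_le_mul_of_nonneg_left (norm_jumpChar_le (ξ / h) y) (sq_nonneg h)).trans ?_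
      have e : h ^ 2 * (2 * (1 + (ξ / h) ^ 2) * min 1 (y ^ 2)) =
          2 * (h ^ 2 + ξ ^ 2) * min 1 (y ^ 2) := by
        have := hh.1.ne'
        field_simp
      rw [e]
      gcongr
      nlinarith [hh.1, hh.2]
    · refine ae_of_all _ fun y => ?_
      -- For a fixed jump the integrand grows only linearly in `ξ / h`, so the factor `h ^ 2` wins
      -- pointwise; the domination above is uniform because `h ^ 2 * (1 + (ξ / h) ^ 2)` stays
      -- bounded.
      have hb : ∀ h : ℝ, 0 < h → ‖((h ^ 2 : ℝ) : ℂ) * jumpChar (ξ / h) y‖ ≤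
          h ^ 2 * 2 + h * |ξ| * |truncJump y| := by
        intro h hh
        rw [norm_mul, Complex.norm_real, Real.norm_of_nonneg (sq_nonneg h)]
        have : ‖jumpChar (ξ / h) y‖ ≤ 2 + |ξ / h| * |truncJump y| := by
          unfold jumpChar
          refine (norm_sub_le _ _).trans (add_le_add ((norm_sub_le _ _).trans ?_) (le_of_eq ?_))
          · rw [norm_cexp_I_mul]; norm_num
          · rw [norm_mul, norm_mul, Complex.norm_I, one_mul, Complex.norm_real, Complex.norm_real]
            rfl
        refine (mul_le_mul_of_nonneg_left this (sq_nonneg h)).trans (le_of_eq ?_)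
        rw [abs_div, abs_of_pos hh]
        field_simp
      have hlim : Tendsto (fun h : ℝ => h ^ 2 * 2 + h * |ξ| * |truncJump y|) (𝓝[>] 0) (𝓝 0) := by
        have : Continuous (fun h : ℝ => h ^ 2 * 2 + h * |ξ| * |truncJump y|) := by fun_prop
        simpa using (this.tendsto 0).mono_left nhdsWithin_le_nhds
      refine squeeze_zero_norm' ?_ hlim
      filter_upwards [self_mem_nhdsWithin] with h hh using hb h hh
  have hd : Tendsto (fun h : ℝ => Complex.I * b * ξ * h - (σ : ℂ) ^ 2 * (ξ : ℂ) ^ 2 / 2) (𝓝[>] 0)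
      (𝓝 (Complex.I * b * ξ * (0 : ℝ) - (σ : ℂ) ^ 2 * (ξ : ℂ) ^ 2 / 2)) := by
    have : Continuous (fun h : ℝ => Complex.I * b * ξ * h - (σ : ℂ) ^ 2 * (ξ : ℂ) ^ 2 / 2) := by
      fun_prop
    exact (this.tendsto 0).mono_left nhdsWithin_le_nhds
  have := hd.add hj
  simp only [Complex.ofReal_zero, mul_zero, zero_sub, integral_zero, add_zero] at this
  refine this.congr' ?_
  filter_upwards [self_mem_nhdsWithin] with h hh
  have hne : (h : ℂ) ≠ 0 := Complex.ofReal_ne_zero.2 (ne_of_gt hh)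
  rw [integral_const_mul, levyExponent_eq]
  push_cast
  field_simp

/-! ### Fourier inversion for finite measures, by Gaussian smoothing. -/

theorem integral_gaussian_mul_cexp {s : ℝ≥0} (hs : s ≠ 0) (x y : ℝ) :
    ∫ v : ℝ, (Real.exp (-(2 * Real.pi ^ 2 * s * v ^ 2)) : ℂ) *
      Complex.exp (2 * Real.pi * v * (y - x) * Complex.I) = (gaussianPDFReal x s y : ℂ) := by
  have hs0 : (0 : ℝ) < s := by positivity
  have hb : 0 < ((2 * Real.pi ^ 2 * s : ℝ) : ℂ).re := by
    rw [Complex.ofReal_re]; positivity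
  have h := fourierIntegral_gaussian hb ((2 * Real.pi * (y - x) : ℝ) : ℂ)
  have e1 : ((Real.pi : ℂ) / ((2 * Real.pi ^ 2 * s : ℝ) : ℂ)) ^ (1 / 2 : ℂ) =
      (((√(2 * Real.pi * s))⁻¹ : ℝ) : ℂ) := by
    have : ((Real.pi : ℂ) / ((2 * Real.pi ^ 2 * s : ℝ) : ℂ)) =
        (((2 * Real.pi * s)⁻¹ : ℝ) : ℂ) := by
      push_cast
      have : (Real.pi : ℂ) ≠ 0 := Complex.ofReal_ne_zero.2 Real.pi_ne_zero
      have : ((s : ℝ) : ℂ) ≠ 0 := Complex.ofReal_ne_zero.2 hs0.ne'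
      field_simp
    rw [this]
    have h2 : (1 / 2 : ℂ) = ((1 / 2 : ℝ) : ℂ) := by push_cast; rfl
    rw [h2, ← Complex.ofReal_cpow (by positivity), ← Real.sqrt_eq_rpow, Real.sqrt_inv]
  rw [e1] at h
  have e2 : Complex.exp (-((2 * Real.pi * (y - x) : ℝ) : ℂ) ^ 2 /
      (4 * ((2 * Real.pi ^ 2 * s : ℝ) : ℂ))) = (Real.exp (-(y - x) ^ 2 / (2 * s)) : ℂ) := by
    rw [Complex.ofReal_exp]
    congr 1
    push_cast
    have : (Real.pi : ℂ) ≠ 0 := Complex.ofReal_ne_zero.2 Real.pi_ne_zero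
    have : ((s : ℝ) : ℂ) ≠ 0 := Complex.ofReal_ne_zero.2 hs0.ne'
    field_simp
    ring
  rw [e2] at h
  rw [gaussianPDFReal, Complex.ofReal_mul, ← h]
  congr 1
  ext v
  rw [mul_comm, Complex.ofReal_exp]
  congr 2
  · push_cast; ring
  · push_cast; ring

/-- Gaussian smoothing expressed through the characteristic function. -/
theorem integral_gaussianPDFReal_eq {ν : Measure ℝ} [IsFiniteMeasure ν] {s : ℝ≥0} (hs : s ≠ 0)
    (x : ℝ) :
    ((∫ y, gaussianPDFReal x s y ∂ν : ℝ) : ℂ) =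
      ∫ v : ℝ, (Real.exp (-(2 * Real.pi ^ 2 * s * v ^ 2)) : ℂ) *
        (Complex.exp (-(2 * Real.pi * v * x * Complex.I)) * charFun ν (2 * Real.pi * v)) := by
  have hs0 : (0 : ℝ) < s := by positivity
  rw [← integral_complex_ofReal]
  simp_rw [← integral_gaussian_mul_cexp hs]
  have hg : Integrable (fun v : ℝ => Real.exp (-(2 * Real.pi ^ 2 * s * v ^ 2))) := by
    have := integrable_exp_neg_mul_sq (b := 2 * Real.pi ^ 2 * s) (by positivity)
    simpa only [neg_mul] using this
  rw [integral_integral_swap]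
  · congr 1
    ext v
    rw [charFun_apply_real, ← integral_const_mul, ← integral_const_mul]
    refine integral_congr_ae (ae_of_all _ fun y => ?_)
    simp only
    rw [← Complex.exp_add]
    congr 2
    push_cast
    ring
  · have : Integrable (fun q : ℝ × ℝ => (1 : ℝ) * Real.exp (-(2 * Real.pi ^ 2 * s * q.2 ^ 2)))
        (ν.prod volume) := Integrable.mul_prod (integrable_const (1 : ℝ)) hg
    refine this.mono' (by fun_prop) (ae_of_all _ fun q => ?_)
    simp only [Function.uncurry]
    rw [norm_mul, Complex.norm_real, Real.norm_of_nonneg (Real.exp_pos _).le, one_mul]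
    have e : (2 * Real.pi * q.2 * (q.1 - x) * Complex.I : ℂ) =
      ((2 * Real.pi * q.2 * (q.1 - x) : ℝ) : ℂ) * Complex.I := by push_cast; ring
    rw [e, Complex.norm_exp_ofReal_mul_I, mul_one]

theorem integrable_charFun_two_pi {ν : Measure ℝ} (h : Integrable (charFun ν)) :
    Integrable (fun v : ℝ => charFun ν (2 * Real.pi * v)) :=
  h.comp_mul_left' (by positivity)

theorem fourier_charFun_eq (ν : Measure ℝ) (x : ℝ) :
    𝓕 (fun v : ℝ => charFun ν (2 * Real.pi * v)) x = ∫ v : ℝ,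
      Complex.exp (-(2 * Real.pi * v * x * Complex.I)) * charFun ν (2 * Real.pi * v) := by
  rw [Real.fourier_real_eq_integral_exp_smul]
  congr 1
  ext v
  rw [smul_eq_mul]
  congr 2
  push_cast
  ring

theorem tendsto_gaussian_smoothing {ν : Measure ℝ} [IsFiniteMeasure ν]
    (h : Integrable (charFun ν)) (x : ℝ) :
    Tendsto (fun n : ℕ => ((∫ y, gaussianPDFReal x (1 / ((n : ℝ≥0) + 1)) y ∂ν : ℝ) : ℂ)) atTop
      (𝓝 (𝓕 (fun v : ℝ => charFun ν (2 * Real.pi * v)) x)) := by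
  have hne : ∀ n : ℕ, (1 / ((n : ℝ≥0) + 1)) ≠ 0 := fun n => by positivity
  simp_rw [integral_gaussianPDFReal_eq (hne _), fourier_charFun_eq]
  have hc : Continuous (charFun ν) := continuous_charFun
  refine tendsto_integral_of_dominated_convergence
    (fun v => ‖charFun ν (2 * Real.pi * v)‖) (fun n => ?_) (integrable_charFun_two_pi h).norm
    (fun n => ae_of_all _ fun v => ?_) (ae_of_all _ fun v => ?_)
  · have : Continuous fun v : ℝ => charFun ν (2 * Real.pi * v) := hc.comp (by fun_prop)
    exact Continuous.aestronglyMeasurable (by fun_prop)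
  · rw [norm_mul, norm_mul, Complex.norm_real, Real.norm_of_nonneg (Real.exp_pos _).le]
    have e : (-(2 * Real.pi * v * x * Complex.I) : ℂ) =
      ((-(2 * Real.pi * v * x) : ℝ) : ℂ) * Complex.I := by push_cast; ring
    rw [e, Complex.norm_exp_ofReal_mul_I, one_mul]
    refine mul_le_of_le_one_left (norm_nonneg _) (Real.exp_le_one_iff.2 ?_)
    have : 0 ≤ 2 * Real.pi ^ 2 * ((1 / ((n : ℝ≥0) + 1) : ℝ≥0) : ℝ) * v ^ 2 := by positivity
    linarith
  · have h1 : Tendsto (fun n : ℕ => Real.exp (-(2 * Real.pi ^ 2 *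
        ((1 / ((n : ℝ≥0) + 1) : ℝ≥0) : ℝ) * v ^ 2))) atTop (𝓝 1) := by
      have h0 : Tendsto (fun n : ℕ => ((1 / ((n : ℝ≥0) + 1) : ℝ≥0) : ℝ)) atTop (𝓝 0) := by
        push_cast
        exact tendsto_one_div_add_atTop_nhds_zero_nat
      have := ((h0.const_mul (2 * Real.pi ^ 2)).mul_const (v ^ 2)).neg.rexp
      simpa using this
    have h2 := (Complex.continuous_ofReal.tendsto _).comp h1
    have := h2.mul_const (Complex.exp (-(2 * Real.pi * v * x * Complex.I)) *
      charFun ν (2 * Real.pi * v))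
    simpa only [Function.comp_def, Complex.ofReal_one, one_mul] using this

/-- **Fourier inversion for measures**: a finite measure with integrable characteristic function
has a continuous nonnegative density. -/
theorem exists_density_of_integrable_charFun {ν : Measure ℝ} [IsFiniteMeasure ν]
    (h : Integrable (charFun ν)) :
    ∃ w : ℝ → ℝ, Continuous w ∧ (∀ x, 0 ≤ w x) ∧ Integrable w ∧
      (∀ x, (w x : ℂ) = 𝓕 (fun v : ℝ => charFun ν (2 * Real.pi * v)) x) ∧
      ν = volume.withDensity (fun x => ENNReal.ofReal (w x)) := by
  set V : ℝ → ℂ := fun v => charFun ν (2 * Real.pi * v) with hV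
  have hVc : Continuous V := continuous_charFun.comp (by fun_prop)
  have hVi : Integrable V := integrable_charFun_two_pi h
  set w : ℝ → ℝ := fun x => (𝓕 V x).re with hw
  have hlim := fun x => tendsto_gaussian_smoothing h x
  have hlimre : ∀ x, Tendsto (fun n : ℕ => ∫ y, gaussianPDFReal x (1 / ((n : ℝ≥0) + 1)) y ∂ν)
      atTop (𝓝 (w x)) := fun x =>
    (Complex.continuous_re.tendsto _).comp (hlim x)
  have heq : ∀ x, (w x : ℂ) = 𝓕 V x := by
    intro x
    have h1 := (Complex.continuous_ofReal.tendsto _).comp (hlimre x)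
    exact tendsto_nhds_unique h1 (hlim x)
  have hFc : Continuous (𝓕 V) :=
    VectorFourier.fourierIntegral_continuous Real.continuous_fourierChar continuous_inner hVi
  have hwc : Continuous w := Complex.continuous_re.comp hFc
  have hw0 : ∀ x, 0 ≤ w x := fun x =>
    ge_of_tendsto' (hlimre x) fun n => integral_nonneg fun y => gaussianPDFReal_nonneg _ _ _
  -- Only an inequality is needed, so integrability need not be checked: a non-integrable kernel has
  -- Bochner integral `0`.
  have hgint : ∀ (s : ℝ≥0) (x : ℝ), ENNReal.ofReal (∫ y, gaussianPDFReal x s y ∂ν) ≤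
      ∫⁻ y, gaussianPDF x s y ∂ν := by
    intro s x
    by_cases hi : Integrable (gaussianPDFReal x s) ν
    · rw [ofReal_integral_eq_lintegral_ofReal hi (ae_of_all _ fun y => gaussianPDFReal_nonneg _ _ _)]
      rfl
    · rw [integral_undef hi]; simp
  -- Fatou's lemma: `w` is a limit of Gaussian smoothings of `ν`, each of mass `ν univ` because the
  -- Gaussian kernel is symmetric in its two points.
  have hwi : Integrable w := by
    refine ⟨hwc.aestronglyMeasurable, ?_⟩
    rw [hasFiniteIntegral_iff_ofReal (ae_of_all _ hw0)]
    have hpt : ∀ x, ENNReal.ofReal (w x) ≤ liminf (fun n : ℕ =>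
        ∫⁻ y, gaussianPDF x (1 / ((n : ℝ≥0) + 1)) y ∂ν) atTop := by
      intro x
      rw [← (ENNReal.tendsto_ofReal (hlimre x)).liminf_eq]
      exact liminf_le_liminf (Eventually.of_forall fun n => hgint _ _)
    have hmeas : ∀ s : ℝ≥0, Measurable (fun q : ℝ × ℝ => gaussianPDF q.1 s q.2) := by
      intro s
      unfold gaussianPDF gaussianPDFReal
      fun_prop
    calc ∫⁻ x, ENNReal.ofReal (w x) ≤ ∫⁻ x, liminf (fun n : ℕ =>
          ∫⁻ y, gaussianPDF x (1 / ((n : ℝ≥0) + 1)) y ∂ν) atTop := lintegral_mono hpt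
      _ ≤ liminf (fun n : ℕ => ∫⁻ x, ∫⁻ y, gaussianPDF x (1 / ((n : ℝ≥0) + 1)) y ∂ν) atTop :=
          lintegral_liminf_le fun n => (hmeas _).lintegral_prod_right'
      _ = liminf (fun _ : ℕ => ν univ) atTop := by
          congr 1
          ext n
          rw [lintegral_lintegral_swap (hmeas _).aemeasurable]
          have : ∀ y, ∫⁻ x, gaussianPDF x (1 / ((n : ℝ≥0) + 1)) y = 1 := by
            intro y
            have e : ∀ x, gaussianPDF x (1 / ((n : ℝ≥0) + 1)) y =
                gaussianPDF y (1 / ((n : ℝ≥0) + 1)) x := by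
              intro x
              unfold gaussianPDF gaussianPDFReal
              rw [show (y - x) ^ 2 = (x - y) ^ 2 by ring]
            simp_rw [e]
            exact lintegral_gaussianPDF_eq_one y (by positivity)
          simp only [this, lintegral_one]
      _ < ∞ := by simp
  refine ⟨w, hwc, hw0, hwi, heq, ?_⟩
  have : IsFiniteMeasure (volume.withDensity (fun x => ENNReal.ofReal (w x))) :=
    isFiniteMeasure_withDensity_ofReal hwi.2
  -- Now that `w` is integrable, classical inversion applies to the continuous function `V` and
  -- recovers the characteristic function of `ν`.
  refine Measure.ext_of_charFun (funext fun ξ => ?_)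
  have hF : (fun x => (w x : ℂ)) = 𝓕 V := funext heq
  have hFi : Integrable (𝓕 V) := by rw [← hF]; exact hwi.ofReal
  have hinv : 𝓕⁻ (𝓕 V) (ξ / (2 * Real.pi)) = V (ξ / (2 * Real.pi)) := by
    rw [hVc.fourierInv_fourier_eq hVi hFi]
  have e1 : V (ξ / (2 * Real.pi)) = charFun ν ξ := by
    simp only [hV]
    congr 1
    field_simp
  rw [← e1, ← hinv, Real.fourierInv_eq', charFun_apply_real,
    integral_withDensity_eq_integral_toReal_smul (by fun_prop) (by simp)]
  congr 1
  ext x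
  rw [ENNReal.toReal_ofReal (hw0 x), ← heq, smul_eq_mul, mul_comm, Complex.real_smul]
  congr 1
  congr 1
  simp only [RCLike.inner_apply, conj_trivial]
  push_cast
  have : (Real.pi : ℂ) ≠ 0 := Complex.ofReal_ne_zero.2 Real.pi_ne_zero
  field_simp

/-! ### The generator as a Fourier multiplier and the evolution of `ν ∗ p t`. -/

/-- The generator of the Lévy process with triplet `(b, σ, Λ)`. -/
noncomputable def levyGenerator (b σ : ℝ) (Λ : Measure ℝ) (f : ℝ → ℝ) (x : ℝ) : ℝ :=
  σ ^ 2 / 2 * deriv (deriv f) x + b * deriv f x +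
    ∫ y, (f (x + y) - f x - truncJump y * deriv f x) ∂Λ

/-- The convolution semigroup of a Lévy process with triplet `(b, σ, Λ)`. -/
structure IsLevySemigroup (p : ℝ≥0 → Measure ℝ) (b σ : ℝ) (Λ : Measure ℝ) : Prop where
  prob : ∀ t, IsProbabilityMeasure (p t)
  charFun_eq : ∀ (t : ℝ≥0) (ξ : ℝ),
    charFun (p t) ξ = Complex.exp ((t : ℝ) * levyExponent b σ Λ ξ)

/-- The function with inverse Fourier transform data `G`. -/
noncomputable def fourierSynth (G : ℝ → ℂ) (x : ℝ) : ℂ :=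
  ∫ v : ℝ, Complex.exp (Complex.I * ((2 * Real.pi * v : ℝ) : ℂ) * x) * G v

theorem fourierSynth_eq_fourierInv (G : ℝ → ℂ) : fourierSynth G = 𝓕⁻ G := by
  ext x
  rw [Real.fourierInv_eq']
  unfold fourierSynth
  congr 1
  ext v
  rw [smul_eq_mul]
  congr 2
  simp only [RCLike.inner_apply, conj_trivial]
  push_cast
  ring

theorem fourierSynth_eq_fourier (G : ℝ → ℂ) (x : ℝ) : fourierSynth G x = 𝓕 G (-x) := by
  rw [fourierSynth_eq_fourierInv, Real.fourierInv_eq_fourier_neg]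

theorem continuous_fourier {G : ℝ → ℂ} (hG : Integrable G) : Continuous (𝓕 G) :=
  VectorFourier.fourierIntegral_continuous Real.continuous_fourierChar continuous_inner hG

theorem continuous_fourierSynth {G : ℝ → ℂ} (hG : Integrable G) : Continuous (fourierSynth G) := by
  have : fourierSynth G = fun x => 𝓕 G (-x) := funext (fourierSynth_eq_fourier G)
  rw [this]
  exact (continuous_fourier hG).comp continuous_neg

theorem hasDerivAt_fourierSynth {G : ℝ → ℂ} (hG : Integrable G)
    (hG' : Integrable (fun v => ((2 * Real.pi * v : ℝ) : ℂ) * G v)) (x : ℝ) :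
    HasDerivAt (fourierSynth G)
      (fourierSynth (fun v => Complex.I * ((2 * Real.pi * v : ℝ) : ℂ) * G v) x) x := by
  have h1 : Integrable (fun v : ℝ => v • G v) := by
    have := hG'.const_mul ((2 * Real.pi : ℝ) : ℂ)⁻¹
    refine this.congr (ae_of_all _ fun v => ?_)
    simp only [Complex.real_smul]
    have : (Real.pi : ℂ) ≠ 0 := Complex.ofReal_ne_zero.2 Real.pi_ne_zero
    push_cast
    field_simp
  have h2 := (Real.hasDerivAt_fourier hG h1 (-x)).scomp x (hasDerivAt_neg x)
  have e : fourierSynth G = 𝓕 G ∘ Neg.neg := funext (fourierSynth_eq_fourier G)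
  rw [e]
  refine h2.congr_deriv ?_
  rw [fourierSynth_eq_fourier, Real.fourier_real_eq_integral_exp_smul,
    Real.fourier_real_eq_integral_exp_smul, ← integral_smul]
  congr 1
  ext v
  simp only [smul_eq_mul, Complex.real_smul]
  push_cast
  ring

/-- Fubini moves the pairing of a test function with `ρ` to the Fourier side, where only `charFun ρ`
enters. For `ρ ∗ p t` this is explicit, so time derivatives become derivatives of exponentials. -/
theorem integral_fourierSynth {G : ℝ → ℂ} (hG : Integrable G) (ρ : Measure ℝ)
    [IsFiniteMeasure ρ] :
    ∫ x, fourierSynth G x ∂ρ = ∫ v, G v * charFun ρ (2 * Real.pi * v) := by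
  unfold fourierSynth
  rw [integral_integral_swap]
  · congr 1
    ext v
    rw [integral_mul_const, charFun_apply_real, mul_comm]
    congr 2
    ext x
    congr 1
    ring
  · have h : Integrable (fun q : ℝ × ℝ => (1 : ℂ) * G q.2) (ρ.prod volume) :=
      Integrable.mul_prod (integrable_const (1 : ℂ)) hG
    refine h.norm.mono' ?_ (ae_of_all _ fun q => ?_)
    · have := h.aestronglyMeasurable
      simp only [one_mul] at this
      exact AEStronglyMeasurable.mul (by fun_prop) this
    · simp only [Function.uncurry]
      rw [norm_mul, norm_cexp_I_mul, norm_mul, norm_one]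

/-- Smooth compactly supported functions are Fourier integrals of rapidly decreasing functions. -/
theorem exists_fourierSynth_eq {f : ℝ → ℝ} (hf : ContDiff ℝ ((⊤ : ℕ∞) : WithTop ℕ∞) f) (hfc : HasCompactSupport f) :
    ∃ F : ℝ → ℂ, Continuous F ∧ Integrable (fun v => (1 + (2 * Real.pi * v) ^ 2) * ‖F v‖) ∧
      ∀ x, (f x : ℂ) = fourierSynth F x := by
  have h1 : HasCompactSupport (fun x => (f x : ℂ)) :=
    hfc.comp_left (g := fun x : ℝ => (x : ℂ)) Complex.ofReal_zero
  have h2 : ContDiff ℝ ((⊤ : ℕ∞) : WithTop ℕ∞) (fun x => (f x : ℂ)) := Complex.ofRealCLM.contDiff.comp hf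
  set φ : SchwartzMap ℝ ℂ := h1.toSchwartzMap h2 with hφ
  have hφv : ∀ x, φ x = (f x : ℂ) := fun x => rfl
  set F : SchwartzMap ℝ ℂ := 𝓕 φ with hF
  refine ⟨F, F.continuous, ?_, fun x => ?_⟩
  · have i0 : Integrable (fun v => ‖F v‖) := F.integrable.norm
    have i2 := F.integrable_pow_mul volume 2
    have := i0.add (i2.const_mul ((2 * Real.pi) ^ 2))
    refine this.congr (ae_of_all _ fun v => ?_)
    simp only [Pi.add_apply, Real.norm_eq_abs, sq_abs]
    ring
  · rw [fourierSynth_eq_fourierInv, ← hφv]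
    have : ((𝓕⁻ F : SchwartzMap ℝ ℂ) : ℝ → ℂ) x = φ x := by
      rw [hF, FourierTransform.fourierInv_fourier_eq]
    rw [← this, SchwartzMap.fourierInv_coe]

/-- Every multiplier met here (`ξ`, `ξ ^ 2`, the exponent) grows at most quadratically, and this
weight absorbs all of them. -/
theorem integrable_of_one_add_sq {F : ℝ → ℂ} (hFm : AEStronglyMeasurable F)
    (hF : Integrable (fun v => (1 + (2 * Real.pi * v) ^ 2) * ‖F v‖)) {k : ℝ → ℂ} {C : ℝ}
    (hk : AEStronglyMeasurable k) (hkC : ∀ v, ‖k v‖ ≤ C * (1 + (2 * Real.pi * v) ^ 2)) :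
    Integrable (fun v => k v * F v) := by
  refine (hF.const_mul C).mono' (hk.mul hFm) (ae_of_all _ fun v => ?_)
  rw [norm_mul, ← mul_assoc]
  exact mul_le_mul_of_nonneg_right (hkC v) (norm_nonneg _)

/-- The generator is the Fourier multiplier with symbol the Lévy–Khintchine exponent. -/
theorem levyGenerator_eq_fourierSynth {Λ : Measure ℝ} (hΛ : IsLevyMeasure Λ) (b σ : ℝ)
    {f : ℝ → ℝ} {F : ℝ → ℂ} (hFc : Continuous F)
    (hF : Integrable (fun v => (1 + (2 * Real.pi * v) ^ 2) * ‖F v‖))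
    (hf : ∀ x, (f x : ℂ) = fourierSynth F x) (x : ℝ) :
    (levyGenerator b σ Λ f x : ℂ) =
      fourierSynth (fun v => levyExponent b σ Λ (2 * Real.pi * v) * F v) x := by
  have hsf := hΛ.sigmaFinite
  have hFm := hFc.aestronglyMeasurable (μ := volume)
  have i0 : Integrable F := by
    have := integrable_of_one_add_sq hFm hF (k := fun _ => 1) (C := 1) (by fun_prop)
      (fun v => by rw [norm_one]; nlinarith [sq_nonneg (2 * Real.pi * v)])
    simpa using this
  have i1 : Integrable (fun v => ((2 * Real.pi * v : ℝ) : ℂ) * F v) := by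
    refine integrable_of_one_add_sq hFm hF (C := 1) (by fun_prop) (fun v => ?_)
    rw [Complex.norm_real, Real.norm_eq_abs]
    nlinarith [sq_abs (2 * Real.pi * v), sq_nonneg (|2 * Real.pi * v| - 1)]
  have i1' : Integrable (fun v => Complex.I * ((2 * Real.pi * v : ℝ) : ℂ) * F v) := by
    simpa only [mul_assoc] using i1.const_mul Complex.I
  have i2 : Integrable (fun v => ((2 * Real.pi * v : ℝ) : ℂ) *
      (Complex.I * ((2 * Real.pi * v : ℝ) : ℂ) * F v)) := by
    have := integrable_of_one_add_sq hFm hF (C := 1)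
      (k := fun v => ((2 * Real.pi * v : ℝ) : ℂ) * (Complex.I * ((2 * Real.pi * v : ℝ) : ℂ)))
      (by fun_prop) (fun v => by
        rw [norm_mul, norm_mul, Complex.norm_I, Complex.norm_real, Real.norm_eq_abs, one_mul,
          abs_mul_abs_self]
        nlinarith [sq_nonneg (2 * Real.pi * v)])
    simpa only [mul_assoc] using this
  have hfS : (fun x => (f x : ℂ)) = fourierSynth F := funext hf
  have d1c : ∀ x, HasDerivAt (fun x => (f x : ℂ))
      (fourierSynth (fun v => Complex.I * ((2 * Real.pi * v : ℝ) : ℂ) * F v) x) x := fun x => by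
    rw [hfS]; exact hasDerivAt_fourierSynth i0 i1 x
  have real_deriv : ∀ {g : ℝ → ℝ} {g' : ℝ → ℂ}, (∀ x, HasDerivAt (fun x => (g x : ℂ)) (g' x) x) →
      ∀ x, ((deriv g x : ℝ) : ℂ) = g' x := by
    intro g g' h x
    have h1 : HasDerivAt g (g' x).re x := by
      have h2 := Complex.reCLM.hasFDerivAt.comp_hasDerivAt x (h x)
      simpa [Function.comp_def] using h2
    exact ((h1.deriv ▸ h1).ofReal_comp).unique (h x)
  have d1 : ∀ x, ((deriv f x : ℝ) : ℂ) =
      fourierSynth (fun v => Complex.I * ((2 * Real.pi * v : ℝ) : ℂ) * F v) x := real_deriv d1c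
  have d2c : ∀ x, HasDerivAt (fun x => ((deriv f x : ℝ) : ℂ))
      (fourierSynth (fun v => Complex.I * ((2 * Real.pi * v : ℝ) : ℂ) *
        (Complex.I * ((2 * Real.pi * v : ℝ) : ℂ) * F v)) x) x := fun x => by
    rw [show (fun x => ((deriv f x : ℝ) : ℂ)) = _ from funext d1]
    exact hasDerivAt_fourierSynth i1' i2 x
  have d2 := real_deriv d2c x
  set e : ℝ → ℂ := fun v => Complex.exp (Complex.I * ((2 * Real.pi * v : ℝ) : ℂ) * x) with he
  have hen : ∀ v, ‖e v‖ = 1 := fun v => norm_cexp_I_mul _ _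
  have hec : Continuous e := by fun_prop
  have je : ∀ {G : ℝ → ℂ}, Integrable G → Integrable (fun v => e v * G v) := fun {G} hG => by
    refine hG.norm.mono' (hec.aestronglyMeasurable.mul hG.aestronglyMeasurable)
      (ae_of_all _ fun v => ?_)
    rw [norm_mul, hen, one_mul]
  have hjump : ((∫ y, (f (x + y) - f x - truncJump y * deriv f x) ∂Λ : ℝ) : ℂ) =
      ∫ v, e v * ((∫ y, jumpChar (2 * Real.pi * v) y ∂Λ) * F v) := by
    rw [← integral_complex_ofReal]
    have hpt : ∀ y, ((f (x + y) - f x - truncJump y * deriv f x : ℝ) : ℂ) =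
        ∫ v, e v * (jumpChar (2 * Real.pi * v) y * F v) := by
      intro y
      push_cast
      rw [hf, hf, d1]
      unfold fourierSynth
      have i3 : Integrable (fun v => Complex.exp (Complex.I * ((2 * Real.pi * v : ℝ) : ℂ) *
          ((x + y : ℝ) : ℂ)) * F v) := by
        refine i0.norm.mono' (by fun_prop) (ae_of_all _ fun v => ?_)
        rw [norm_mul, norm_cexp_I_mul, one_mul]
      have i5 : Integrable (fun v => Complex.exp (Complex.I * ((2 * Real.pi * v : ℝ) : ℂ) *
          ((x + y : ℝ) : ℂ)) * F v - e v * F v) := i3.sub (je i0)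
      rw [← integral_const_mul, ← integral_sub i3 (je i0), ← integral_sub i5
        ((je i1').const_mul _)]
      congr 1
      ext v
      simp only [jumpChar, he]
      have : Complex.exp (Complex.I * ((2 * Real.pi * v : ℝ) : ℂ) * ((x + y : ℝ) : ℂ)) =
          Complex.exp (Complex.I * ((2 * Real.pi * v : ℝ) : ℂ) * x) *
          Complex.exp (Complex.I * ((2 * Real.pi * v : ℝ) : ℂ) * y) := by
        rw [← Complex.exp_add]; congr 1; push_cast; ring
      rw [this]
      ring
    simp_rw [hpt]
    rw [integral_integral_swap]
    · congr 1
      ext v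
      rw [integral_const_mul, integral_mul_const]
    -- The bound on `jumpChar` factors into `min 1 (y ^ 2)`, integrable for `Λ`, and a quadratic
    -- weight in the frequency, integrable against `F`; this justifies Fubini.
    · have h : Integrable (fun q : ℝ × ℝ => min 1 (q.1 ^ 2) *
          (2 * ((1 + (2 * Real.pi * q.2) ^ 2) * ‖F q.2‖))) (Λ.prod volume) :=
        Integrable.mul_prod hΛ.integrable_min (hF.const_mul 2)
      refine h.mono' ?_ (ae_of_all _ fun q => ?_)
      · have hm : Measurable (fun q : ℝ × ℝ => jumpChar (2 * Real.pi * q.2) q.1) :=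
          measurable_jumpChar.comp (f := fun q : ℝ × ℝ => (2 * Real.pi * q.2, q.1)) (by fun_prop)
        have h3 : Measurable (fun q : ℝ × ℝ => e q.2 * (jumpChar (2 * Real.pi * q.2) q.1 * F q.2)) :=
          (hec.measurable.comp measurable_snd).mul
            (hm.mul (hFc.measurable.comp measurable_snd))
        exact h3.aestronglyMeasurable
      · simp only [Function.uncurry]
        rw [norm_mul, hen, one_mul, norm_mul]
        refine (mul_le_mul_of_nonneg_right (norm_jumpChar_le _ _) (norm_nonneg _)).trans
          (le_of_eq ?_)
        ring
  have i4 : Integrable (fun v => (∫ y, jumpChar (2 * Real.pi * v) y ∂Λ) * F v) := by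
    refine integrable_of_one_add_sq hFm hF ?_ (fun v => norm_integral_jumpChar_le hΛ _)
    have h : Measurable fun ξ : ℝ => ∫ y, jumpChar ξ y ∂Λ :=
      (measurable_jumpChar.stronglyMeasurable.integral_prod_right (ν := Λ)).measurable
    exact (h.comp (f := fun v : ℝ => 2 * Real.pi * v) (by fun_prop)).aestronglyMeasurable
  have i2' : Integrable (fun v => Complex.I * ((2 * Real.pi * v : ℝ) : ℂ) *
      (Complex.I * ((2 * Real.pi * v : ℝ) : ℂ) * F v)) := by
    simpa only [mul_assoc] using i2.const_mul Complex.I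
  unfold levyGenerator
  rw [Complex.ofReal_add, Complex.ofReal_add, hjump, Complex.ofReal_mul, Complex.ofReal_mul, d2, d1]
  unfold fourierSynth
  have i6 : Integrable (fun v => ((σ ^ 2 / 2 : ℝ) : ℂ) *
      (e v * (Complex.I * ((2 * Real.pi * v : ℝ) : ℂ) *
        (Complex.I * ((2 * Real.pi * v : ℝ) : ℂ) * F v))) +
      (b : ℂ) * (e v * (Complex.I * ((2 * Real.pi * v : ℝ) : ℂ) * F v))) :=
    ((je i2').const_mul _).add ((je i1').const_mul _)
  rw [← integral_const_mul, ← integral_const_mul,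
    ← integral_add ((je i2').const_mul _) ((je i1').const_mul _),
    ← integral_add i6 (je i4)]
  congr 1
  ext v
  simp only [levyExponent_eq, he]
  generalize Complex.exp (Complex.I * ((2 * Real.pi * v : ℝ) : ℂ) * x) = E
  push_cast
  -- The only nonformal point is `I ^ 2 = -1`, which turns two derivatives into `-ξ ^ 2`.
  linear_combination (σ ^ 2 / 2 * E * (2 * Real.pi * v) ^ 2 * F v : ℂ) * Complex.I_sq

/-- In the left half-plane the exponential has modulus at most one, so increments in time are
Lipschitz with constant `‖z‖`. It dominates difference quotients and also yields the `O(t)` bounds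
at small times. -/
theorem norm_cexp_mul_sub_le {z : ℂ} (hz : z.re ≤ 0) {s u : ℝ} (hs : 0 ≤ s) (hu : s ≤ u) :
    ‖Complex.exp (u * z) - Complex.exp (s * z)‖ ≤ ‖z‖ * (u - s) := by
  have hd : ∀ t ∈ Icc s u, HasDerivWithinAt (fun t : ℝ => Complex.exp (t * z))
      (z * Complex.exp (t * z)) (Icc s u) t := fun t _ => by
    simpa only [mul_comm z] using (hasDerivAt_cexp_mul z t).hasDerivWithinAt
  have hb : ∀ t ∈ Icc s u, ‖z * Complex.exp (t * z)‖ ≤ ‖z‖ := fun t ht => by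
    rw [norm_mul, Complex.norm_exp]
    refine mul_le_of_le_one_right (norm_nonneg _) (Real.exp_le_one_iff.2 ?_)
    rw [Complex.re_ofReal_mul]
    exact mul_nonpos_of_nonneg_of_nonpos (hs.trans ht.1) hz
  have := (convex_Icc s u).norm_image_sub_le_of_norm_hasDerivWithin_le hd hb
    (left_mem_Icc.2 hu) (right_mem_Icc.2 hu)
  rwa [Real.norm_of_nonneg (sub_nonneg.2 hu)] at this

section Semigroup

variable {p : ℝ≥0 → Measure ℝ} {b σ : ℝ} {Λ : Measure ℝ}

theorem IsLevySemigroup.charFun_conv_eq (hp : IsLevySemigroup p b σ Λ) (ρ : Measure ℝ)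
    [IsFiniteMeasure ρ] (t : ℝ≥0) (ξ : ℝ) :
    charFun (ρ ∗ p t) ξ = charFun ρ ξ * Complex.exp ((t : ℝ) * levyExponent b σ Λ ξ) := by
  have := hp.prob t
  rw [charFun_conv, hp.charFun_eq]

/-- The evolution equation of the convolution semigroup on smooth test functions. -/
theorem IsLevySemigroup.hasDerivWithinAt_integral_conv (hp : IsLevySemigroup p b σ Λ)
    (hΛ : IsLevyMeasure Λ) (ρ : Measure ℝ) [IsFiniteMeasure ρ]
    {f : ℝ → ℝ} (hf : ContDiff ℝ ((⊤ : ℕ∞) : WithTop ℕ∞) f) (hfc : HasCompactSupport f) {s : ℝ} (hs : 0 ≤ s) :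
    HasDerivWithinAt (fun t : ℝ => ∫ x, f x ∂(ρ ∗ p t.toNNReal))
      (∫ x, levyGenerator b σ Λ f x ∂(ρ ∗ p s.toNNReal)) (Ici s) s := by
  obtain ⟨F, hFc, hF, hfF⟩ := exists_fourierSynth_eq hf hfc
  have hFm := hFc.aestronglyMeasurable (μ := volume)
  set Ψ : ℝ → ℂ := fun v => levyExponent b σ Λ (2 * Real.pi * v) with hΨ
  have hΨm : Measurable Ψ := (measurable_levyExponent hΛ b σ).comp (by fun_prop)
  have hΨre : ∀ v, (Ψ v).re ≤ 0 := fun v => re_levyExponent_nonpos hΛ b σ _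
  obtain ⟨C, hC0, hC⟩ := exists_norm_levyExponent_le hΛ b σ
  have i0 : Integrable F := by
    have := integrable_of_one_add_sq hFm hF (k := fun _ => 1) (C := 1) (by fun_prop)
      (fun v => by rw [norm_one]; nlinarith [sq_nonneg (2 * Real.pi * v)])
    simpa using this
  have iΨ : Integrable (fun v => Ψ v * F v) :=
    integrable_of_one_add_sq hFm hF hΨm.aestronglyMeasurable (fun v => hC _)
  have hpr := hp.prob
  have hrep : ∀ t : ℝ, 0 ≤ t → ((∫ x, f x ∂(ρ ∗ p t.toNNReal) : ℝ) : ℂ) =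
      ∫ v, F v * (charFun ρ (2 * Real.pi * v) * Complex.exp (t * Ψ v)) := by
    intro t ht
    rw [← integral_complex_ofReal]
    simp_rw [hfF]
    rw [integral_fourierSynth i0]
    simp_rw [hp.charFun_conv_eq, Real.coe_toNNReal t ht, hΨ]
  have hder : ((∫ x, levyGenerator b σ Λ f x ∂(ρ ∗ p s.toNNReal) : ℝ) : ℂ) =
      ∫ v, F v * (charFun ρ (2 * Real.pi * v) * (Ψ v * Complex.exp (s * Ψ v))) := by
    rw [← integral_complex_ofReal]
    simp_rw [levyGenerator_eq_fourierSynth hΛ b σ hFc hF hfF]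
    rw [integral_fourierSynth iΨ]
    congr 1
    ext v
    rw [hp.charFun_conv_eq, Real.coe_toNNReal s hs]
    simp only [hΨ]
    ring
  have bnd : ∀ (v : ℝ) {a : ℝ}, a ≤ 1 → ‖charFun ρ (2 * Real.pi * v)‖ * a ≤ ρ.real univ :=
    fun v a ha => (mul_le_of_le_one_right (norm_nonneg _) ha).trans (norm_charFun_le _)
  have hρm : Measurable (fun v : ℝ => charFun ρ (2 * Real.pi * v)) :=
    measurable_charFun.comp (by fun_prop)
  have hρb : ∀ v, ‖charFun ρ v‖ ≤ ρ.real univ := fun v => norm_charFun_le v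
  set K : ℝ → ℂ := fun t => ∫ v, F v * (charFun ρ (2 * Real.pi * v) * Complex.exp (t * Ψ v))
    with hK
  have iK : ∀ t : ℝ, 0 ≤ t → Integrable fun v =>
      F v * (charFun ρ (2 * Real.pi * v) * Complex.exp (t * Ψ v)) := by
    intro t ht
    refine (i0.norm.mul_const (ρ.real univ)).mono'
      (hFm.mul (by fun_prop)) (ae_of_all _ fun v => ?_)
    rw [norm_mul, norm_mul]
    refine mul_le_mul_of_nonneg_left (bnd v ?_)
      (norm_nonneg _)
    rw [Complex.norm_exp, Real.exp_le_one_iff, Complex.re_ofReal_mul]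
    exact mul_nonpos_of_nonneg_of_nonpos ht (hΨre v)
  have hKd : HasDerivWithinAt K
      (∫ v, F v * (charFun ρ (2 * Real.pi * v) * (Ψ v * Complex.exp (s * Ψ v)))) (Ici s) s := by
    rw [hasDerivWithinAt_iff_tendsto_slope]
    have hslope : ∀ u ∈ Ici s \ {s}, (∫ v, F v * (charFun ρ (2 * Real.pi * v) *
        (((u - s : ℝ) : ℂ)⁻¹ * (Complex.exp (u * Ψ v) - Complex.exp (s * Ψ v))))) =
          slope K s u := by
      intro u hu
      rw [slope_def_module, ← integral_sub (iK u (hs.trans hu.1)) (iK s hs), ← integral_smul]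
      congr 1
      ext v
      rw [Complex.real_smul]
      push_cast
      ring
    refine Tendsto.congr' (eventually_of_mem self_mem_nhdsWithin hslope) ?_
    -- The difference quotient of `exp (t Ψ)` is bounded by `‖Ψ‖`, and `Ψ * F` is integrable since
    -- `F` decays faster than the quadratic growth of `Ψ`.
    refine tendsto_integral_filter_of_dominated_convergence
      (fun v => ‖Ψ v * F v‖ * ρ.real univ) ?_ ?_ (iΨ.norm.mul_const _) ?_
    · exact Eventually.of_forall fun u => hFm.mul (by fun_prop)
    · filter_upwards [self_mem_nhdsWithin] with u hu
      have hlt : 0 < u - s := sub_pos.2 (lt_of_le_of_ne hu.1 (Ne.symm hu.2))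
      refine ae_of_all _ fun v => ?_
      have h1 : ‖((u - s : ℝ) : ℂ)⁻¹ * (Complex.exp (u * Ψ v) - Complex.exp (s * Ψ v))‖ ≤
          ‖Ψ v‖ := by
        rw [norm_mul, norm_inv, Complex.norm_real, Real.norm_of_nonneg hlt.le,
          inv_mul_le_iff₀ hlt, mul_comm (u - s)]
        exact norm_cexp_mul_sub_le (hΨre v) hs hu.1
      rw [norm_mul, norm_mul]
      calc _ ≤ ‖F v‖ * (ρ.real univ * ‖Ψ v‖) :=
            mul_le_mul_of_nonneg_left (mul_le_mul (hρb _) h1 (norm_nonneg _) measureReal_nonneg)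
              (norm_nonneg _)
        _ = _ := by rw [norm_mul]; ring
    · refine ae_of_all _ fun v => ?_
      have h1 := hasDerivAt_iff_tendsto_slope.1 (hasDerivAt_cexp_mul (Ψ v) s)
      have h2 : Tendsto (fun u : ℝ => ((u - s : ℝ) : ℂ)⁻¹ *
          (Complex.exp (u * Ψ v) - Complex.exp (s * Ψ v))) (𝓝[Ici s \ {s}] s)
          (𝓝 (Ψ v * Complex.exp (s * Ψ v))) := by
        refine ((h1.mono_left (nhdsWithin_mono _ (fun u hu => hu.2))).congr fun u => ?_).trans
          (le_of_eq ?_)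
        · rw [slope_def_module, Complex.real_smul, mul_comm (Ψ v), mul_comm (Ψ v),
            Complex.ofReal_inv]
        · rw [mul_comm (Ψ v) (s : ℂ)]
      exact (h2.const_mul _).const_mul _
  rw [← hder] at hKd
  have hre := Complex.reCLM.hasFDerivAt.comp_hasDerivWithinAt s hKd
  have hre' : HasDerivWithinAt (fun t => (K t).re)
      (∫ x, levyGenerator b σ Λ f x ∂(ρ ∗ p s.toNNReal)) (Ici s) s := by
    simpa [Function.comp_def] using hre
  refine hre'.congr (fun t ht => ?_) ?_
  · simp only [hK]
    rw [← hrep t (hs.trans ht), Complex.ofReal_re]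
  · simp only [hK]
    rw [← hrep s hs, Complex.ofReal_re]

theorem IsLevySemigroup.continuousOn_integral_conv (hp : IsLevySemigroup p b σ Λ)
    (hΛ : IsLevyMeasure Λ) (ρ : Measure ℝ) [IsFiniteMeasure ρ]
    {f : ℝ → ℝ} (hf : ContDiff ℝ ((⊤ : ℕ∞) : WithTop ℕ∞) f) (hfc : HasCompactSupport f) :
    ContinuousOn (fun t : ℝ => ∫ x, f x ∂(ρ ∗ p t.toNNReal)) (Ici 0) := by
  obtain ⟨F, hFc, hF, hfF⟩ := exists_fourierSynth_eq hf hfc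
  have hFm := hFc.aestronglyMeasurable (μ := volume)
  set Ψ : ℝ → ℂ := fun v => levyExponent b σ Λ (2 * Real.pi * v) with hΨ
  have hΨm : Measurable Ψ := (measurable_levyExponent hΛ b σ).comp (by fun_prop)
  have hΨre : ∀ v, (Ψ v).re ≤ 0 := fun v => re_levyExponent_nonpos hΛ b σ _
  have i0 : Integrable F := by
    have := integrable_of_one_add_sq hFm hF (k := fun _ => 1) (C := 1) (by fun_prop)
      (fun v => by rw [norm_one]; nlinarith [sq_nonneg (2 * Real.pi * v)])
    simpa using this
  have hpr := hp.prob
  have bnd : ∀ (v : ℝ) {a : ℝ}, a ≤ 1 → ‖charFun ρ (2 * Real.pi * v)‖ * a ≤ ρ.real univ :=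
    fun v a ha => (mul_le_of_le_one_right (norm_nonneg _) ha).trans (norm_charFun_le _)
  have hρm : Measurable (fun v : ℝ => charFun ρ (2 * Real.pi * v)) :=
    measurable_charFun.comp (by fun_prop)
  have hK : ContinuousOn (fun t : ℝ => ∫ v, F v *
      (charFun ρ (2 * Real.pi * v) * Complex.exp (t * Ψ v))) (Ici 0) := by
    refine continuousOn_of_dominated (bound := fun v => ‖F v‖ * ρ.real univ) ?_ ?_
      (i0.norm.mul_const _) ?_
    · exact fun t _ => hFm.mul (by fun_prop)
    · refine fun t ht => ae_of_all _ fun v => ?_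
      rw [norm_mul, norm_mul]
      refine mul_le_mul_of_nonneg_left (bnd v ?_) (norm_nonneg _)
      rw [Complex.norm_exp, Real.exp_le_one_iff, Complex.re_ofReal_mul]
      exact mul_nonpos_of_nonneg_of_nonpos ht (hΨre v)
    · exact ae_of_all _ fun v => Continuous.continuousOn (by fun_prop)
  refine (Complex.continuous_re.comp_continuousOn hK).congr fun t ht => ?_
  have : ((∫ x, f x ∂(ρ ∗ p t.toNNReal) : ℝ) : ℂ) =
      ∫ v, F v * (charFun ρ (2 * Real.pi * v) * Complex.exp (t * Ψ v)) := by
    rw [← integral_complex_ofReal]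
    simp_rw [hfF]
    rw [integral_fourierSynth i0]
    simp_rw [hp.charFun_conv_eq, Real.coe_toNNReal t ht, hΨ]
  simp only [Function.comp]
  rw [← this, Complex.ofReal_re]

end Semigroup

/-! ### Duality between the generator and its adjoint. -/

theorem ContDiffOn.hasDerivAt_deriv_two {w : ℝ → ℝ} {U : Set ℝ} (hU : IsOpen U)
    (hw : ContDiffOn ℝ 2 w U) :
    (∀ x ∈ U, HasDerivAt w (deriv w x) x) ∧
      (∀ x ∈ U, HasDerivAt (deriv w) (deriv (deriv w) x) x) ∧
      ContinuousOn (deriv w) U ∧ ContinuousOn (deriv (deriv w)) U := by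
  have h1 := (contDiffOn_succ_iff_deriv_of_isOpen (n := 1) hU).1 hw
  have h2 := (contDiffOn_succ_iff_deriv_of_isOpen (n := 0) hU).1 h1.2.2
  exact ⟨fun x hx => (h1.1.differentiableAt (hU.mem_nhds hx)).hasDerivAt,
    fun x hx => (h2.1.differentiableAt (hU.mem_nhds hx)).hasDerivAt, h1.2.2.continuousOn,
    h2.2.2.continuousOn⟩

theorem contDiffOn_two_of_hasDerivAt {w w1 w2 : ℝ → ℝ} {U : Set ℝ} (hU : IsOpen U)
    (h1 : ∀ x ∈ U, HasDerivAt w (w1 x) x) (h2 : ∀ x ∈ U, HasDerivAt w1 (w2 x) x)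
    (hc : ContinuousOn w2 U) : ContDiffOn ℝ 2 w U := by
  have e1 : ∀ x ∈ U, deriv w x = w1 x := fun x hx => (h1 x hx).deriv
  refine (contDiffOn_succ_iff_deriv_of_isOpen (n := 1) hU).2
    ⟨fun x hx => (h1 x hx).differentiableAt.differentiableWithinAt, by simp, ?_⟩
  have : ContDiffOn ℝ 1 w1 U := by
    refine (contDiffOn_succ_iff_deriv_of_isOpen (n := 0) hU).2
      ⟨fun x hx => (h2 x hx).differentiableAt.differentiableWithinAt, by simp, ?_⟩
    exact contDiffOn_zero.2 (hc.congr fun x hx => (h2 x hx).deriv)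
  exact this.congr e1

theorem continuous_mul_of_tsupport_subset {f g : ℝ → ℝ} {U : Set ℝ} (hU : IsOpen U)
    (hf : Continuous f) (hfU : tsupport f ⊆ U) (hg : ContinuousOn g U) :
    Continuous fun x => f x * g x := by
  refine continuous_of_tsupport fun x hx => ?_
  have hx' : x ∈ U := hfU (closure_mono (fun y hy => left_ne_zero_of_mul hy) hx)
  exact hf.continuousAt.mul (hg.continuousAt (hU.mem_nhds hx'))

theorem adjointJumpIntegrand_eq_sub (w : ℝ → ℝ) (x y : ℝ) :
    adjointJumpIntegrand w x y = w (x - y) - w x + truncJump y * deriv w x := rfl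

theorem measurable_adjointJumpIntegrand {w : ℝ → ℝ} (hw : Measurable w) :
    Measurable fun q : ℝ × ℝ => adjointJumpIntegrand w q.1 q.2 := by
  have h1 := measurable_truncJump
  have h2 := measurable_deriv w
  unfold adjointJumpIntegrand
  fun_prop

/-- Near a compact subset of the open set where `w` is `C²`, small jumps are compensated. -/
theorem exists_adjointJumpIntegrand_le {w : ℝ → ℝ} {U K : Set ℝ} (hU : IsOpen U)
    (hw : ContDiffOn ℝ 2 w U) (hK : IsCompact K) (hKU : K ⊆ U) :
    ∃ δ M, 0 < δ ∧ δ ≤ 1 ∧ 0 ≤ M ∧ ∀ x ∈ K, ∀ y, |y| < δ →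
      |adjointJumpIntegrand w x y| ≤ M * min 1 (y ^ 2) := by
  obtain ⟨h1, h2, -, hc⟩ := hw.hasDerivAt_deriv_two hU
  -- A closed neighbourhood of `K` inside `U` contains every segment from `x` to `x - y` with `|y| <
  -- δ`, so Taylor's bound holds with one constant for all `x ∈ K`.
  obtain ⟨δ, hδ, hδU⟩ := hK.exists_cthickening_subset_open hU hKU
  obtain ⟨M, hM⟩ := (hK.cthickening (r := δ)).exists_bound_of_continuousOn (hc.mono hδU)
  refine ⟨min δ 1, max M 0, by positivity, min_le_right _ _, le_max_right _ _, ?_⟩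
  intro x hx y hy
  have hy1 : |y| ≤ 1 := (hy.trans_le (min_le_right _ _)).le
  have hsub : uIcc x (x + -y) ⊆ Metric.cthickening δ K := by
    intro z hz
    refine Metric.mem_cthickening_of_dist_le z x δ K hx ?_
    have := abs_sub_left_of_mem_uIcc hz
    rw [Real.dist_eq]
    refine this.trans ?_
    simpa using (hy.trans_le (min_le_left _ _)).le
  have := norm_taylor_sub_le (fun z hz => h1 z (hδU (hsub hz))) (fun z hz => h2 z (hδU (hsub hz)))
    (fun z hz => hM z (hsub hz))
  rw [adjointJumpIntegrand_eq_sub, truncJump_of_le hy1, min_one_sq_of_le hy1]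
  rw [← sub_eq_add_neg, Real.norm_eq_abs, smul_eq_mul, neg_sq] at this
  rw [show w (x - y) - w x + y * deriv w x = w (x - y) - w x - -y * deriv w x by ring]
  exact this.trans (mul_le_mul_of_nonneg_right (le_max_left _ _) (sq_nonneg y))

theorem levyJump_bound {f : ℝ → ℝ} (hf : ContDiff ℝ 2 f) (hfc : HasCompactSupport f) :
    ∃ C, 0 ≤ C ∧ (∀ x, |f x| ≤ C) ∧ ∀ x y,
      |f (x + y) - f x - truncJump y * deriv f x| ≤ C * min 1 (y ^ 2) := by
  obtain ⟨h1, h2, -, hc⟩ := (contDiffOn_univ.2 hf).hasDerivAt_deriv_two isOpen_univ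
  obtain ⟨C0, hC0⟩ := hfc.exists_bound_of_continuous hf.continuous
  obtain ⟨C2, hC2⟩ := hfc.deriv.deriv.exists_bound_of_continuous (continuousOn_univ.1 hc)
  set M := max C0 C2
  have hM : 0 ≤ M := (norm_nonneg _).trans ((hC0 0).trans (le_max_left _ _))
  refine ⟨2 * M, by positivity, fun x => ?_, fun x y => ?_⟩
  · exact (hC0 x).trans ((le_max_left _ _).trans (by linarith))
  · exact norm_compensated_le (fun z => h1 z trivial) (fun z => h2 z trivial)
      (fun z => (hC0 z).trans (le_max_left _ _)) (fun z => (hC2 z).trans (le_max_right _ _)) x y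

/-- The generator and its adjoint are in duality on compactly supported test functions. -/
theorem integral_mul_levyGenerator {Λ : Measure ℝ} (hΛ : IsLevyMeasure Λ) (b σ : ℝ)
    {w f : ℝ → ℝ} {U : Set ℝ} (hU : IsOpen U) (hwi : Integrable w) (hwc : Continuous w)
    (hw : ContDiffOn ℝ 2 w U) (hf : ContDiff ℝ 2 f) (hfc : HasCompactSupport f)
    (hfU : tsupport f ⊆ U) :
    Integrable (fun x => f x * adjointGenerator b σ Λ w x) ∧
      ∫ x, w x * levyGenerator b σ Λ f x = ∫ x, f x * adjointGenerator b σ Λ w x := by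
  have hsf := hΛ.sigmaFinite
  obtain ⟨w1, w2, hc1, hc2⟩ := hw.hasDerivAt_deriv_two hU
  obtain ⟨f1, f2, fc1, fc2⟩ := (contDiffOn_univ.2 hf).hasDerivAt_deriv_two isOpen_univ
  rw [continuousOn_univ] at fc1 fc2
  have fU : ∀ {g : ℝ → ℝ}, ContinuousOn g U → Integrable fun x => f x * g x := fun {g} hg =>
    (continuous_mul_of_tsupport_subset hU hf.continuous hfU hg).integrable_of_hasCompactSupport
      hfc.mul_right
  have i1 : Integrable fun x => f x * deriv w x := fU hc1
  have i2 : Integrable fun x => f x * deriv (deriv w) x := fU hc2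
  have i0 : Integrable fun x => f x * w x := fU hwc.continuousOn
  have j1 : Integrable fun x => w x * deriv f x :=
    (hwc.mul fc1).integrable_of_hasCompactSupport hfc.deriv.mul_left
  have j2 : Integrable fun x => w x * deriv (deriv f) x :=
    (hwc.mul fc2).integrable_of_hasCompactSupport hfc.deriv.deriv.mul_left
  have hout : ∀ x ∉ tsupport f, f =ᶠ[𝓝 x] 0 := fun x hx =>
    notMem_tsupport_iff_eventuallyEq.1 hx
  have hout1 : ∀ x ∉ tsupport f, deriv f =ᶠ[𝓝 x] 0 := fun x hx => by
    have := (hout x hx).deriv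
    simpa using! this
  have hout2 : ∀ x ∉ tsupport f, deriv (deriv f) =ᶠ[𝓝 x] 0 := fun x hx => by
    have := (hout1 x hx).deriv
    simpa using! this
  -- integration by parts
  have p1 : ∫ x, w x * deriv f x = -∫ x, f x * deriv w x := by
    have hd : ∀ x, HasDerivAt (fun x => f x * w x) (f x * deriv w x + w x * deriv f x) x := by
      intro x
      by_cases hx : x ∈ tsupport f
      · exact ((f1 x trivial).fun_mul (w1 x (hfU hx))).congr_deriv (by ring)
      · have h0 : (fun x => f x * w x) =ᶠ[𝓝 x] fun _ => 0 := by
          filter_upwards [hout x hx] with z hz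
          simp [hz]
        rw [(hout x hx).self_of_nhds, (hout1 x hx).self_of_nhds]
        simpa using (hasDerivAt_const x (0 : ℝ)).congr_of_eventuallyEq h0
    have := integral_eq_zero_of_hasDerivAt_of_integrable hd (i1.add j1) i0
    rw [integral_add i1 j1] at this
    linarith
  have p2 : ∫ x, w x * deriv (deriv f) x = ∫ x, f x * deriv (deriv w) x := by
    have hd : ∀ x, HasDerivAt (fun x => f x * deriv w x - w x * deriv f x)
        (f x * deriv (deriv w) x - w x * deriv (deriv f) x) x := by
      intro x
      by_cases hx : x ∈ tsupport f
      · exact (((f1 x trivial).fun_mul (w2 x (hfU hx))).fun_sub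
          ((w1 x (hfU hx)).fun_mul (f2 x trivial))).congr_deriv (by ring)
      · have h0 : (fun x => f x * deriv w x - w x * deriv f x) =ᶠ[𝓝 x] fun _ => 0 := by
          filter_upwards [hout x hx, hout1 x hx] with z hz hz1
          simp [hz, hz1]
        rw [(hout x hx).self_of_nhds, (hout2 x hx).self_of_nhds]
        simpa using (hasDerivAt_const x (0 : ℝ)).congr_of_eventuallyEq h0
    have := integral_eq_zero_of_hasDerivAt_of_integrable hd (i2.sub j2) (i1.sub j1)
    rw [integral_sub i2 j2] at this
    linarith
  -- the jump part
  obtain ⟨C, hC0, hCf, hC⟩ := levyJump_bound hf hfc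
  obtain ⟨δ, M, hδ, hδ1, hM, hMb⟩ := exists_adjointJumpIntegrand_le hU hw hfc hfU
  have mt := measurable_truncJump
  have hmf := hf.continuous.measurable
  have hmf1 := fc1.measurable
  have hmw := hwc.measurable
  have I1 : Integrable (fun q : ℝ × ℝ => w q.1 * (f (q.1 + q.2) - f q.1 - truncJump q.2 *
      deriv f q.1)) (volume.prod Λ) := by
    refine (hwi.norm.mul_prod (hΛ.integrable_min.const_mul C)).mono' ?_ (ae_of_all _ fun q => ?_)
    · exact Measurable.aestronglyMeasurable (by fun_prop)
    · rw [norm_mul]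
      exact mul_le_mul_of_nonneg_left (hC _ _) (norm_nonneg _)
  set S : Set ℝ := {y | δ ≤ |y|} with hS
  have hSm : MeasurableSet S := measurableSet_le (by fun_prop) (by fun_prop)
  have hSfin : Λ S < ⊤ := hΛ.measure_le_abs_lt_top hδ
  have iS : Integrable (S.indicator (fun _ => (1 : ℝ))) Λ :=
    (integrable_indicator_iff hSm).2 (integrableOn_const hSfin.ne)
  have mS : Measurable (S.indicator (fun _ => (1 : ℝ))) := measurable_const.indicator hSm
  have nS : ∀ y, 0 ≤ S.indicator (fun _ => (1 : ℝ)) y := fun y =>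
    indicator_nonneg (fun _ _ => zero_le_one) y
  -- Near the support of `f`, jumps below `δ` are controlled by Taylor's formula. For the remaining
  -- jumps, of finite total measure, the three terms are bounded separately; the nonlocal term `w (x
  -- - y)` uses only that `w` is integrable and Lebesgue measure translation invariant.
  have I2 : Integrable (fun q : ℝ × ℝ => f q.1 * adjointJumpIntegrand w q.1 q.2)
      (volume.prod Λ) := by
    have a1 : Integrable (fun q : ℝ × ℝ => ‖f q.1‖ * (M * min 1 (q.2 ^ 2))) (volume.prod Λ) := by
      have : Integrable f := hf.continuous.integrable_of_hasCompactSupport hfc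
      exact this.norm.mul_prod (hΛ.integrable_min.const_mul M)
    have a2 : Integrable (fun q : ℝ × ℝ => (‖f q.1 * w q.1‖ + ‖f q.1 * deriv w q.1‖) *
        S.indicator (fun _ => (1 : ℝ)) q.2) (volume.prod Λ) :=
      (i0.norm.add i1.norm).mul_prod iS
    have a3 : Integrable (fun q : ℝ × ℝ => C * (‖w (q.1 - q.2)‖ *
        S.indicator (fun _ => (1 : ℝ)) q.2)) (volume.prod Λ) := by
      refine Integrable.const_mul ?_ C
      rw [integrable_prod_iff' (Measurable.aestronglyMeasurable (by fun_prop))]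
      refine ⟨ae_of_all _ fun y => (hwi.norm.comp_sub_right y).mul_const
        (S.indicator (fun _ => (1 : ℝ)) y), ?_⟩
      have e : (fun y => ∫ x, ‖‖w (x - y)‖ * S.indicator (fun _ => (1 : ℝ)) y‖) =
          fun y => (∫ x, ‖w x‖) * S.indicator (fun _ => (1 : ℝ)) y := by
        ext y
        simp_rw [norm_mul, norm_norm, Real.norm_of_nonneg (nS y)]
        rw [integral_mul_const, integral_sub_right_eq_self (fun x => ‖w x‖)]
      rw [e]
      exact iS.const_mul _
    refine ((a1.add a2).add a3).mono' ?_ (ae_of_all _ fun q => ?_)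
    · exact ((hmf.comp measurable_fst).mul
        (measurable_adjointJumpIntegrand hmw)).aestronglyMeasurable
    · obtain ⟨x, y⟩ := q
      simp only [Pi.add_apply]
      have hn1 : 0 ≤ ‖f x‖ * (M * min 1 (y ^ 2)) := by positivity
      by_cases hy : y ∈ S
      · rw [indicator_of_mem hy, mul_one, mul_one]
        have b1 : ‖f x * w (x - y)‖ ≤ C * ‖w (x - y)‖ := by
          rw [norm_mul]
          exact mul_le_mul_of_nonneg_right (hCf x) (norm_nonneg _)
        have b2 : ‖f x * (truncJump y * deriv w x)‖ ≤ ‖f x * deriv w x‖ := by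
          rw [norm_mul, norm_mul, norm_mul]
          refine mul_le_mul_of_nonneg_left (mul_le_of_le_one_left (norm_nonneg _) ?_)
            (norm_nonneg _)
          unfold truncJump
          split_ifs with h
          · exact h
          · simp
        have b3 : f x * adjointJumpIntegrand w x y =
            f x * w (x - y) - f x * w x + f x * (truncJump y * deriv w x) := by
          rw [adjointJumpIntegrand_eq_sub]; ring
        rw [b3]
        refine (norm_add_le _ _).trans ?_
        have := norm_sub_le (f x * w (x - y)) (f x * w x)
        linarith
      · rw [indicator_of_notMem hy, mul_zero, mul_zero, mul_zero, add_zero, add_zero, norm_mul]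
        by_cases hx : x ∈ tsupport f
        · exact mul_le_mul_of_nonneg_left (hMb x hx y (not_le.1 hy)) (norm_nonneg _)
        · rw [image_eq_zero_of_notMem_tsupport hx]
          simp
  have hswap : ∫ x, w x * ∫ y, (f (x + y) - f x - truncJump y * deriv f x) ∂Λ =
      ∫ x, f x * ∫ y, adjointJumpIntegrand w x y ∂Λ := by
    simp_rw [← integral_const_mul]
    refine (integral_integral_swap I1).trans (Eq.trans ?_ (integral_integral_swap I2).symm)
    congr 1
    ext y
    have hfs : Integrable fun x => w x * f (x + y) := by
      refine (hwi.mul_const C).norm.mono' (by fun_prop) (ae_of_all _ fun x => ?_)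
      rw [norm_mul, norm_mul, Real.norm_of_nonneg hC0]
      exact mul_le_mul_of_nonneg_left (hCf _) (norm_nonneg _)
    -- Translating the variable moves the jump from the test function to `w`, which reverses its
    -- sign.
    have hfw : ∫ x, w x * f (x + y) = ∫ x, f x * w (x - y) := by
      rw [← integral_sub_right_eq_self (fun x => w x * f (x + y)) y]
      congr 1
      ext x
      rw [sub_add_cancel, mul_comm]
    have hfs' : Integrable fun x => f x * w (x - y) := by
      refine (hfs.comp_sub_right y).congr (ae_of_all _ fun x => ?_)
      simp only [sub_add_cancel, mul_comm]
    have e1 : ∀ x, w x * (f (x + y) - f x - truncJump y * deriv f x) =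
        w x * f (x + y) - f x * w x - truncJump y * (w x * deriv f x) := fun x => by ring
    have e2 : ∀ x, f x * adjointJumpIntegrand w x y =
        f x * w (x - y) - f x * w x + truncJump y * (f x * deriv w x) := fun x => by
      rw [adjointJumpIntegrand_eq_sub]; ring
    have k1 : Integrable fun x => w x * f (x + y) - f x * w x := hfs.sub i0
    have k2 : Integrable fun x => f x * w (x - y) - f x * w x := hfs'.sub i0
    simp_rw [e1, e2]
    rw [integral_sub k1 (j1.const_mul _), integral_add k2 (i1.const_mul _),
      integral_sub hfs i0, integral_sub hfs' i0, integral_const_mul, integral_const_mul, hfw, p1]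
    ring
  have k3 : Integrable fun x => f x * ∫ y, adjointJumpIntegrand w x y ∂Λ := by
    simp_rw [← integral_const_mul]
    exact I2.integral_prod_left
  have k4 : Integrable fun x => w x * ∫ y, (f (x + y) - f x - truncJump y * deriv f x) ∂Λ := by
    simp_rw [← integral_const_mul]
    exact I1.integral_prod_left
  have k5 : Integrable fun x => σ ^ 2 / 2 * (f x * deriv (deriv w) x) -
      b * (f x * deriv w x) := (i2.const_mul _).sub (i1.const_mul _)
  have k6 : Integrable fun x => σ ^ 2 / 2 * (w x * deriv (deriv f) x) +
      b * (w x * deriv f x) := (j2.const_mul _).add (j1.const_mul _)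
  have e3 : ∀ x, f x * adjointGenerator b σ Λ w x = σ ^ 2 / 2 * (f x * deriv (deriv w) x) -
      b * (f x * deriv w x) + f x * ∫ y, adjointJumpIntegrand w x y ∂Λ := fun x => by
    unfold adjointGenerator; ring
  have e4 : ∀ x, w x * levyGenerator b σ Λ f x = σ ^ 2 / 2 * (w x * deriv (deriv f) x) +
      b * (w x * deriv f x) + w x * ∫ y, (f (x + y) - f x - truncJump y * deriv f x) ∂Λ :=
    fun x => by unfold levyGenerator; ring
  simp_rw [e3, e4]
  refine ⟨k5.add k3, ?_⟩
  rw [integral_add k6 k4, integral_add k5 k3, hswap,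
    integral_add (j2.const_mul _) (j1.const_mul _), integral_sub (i2.const_mul _) (i1.const_mul _),
    integral_const_mul, integral_const_mul, integral_const_mul, integral_const_mul, p1, p2]
  ring

/-! ### Path-space realization of killing at grid times. -/

section LevyProcess

variable {Ω : Type*} [MeasurableSpace Ω] {P : Measure Ω}
  {Z Y : ℝ≥0 → Ω → ℝ}

theorem IsLevyProcess.drifted (hZ : IsLevyProcess Z P) (c : ℝ) :
    IsLevyProcess (drifted Z c) P where
  measurable t := (hZ.measurable t).sub_const _
  start_zero := by
    filter_upwards [hZ.start_zero] with ω hω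
    simp [_root_.drifted, hω]
  indep_increments := by
    intro n t ht
    have := (hZ.indep_increments n t ht).comp
      (fun i y => y - c * ((t i.succ : ℝ) - t i.castSucc)) (fun i => by fun_prop)
    convert! this using 3 with i ω
    simp only [_root_.drifted, Function.comp]
    ring
  stationary_increments s t := by
    have := (hZ.stationary_increments s t).comp (u := fun y => y - c * t) (by fun_prop)
    convert! this using 2 with ω
    simp only [_root_.drifted, Function.comp]
    push_cast
    ring
  cadlag := by
    filter_upwards [hZ.cadlag] with ω hω t
    obtain ⟨h1, l, hl⟩ := hω t
    have hc : Continuous fun s : ℝ≥0 => c * (s : ℝ) := by fun_prop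
    exact ⟨h1.sub hc.continuousWithinAt, l - c * t,
      hl.sub (hc.continuousAt.tendsto.mono_left nhdsWithin_le_nhds)⟩

theorem HasLevyTriplet.drifted {b σ : ℝ} {Λ : Measure ℝ} (hZ : ∀ t, Measurable (Z t))
    (hT : HasLevyTriplet Z P b σ Λ) (c : ℝ) : HasLevyTriplet (drifted Z c) P (b - c) σ Λ := by
  intro t ξ
  have e : P.map (_root_.drifted Z c t) = (P.map (Z t)).map (fun x => x + -(c * t)) := by
    rw [Measure.map_map (by fun_prop) (hZ t)]
    rfl
  rw [e, charFun_map_add_const, hT t ξ, ← Complex.exp_add]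
  congr 1
  simp only [levyExponent, RCLike.inner_apply, conj_trivial]
  push_cast
  ring

theorem isLevySemigroup_map [IsProbabilityMeasure P] {b σ : ℝ} {Λ : Measure ℝ} (hY : ∀ t, Measurable (Y t))
    (hT : HasLevyTriplet Y P b σ Λ) : IsLevySemigroup (fun t => P.map (Y t)) b σ Λ where
  prob t := Measure.isProbabilityMeasure_map (hY t).aemeasurable
  charFun_eq := hT

/-- The increment after a finite set of times is independent of the values at those times. -/
theorem IsLevyProcess.map_past_increment [IsProbabilityMeasure P] (hY : IsLevyProcess Y P) {t : ℕ → ℝ≥0} (ht : Monotone t)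
    (h0 : t 0 = 0) (k : ℕ) :
    P.map (fun ω => ((fun j : Fin (k + 1) => Y (t j) ω), Y (t (k + 1)) ω - Y (t k) ω)) =
      (P.map (fun ω => fun j : Fin (k + 1) => Y (t j) ω)).prod
        (P.map (Y (t (k + 1) - t k))) := by
  have hm := hY.measurable
  have hi := hY.indep_increments.nat ht
  have hfin := hi.indepFun_finset (Finset.range k) {k} (by simp)
    (fun i => (hm _).sub (hm _))
  -- Partial sums rebuild the positions from the increments. Since `Y 0 = 0` almost surely, the
  -- whole past is a function of the first `k` increments.
  set φ : (↥(Finset.range k) → ℝ) → (Fin (k + 1) → ℝ) := fun v j =>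
    ∑ i ∈ (Finset.range k).attach, if i.1 < j then v i else 0 with hφ
  have hφm : Measurable φ := by
    refine measurable_pi_lambda _ fun j => Finset.measurable_sum _ fun i _ => ?_
    split_ifs
    · exact measurable_pi_apply i
    · exact measurable_const
  have h2 := hfin.comp hφm (measurable_pi_apply (⟨k, by simp⟩ : ({k} : Finset ℕ)))
  have hpast : (φ ∘ fun a (i : (Finset.range k : Finset ℕ)) => Y (t (i.1 + 1)) a - Y (t i.1) a)
      =ᵐ[P] fun ω => fun j : Fin (k + 1) => Y (t j) ω := by
    filter_upwards [hY.start_zero] with ω hω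
    ext j
    simp only [Function.comp, hφ]
    rw [Finset.sum_attach (Finset.range k)
      (fun i => if i < (j : ℕ) then Y (t (i + 1)) ω - Y (t i) ω else 0), ← Finset.sum_filter]
    have : Finset.filter (fun i => i < (j : ℕ)) (Finset.range k) = Finset.range j := by
      ext i
      simp only [Finset.mem_filter, Finset.mem_range]
      have := j.2
      omega
    rw [this, Finset.sum_range_sub (fun i => Y (t i) ω), h0, hω, sub_zero]
  have h3 : IndepFun (fun ω => fun j : Fin (k + 1) => Y (t j) ω)
      (fun ω => Y (t (k + 1)) ω - Y (t k) ω) P := h2.congr hpast (ae_of_all _ fun ω => rfl)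
  have hinc : Measurable fun ω => Y (t (k + 1)) ω - Y (t k) ω := (hm _).sub (hm _)
  rw [(indepFun_iff_map_prod_eq_prod_map_map
    (measurable_pi_lambda _ fun j => hm _).aemeasurable hinc.aemeasurable).1 h3]
  congr 1
  have := (hY.stationary_increments (t k) (t (k + 1) - t k)).map_eq
  rwa [add_tsub_cancel_of_le (ht (Nat.le_succ k))] at this

/-- One step of the discretely killed semigroup: convolve, then kill outside `(0, ∞)`. -/
noncomputable def killedStep (q ν : Measure ℝ) : Measure ℝ := (ν ∗ q).restrict (Ioi 0)

/-- The Markov property in the form used here: an increment independent of the past stays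
independent after conditioning on a past event `E`, so moving on is a convolution, even when part of
the mass has been killed. -/
theorem map_restrict_add_eq_conv {Ω' β : Type*} [MeasurableSpace Ω'] [MeasurableSpace β]
    {Q : Measure Ω'} [IsFiniteMeasure Q] {q : Measure ℝ} [IsProbabilityMeasure q]
    {V : Ω' → β} {D : Ω' → ℝ}
    (hV : Measurable V) (hD : Measurable D)
    (h : Q.map (fun ω => (V ω, D ω)) = (Q.map V).prod q) {E : Set β} (hE : MeasurableSet E)
    {g : β → ℝ} (hg : Measurable g) :
    (Q.restrict (V ⁻¹' E)).map (fun ω => g (V ω) + D ω) =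
      ((Q.restrict (V ⁻¹' E)).map (fun ω => g (V ω))) ∗ q := by
  have h1 : (Q.restrict (V ⁻¹' E)).map (fun ω => (V ω, D ω)) =
      ((Q.map V).restrict E).prod q := by
    have : V ⁻¹' E = (fun ω => (V ω, D ω)) ⁻¹' (E ×ˢ univ) := by ext; simp
    rw [this, ← Measure.restrict_map (hV.prodMk hD) (hE.prod MeasurableSet.univ), h,
      ← Measure.prod_restrict, Measure.restrict_univ]
  have h2 : (fun ω => g (V ω) + D ω) =
      (fun z : ℝ × ℝ => z.1 + z.2) ∘ (Prod.map g id) ∘ (fun ω => (V ω, D ω)) := rfl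
  rw [h2, ← Measure.map_map (by fun_prop) (by fun_prop), ← Measure.map_map (by fun_prop)
    (by fun_prop), h1, Measure.restrict_map hV hE, ← Measure.map_prod_map _ _ hg measurable_id,
    Measure.map_map hg hV, Measure.map_id]
  rfl

/-- The event that the process started at `x` is positive at the first `k` times of a sequence. -/
def positiveAt (Y : ℝ≥0 → Ω → ℝ) (t : ℕ → ℝ≥0) (k : ℕ) : Set (ℝ × Ω) :=
  {q | ∀ j, 1 ≤ j → j ≤ k → 0 < q.1 + Y (t j) q.2}

theorem measurableSet_positiveAt (hY : ∀ t, Measurable (Y t)) (t : ℕ → ℝ≥0) (k : ℕ) :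
    MeasurableSet (positiveAt Y t k) := by
  have : positiveAt Y t k = ⋂ (j : ℕ) (_ : 1 ≤ j) (_ : j ≤ k), {q | 0 < q.1 + Y (t j) q.2} := by
    ext q; simp [positiveAt]
  rw [this]
  refine MeasurableSet.iInter fun j => MeasurableSet.iInter fun _ => MeasurableSet.iInter fun _ => ?_
  exact measurableSet_lt measurable_const (measurable_fst.add ((hY _).comp measurable_snd))

/-- With the starting point drawn independently of the path, iterated killing is the law of the
position on the event of positivity at all grid times. Estimates on iterates thus become estimates
on one fixed path. -/
theorem IsLevyProcess.iterate_killedStep_eq [IsProbabilityMeasure P] (hY : IsLevyProcess Y P) (ν : Measure ℝ)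
    [IsFiniteMeasure ν] (h : ℝ≥0) (k : ℕ) :
    (killedStep (P.map (Y h)))^[k] ν =
      ((ν.prod P).restrict (positiveAt Y (fun j => j * h) k)).map
        (fun q => q.1 + Y (k * h) q.2) := by
  have hm := hY.measurable
  have hp : ∀ s, IsProbabilityMeasure (P.map (Y s)) := fun s =>
    Measure.isProbabilityMeasure_map (hm s).aemeasurable
  set t : ℕ → ℝ≥0 := fun j => j * h with ht
  have hmono : Monotone t := fun i j hij => by
    simp only [ht]; gcongr
  induction k with
  | zero =>
    have h1 : positiveAt Y t 0 = univ := by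
      ext q; simp only [positiveAt, mem_ofPred_eq, mem_univ, iff_true]; intros; omega
    rw [h1, Measure.restrict_univ, Function.iterate_zero, id]
    have h2 : (fun q : ℝ × Ω => q.1 + Y (((0 : ℕ) : ℝ≥0) * h) q.2) =ᵐ[ν.prod P] Prod.fst := by
      have := (Measure.quasiMeasurePreserving_snd (μ := ν) (ν := P)).ae hY.start_zero
      filter_upwards [this] with q hq
      simp [hq]
    rw [Measure.map_congr h2, Measure.map_fst_prod, measure_univ, one_smul]
  | succ k ih =>
    rw [Function.iterate_succ_apply', ih, killedStep]
    set V : ℝ × Ω → ℝ × (Fin (k + 1) → ℝ) := fun q => (q.1, fun j => Y (t j) q.2) with hV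
    set D : ℝ × Ω → ℝ := fun q => Y (t (k + 1)) q.2 - Y (t k) q.2 with hD
    have hVm : Measurable V := measurable_fst.prodMk
      (measurable_pi_lambda _ fun j => (hm _).comp measurable_snd)
    have hDm : Measurable D := ((hm _).sub (hm _)).comp measurable_snd
    have hlaw : (ν.prod P).map (fun q => (V q, D q)) =
        ((ν.prod P).map V).prod (P.map (Y h)) := by
      have h1 := hY.map_past_increment hmono (by simp [ht]) k
      have h2 : t (k + 1) - t k = h := by
        simp only [ht]; push_cast; rw [add_mul, one_mul, add_tsub_cancel_left]
      rw [h2] at h1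
      have hpm : Measurable (fun ω => fun j : Fin (k + 1) => Y (t j) ω) :=
        measurable_pi_lambda _ fun j => hm _
      have h3 : (ν.prod P).map V = ν.prod (P.map (fun ω => fun j : Fin (k + 1) => Y (t j) ω)) := by
        have : V = Prod.map id (fun ω => fun j : Fin (k + 1) => Y (t j) ω) := rfl
        rw [this, ← Measure.map_prod_map _ _ measurable_id hpm, Measure.map_id]
      have h4 : (fun q => (V q, D q)) = MeasurableEquiv.prodAssoc.symm ∘ Prod.map id
          (fun ω => ((fun j : Fin (k + 1) => Y (t j) ω), Y (t (k + 1)) ω - Y (t k) ω)) := rfl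
      have hprob : IsProbabilityMeasure (P.map (fun ω => fun j : Fin (k + 1) => Y (t j) ω)) :=
        Measure.isProbabilityMeasure_map hpm.aemeasurable
      have hjm : Measurable (fun ω =>
          ((fun j : Fin (k + 1) => Y (t j) ω), Y (t (k + 1)) ω - Y (t k) ω)) :=
        hpm.prodMk ((hm _).sub (hm _))
      rw [h3, h4, ← Measure.map_map (MeasurableEquiv.measurable _) (measurable_id.prodMap hjm),
        ← Measure.map_prod_map _ _ measurable_id hjm, Measure.map_id, h1]
      exact ((measurePreserving_prodAssoc ν (P.map (fun ω => fun j : Fin (k + 1) => Y (t j) ω))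
        (P.map (Y h))).symm).map_eq
    set E : Set (ℝ × (Fin (k + 1) → ℝ)) := {z | ∀ j : Fin (k + 1), 1 ≤ (j : ℕ) → 0 < z.1 + z.2 j}
      with hE
    have hEm : MeasurableSet E := by
      have : E = ⋂ (j : Fin (k + 1)) (_ : 1 ≤ (j : ℕ)), {z | 0 < z.1 + z.2 j} := by
        ext z; simp [hE]
      rw [this]
      refine MeasurableSet.iInter fun j => MeasurableSet.iInter fun _ => ?_
      exact measurableSet_lt measurable_const (by fun_prop)
    have hVE : V ⁻¹' E = positiveAt Y t k := by
      ext q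
      simp only [hE, hV, positiveAt, mem_preimage, mem_ofPred_eq]
      constructor
      · intro h j h1 h2
        exact h ⟨j, by omega⟩ h1
      · intro h j h1
        exact h j h1 (by have := j.2; omega)
    have hconv := map_restrict_add_eq_conv hVm hDm hlaw hEm
      (g := fun z => z.1 + z.2 (Fin.last k)) (by fun_prop)
    rw [hVE] at hconv
    have e1 : (fun q : ℝ × Ω => (V q).1 + (V q).2 (Fin.last k)) =
        fun q => q.1 + Y (k * h) q.2 := by
      ext q; simp [hV, ht]
    have e2 : (fun q : ℝ × Ω => (V q).1 + (V q).2 (Fin.last k) + D q) =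
        fun q => q.1 + Y (((k + 1 : ℕ) : ℝ≥0) * h) q.2 := by
      ext q; simp only [hV, hD, ht, Fin.val_last]; ring
    rw [e1, e2] at hconv
    have hXm : Measurable fun q : ℝ × Ω => q.1 + Y (((k + 1 : ℕ) : ℝ≥0) * h) q.2 :=
      measurable_fst.add ((hm _).comp measurable_snd)
    rw [← hconv, Measure.restrict_map hXm measurableSet_Ioi,
      Measure.restrict_restrict (hXm measurableSet_Ioi)]
    congr 2
    ext q
    simp only [positiveAt, mem_inter_iff, mem_preimage, mem_Ioi, mem_ofPred_eq, ht]
    constructor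
    · rintro ⟨h1, h2⟩ j hj1 hj2
      rcases Nat.lt_or_ge j (k + 1) with hlt | hge
      · exact h2 j hj1 (by omega)
      · rw [show j = k + 1 by omega]; exact h1
    · exact fun h => ⟨h (k + 1) (by omega) le_rfl, fun j h1 h2 => h j h1 (by omega)⟩

end LevyProcess

/-! ### From grid killing to absorption in continuous time. -/

/-- The dyadic grid points of `[0, t]`. -/
noncomputable def gridTime (t : ℝ≥0) (q : ℕ × ℕ) : ℝ≥0 := min (q.2 * (t / 2 ^ q.1)) t

section Path

variable {y : ℝ≥0 → ℝ} {x : ℝ} {t : ℝ≥0}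

/-- The approximation is from the right, the side on which the paths are continuous. -/
theorem exists_gridTime_tendsto (ht : 0 < t) {s : ℝ≥0} (hs : s ≤ t) :
    ∃ k : ℕ → ℕ, (∀ n, s ≤ gridTime t (n, k n)) ∧
      Tendsto (fun n => gridTime t (n, k n)) atTop (𝓝 s) := by
  have hpos : ∀ n : ℕ, 0 < t / 2 ^ n := fun n => by positivity
  refine ⟨fun n => ⌊s / (t / 2 ^ n)⌋₊ + 1, fun n => le_min ?_ hs, ?_⟩
  · have := (Nat.lt_floor_add_one (s / (t / 2 ^ n))).le
    rw [div_le_iff₀ (hpos n)] at this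
    push_cast
    exact this
  · have hz : Tendsto (fun n : ℕ => t / 2 ^ n) atTop (𝓝 0) := by
      have h1 := (tendsto_inv_atTop_nhds_zero_nat (𝕜 := ℝ≥0)).comp
        (tendsto_pow_atTop_atTop_of_one_lt (one_lt_two (α := ℕ)))
      have h2 := h1.const_mul t
      simp only [mul_zero] at h2
      refine h2.congr fun n => ?_
      simp [div_eq_mul_inv]
    refine tendsto_of_tendsto_of_tendsto_of_le_of_le (tendsto_const_nhds (x := s))
      (h := fun n => s + t / 2 ^ n) (by simpa using hz.const_add s) (fun n => le_min ?_ hs)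
      (fun n => (min_le_left _ _).trans ?_)
    · have := (Nat.lt_floor_add_one (s / (t / 2 ^ n))).le
      rw [div_le_iff₀ (hpos n)] at this
      push_cast
      exact this
    · have h1 : (⌊s / (t / 2 ^ n)⌋₊ : ℝ≥0) ≤ s / (t / 2 ^ n) := Nat.floor_le zero_le
      rw [le_div_iff₀ (hpos n)] at h1
      push_cast
      rw [add_mul, one_mul]
      gcongr

/-- Right-continuity at `t` keeps the path positive for a short time after `t`, which makes the
inequality strict although the absorption time is an infimum. -/
theorem absorptionTime_gt_of_forall {Ω : Type*} {Y : ℝ≥0 → Ω → ℝ} {ω : Ω}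
    (hr : ContinuousWithinAt (fun s => Y s ω) (Ici t) t)
    (hpos : ∀ s, 0 < s → s < t → 0 < x + Y s ω) (ht : 0 < x + Y t ω) :
    (t : ℝ≥0∞) < absorptionTime Y x ω := by
  have h1 : ∀ᶠ s in 𝓝[≥] t, 0 < x + Y s ω :=
    (hr.const_add x).eventually (lt_mem_nhds ht)
  obtain ⟨u, hu, hsub⟩ := (mem_nhdsGE_iff_exists_Ico_subset' (show t < t + 1 by simp)).1 h1
  refine lt_of_lt_of_le (ENNReal.coe_lt_coe.2 hu) (le_iInf₂ fun s hs => ?_)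
  rw [ENNReal.coe_le_coe]
  by_contra hlt
  rw [not_le] at hlt
  rcases lt_or_ge s t with h | h
  · exact (hpos s hs.1 h).not_ge hs.2
  · exact (hsub ⟨h, hlt⟩ : 0 < x + Y s ω).not_ge hs.2

theorem pos_of_lt_absorptionTime {Ω : Type*} {Y : ℝ≥0 → Ω → ℝ} {ω : Ω}
    (h : (t : ℝ≥0∞) < absorptionTime Y x ω) {s : ℝ≥0} (hs : 0 < s) (hst : s ≤ t) :
    0 < x + Y s ω := by
  by_contra hle
  have : absorptionTime Y x ω ≤ s := iInf₂_le s ⟨hs, not_lt.1 hle⟩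
  exact absurd (h.trans_le this) (by simpa using hst)

/-- A right-continuous path which is positive on the dyadic grid does not touch `0`, unless its
infimum over the grid vanishes. -/
theorem lt_absorptionTime_iff_grid {Ω : Type*} {Y : ℝ≥0 → Ω → ℝ} {ω : Ω} (ht : 0 < t) (hx : 0 < x)
    (h0 : Y 0 ω = 0) (hr : ∀ s, ContinuousWithinAt (fun s => Y s ω) (Ici s) s)
    (hI : x ≠ -⨅ q, Y (gridTime t q) ω) :
    (t : ℝ≥0∞) < absorptionTime Y x ω ↔ ∀ q, 0 < x + Y (gridTime t q) ω := by
  constructor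
  · intro h q
    rcases eq_or_ne (gridTime t q) 0 with hq | hq
    · rw [hq, h0, add_zero]; exact hx
    · exact pos_of_lt_absorptionTime h (pos_iff_ne_zero.2 hq) (min_le_right _ _)
  · intro h
    have hgt : gridTime t (0, 1) = t := by simp [gridTime]
    refine absorptionTime_gt_of_forall (hr t) (fun s hs hst => ?_) (hgt ▸ h (0, 1))
    by_contra hle
    rw [not_lt] at hle
    obtain ⟨k, hk1, hk2⟩ := exists_gridTime_tendsto ht hst.le
    have hlim : Tendsto (fun n => Y (gridTime t (n, k n)) ω) atTop (𝓝 (Y s ω)) :=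
      (hr s).tendsto.comp (tendsto_nhdsWithin_iff.2 ⟨hk2, Eventually.of_forall hk1⟩)
    have hge : 0 ≤ x + Y s ω := ge_of_tendsto' (hlim.const_add x) fun n => (h _).le
    have heq : Y s ω = -x := by linarith
    -- An infimum of reals has a meaningful value only for a family bounded below; positivity on the
    -- grid provides the bound `-x`.
    have hbdd : BddBelow (range fun q => Y (gridTime t q) ω) :=
      ⟨-x, by rintro _ ⟨q, rfl⟩; have := h q; simp only; linarith⟩
    apply hI
    have h1 : -x ≤ ⨅ q, Y (gridTime t q) ω := le_ciInf fun q => by have := h q; linarith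
    have h2 : ⨅ q, Y (gridTime t q) ω ≤ -x := by
      rw [← heq]
      exact ge_of_tendsto' hlim fun n => ciInf_le hbdd _
    linarith

end Path

section LevyProcess

variable {Ω : Type*} [MeasurableSpace Ω] {P : Measure Ω} {Y : ℝ≥0 → Ω → ℝ}

/-- Only times `s > 0` can absorb, and right-continuity at `0` keeps a path started at `x > 0`
positive at first, so nothing is killed at time zero. -/
theorem IsLevyProcess.killedLaw_zero [IsProbabilityMeasure P] (hY : IsLevyProcess Y P)
    {ν : Measure ℝ} (hν : ν (Iic 0) = 0) {A : Set ℝ} (hA : MeasurableSet A) :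
    killedLaw Y P ν 0 A = ν A := by
  have hpos : ∀ᵐ x ∂ν, 0 < x := by
    rw [ae_iff]; convert! hν using 2; ext; simp
  have : killedLaw Y P ν 0 A = ∫⁻ x, A.indicator 1 x ∂ν := by
    refine lintegral_congr_ae ?_
    filter_upwards [hpos] with x hx
    have hev : ∀ᵐ ω ∂P, (x + Y 0 ω ∈ A ∧ ((0 : ℝ≥0) : ℝ≥0∞) < absorptionTime Y x ω) ↔ x ∈ A := by
      filter_upwards [hY.start_zero, hY.cadlag] with ω h0 hc
      have h1 : ((0 : ℝ≥0) : ℝ≥0∞) < absorptionTime Y x ω :=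
        absorptionTime_gt_of_forall (hc 0).1 (fun s hs hs' => absurd hs' (not_lt.2 hs.le))
          (by rw [h0, add_zero]; exact hx)
      rw [h0, add_zero]
      exact and_iff_left h1
    by_cases hxA : x ∈ A
    · rw [indicator_of_mem hxA, Pi.one_apply]
      have : (fun ω => x + Y 0 ω ∈ A ∧ ((0 : ℝ≥0) : ℝ≥0∞) < absorptionTime Y x ω) =ᵐ[P]
          fun _ => True := by
        filter_upwards [hev] with ω hω
        simp only [eq_iff_iff, iff_true]
        exact hω.2 hxA
      exact (measure_congr (t := univ) this).trans measure_univ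
    · rw [indicator_of_notMem hxA]
      have : (fun ω => x + Y 0 ω ∈ A ∧ ((0 : ℝ≥0) : ℝ≥0∞) < absorptionTime Y x ω) =ᵐ[P]
          fun _ => False := by
        filter_upwards [hev] with ω hω
        simp only [eq_iff_iff, iff_false]
        exact fun h => hxA (hω.1 h)
      exact (measure_congr (t := ∅) this).trans measure_empty
  rw [this, lintegral_indicator_one hA]

/-- The killed law is dominated by the law of the process. -/
theorem killedLaw_le_conv [IsProbabilityMeasure P] (hY : ∀ t, Measurable (Y t)) (ν : Measure ℝ)
    [IsFiniteMeasure ν] (t : ℝ≥0) {A : Set ℝ} (hA : MeasurableSet A) :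
    killedLaw Y P ν t A ≤ (ν ∗ P.map (Y t)) A := by
  have : IsProbabilityMeasure (P.map (Y t)) :=
    Measure.isProbabilityMeasure_map (hY t).aemeasurable
  rw [Measure.conv, Measure.map_apply (by fun_prop) hA,
    Measure.prod_apply (measurable_add hA)]
  refine lintegral_mono fun x => ?_
  rw [Measure.map_apply (hY t) (measurable_prodMk_left (measurable_add hA))]
  exact measure_mono fun ω hω => hω.1

/-- The killed law is the limit of the discretely killed laws along dyadic grids. -/
theorem IsLevyProcess.tendsto_iterate_killedStep [IsProbabilityMeasure P] (hY : IsLevyProcess Y P)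
    {ν : Measure ℝ} [IsFiniteMeasure ν] (hν : ν (Iic 0) = 0) (hac : ν ≪ volume) {t : ℝ≥0}
    (ht : 0 < t) {A : Set ℝ} (hA : MeasurableSet A) :
    Tendsto (fun n : ℕ => (killedStep (P.map (Y (t / 2 ^ n))))^[2 ^ n] ν A) atTop
      (𝓝 (killedLaw Y P ν t A)) := by
  have hm := hY.measurable
  set E : ℕ → Set (ℝ × Ω) := fun n => positiveAt Y (fun j => j * (t / 2 ^ n)) (2 ^ n) with hE
  have hEm : ∀ n, MeasurableSet (E n) := fun n => measurableSet_positiveAt hm _ _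
  set X : ℝ × Ω → ℝ := fun q => q.1 + Y t q.2 with hX
  have hXm : Measurable X := measurable_fst.add ((hm t).comp measurable_snd)
  have htn : ∀ n : ℕ, ((2 ^ n : ℕ) : ℝ≥0) * (t / 2 ^ n) = t := fun n => by
    push_cast
    field_simp
  have hval : ∀ n : ℕ, (killedStep (P.map (Y (t / 2 ^ n))))^[2 ^ n] ν A =
      (ν.prod P) (E n ∩ X ⁻¹' A) := by
    intro n
    rw [hY.iterate_killedStep_eq ν, htn, Measure.map_apply hXm hA,
      Measure.restrict_apply (hXm hA), inter_comm]
  -- Point `j` of a grid is point `2 j` of the next one, so refining the grid adds constraints.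
  have hanti : Antitone E := by
    refine antitone_nat_of_succ_le fun n q hq j hj1 hj2 => ?_
    have := hq (2 * j) (by omega) (by rw [pow_succ]; omega)
    have e : ((2 * j : ℕ) : ℝ≥0) * (t / 2 ^ (n + 1)) = j * (t / 2 ^ n) := by
      push_cast
      rw [pow_succ]
      field_simp
    simpa only [e] using this
  simp_rw [hval]
  have hlim : Tendsto (fun n => (ν.prod P) (E n ∩ X ⁻¹' A)) atTop
      (𝓝 ((ν.prod P) (⋂ n, E n ∩ X ⁻¹' A))) :=
    tendsto_measure_iInter_atTop (fun n => ((hEm n).inter (hXm hA)).nullMeasurableSet)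
      (fun i j hij => inter_subset_inter_left _ (hanti hij)) ⟨0, measure_ne_top _ _⟩
  convert! hlim using 2
  set I : Ω → ℝ := fun ω => ⨅ q, Y (gridTime t q) ω with hI
  have hIm : Measurable I := Measurable.iInf fun q => hm _
  -- For each path the only bad start is the point `-I ω`, at which the path may touch `0` between
  -- grid times; `ν` does not charge points.
  have hIac : ∀ᵐ q ∂(ν.prod P), q.1 ≠ -I q.2 := by
    rw [ae_iff]
    have hset : MeasurableSet {q : ℝ × Ω | ¬q.1 ≠ -I q.2} := by
      simp only [not_not]
      exact measurableSet_eq_fun measurable_fst (hIm.neg.comp measurable_snd)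
    rw [Measure.prod_apply_symm hset]
    have : ∀ ω, ν ((fun x => (x, ω)) ⁻¹' {q : ℝ × Ω | ¬q.1 ≠ -I q.2}) = 0 := by
      intro ω
      have : ((fun x => (x, ω)) ⁻¹' {q : ℝ × Ω | ¬q.1 ≠ -I q.2}) = {-I ω} := by
        ext x; simp
      rw [this]
      exact hac (measure_singleton _)
    simp only [this, lintegral_zero]
  have hpos : ∀ᵐ x ∂ν, 0 < x := by
    rw [ae_iff]; convert! hν using 2; ext; simp
  rw [Measure.prod_apply (MeasurableSet.iInter fun n => (hEm n).inter (hXm hA))]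
  refine lintegral_congr_ae ?_
  filter_upwards [hpos, Measure.ae_ae_of_ae_prod hIac] with x hx hxI
  -- Measurability of the absorption event is not needed: for almost every `x` it agrees almost
  -- surely with the measurable grid event.
  refine measure_congr ?_
  filter_upwards [hY.start_zero, hY.cadlag, hxI] with ω h0 hc hne
  have key := lt_absorptionTime_iff_grid ht hx h0 (fun s => (hc s).1) hne
  have hgrid : (∀ q, 0 < x + Y (gridTime t q) ω) ↔ ∀ n, (x, ω) ∈ E n := by
    constructor
    · intro h n j hj1 hj2
      have e : gridTime t (n, j) = j * (t / 2 ^ n) := by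
        refine min_eq_left ?_
        calc (j : ℝ≥0) * (t / 2 ^ n) ≤ ((2 ^ n : ℕ) : ℝ≥0) * (t / 2 ^ n) := by gcongr
          _ = t := htn n
      simpa only [e] using h (n, j)
    · rintro h ⟨n, j⟩
      rcases Nat.eq_zero_or_pos j with rfl | hj
      · have : gridTime t (n, 0) = 0 := by simp [gridTime]
        rw [this, h0, add_zero]; exact hx
      · rcases le_total j (2 ^ n) with hle | hle
        · have e : gridTime t (n, j) = j * (t / 2 ^ n) := by
            refine min_eq_left ?_
            calc (j : ℝ≥0) * (t / 2 ^ n) ≤ ((2 ^ n : ℕ) : ℝ≥0) * (t / 2 ^ n) := by gcongr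
              _ = t := htn n
          rw [e]
          exact h n j hj hle
        · have e : gridTime t (n, j) = ((2 ^ n : ℕ) : ℝ≥0) * (t / 2 ^ n) := by
            rw [htn]
            refine min_eq_right ?_
            calc t = ((2 ^ n : ℕ) : ℝ≥0) * (t / 2 ^ n) := (htn n).symm
              _ ≤ j * (t / 2 ^ n) := by gcongr
          rw [e]
          exact h n (2 ^ n) Nat.one_le_two_pow le_rfl
  refine propext ?_
  change (x + Y t ω ∈ A ∧ (t : ℝ≥0∞) < absorptionTime Y x ω) ↔ (x, ω) ∈ ⋂ n, E n ∩ X ⁻¹' A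
  rw [key, hgrid, mem_iInter]
  exact ⟨fun h n => ⟨h.2 n, h.1⟩, fun h => ⟨(h 0).2, fun n => (h n).1⟩⟩

end LevyProcess

/-! ### Small-time estimates and comparison of killed with free evolution. -/

section Semigroup

variable {p : ℝ≥0 → Measure ℝ} {b σ : ℝ} {Λ : Measure ℝ}

theorem IsLevySemigroup.conv_eq (hp : IsLevySemigroup p b σ Λ) (s t : ℝ≥0) :
    p s ∗ p t = p (s + t) := by
  have := hp.prob
  refine Measure.ext_of_charFun (funext fun ξ => ?_)
  rw [hp.charFun_conv_eq, hp.charFun_eq, hp.charFun_eq, ← Complex.exp_add]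
  congr 1
  push_cast
  ring

theorem IsLevySemigroup.zero (hp : IsLevySemigroup p b σ Λ) : p 0 = Measure.dirac 0 := by
  have := hp.prob
  refine Measure.ext_of_charFun (funext fun ξ => ?_)
  rw [hp.charFun_eq, charFun_dirac]
  simp

theorem IsLevySemigroup.norm_charFun_le (hp : IsLevySemigroup p b σ Λ) (hΛ : IsLevyMeasure Λ)
    (t : ℝ≥0) (ξ : ℝ) : ‖charFun (p t) ξ‖ ≤ Real.exp (-(t * σ ^ 2 / 2) * ξ ^ 2) := by
  rw [hp.charFun_eq, Complex.norm_exp, Complex.re_ofReal_mul, Real.exp_le_exp]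
  have := mul_le_mul_of_nonneg_left (re_levyExponent_le hΛ b σ ξ) t.coe_nonneg
  linarith

/-- The Gaussian component makes the law absolutely continuous. -/
theorem IsLevySemigroup.absolutelyContinuous (hp : IsLevySemigroup p b σ Λ)
    (hΛ : IsLevyMeasure Λ) (hσ : 0 < σ) {t : ℝ≥0} (ht : 0 < t) : p t ≪ volume := by
  have := hp.prob t
  have ht' : (0 : ℝ) < t := ht
  have hi : Integrable (charFun (p t)) :=
    (integrable_exp_neg_mul_sq (b := t * σ ^ 2 / 2) (by positivity)).mono'
      measurable_charFun.aestronglyMeasurable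
      (ae_of_all _ fun ξ => hp.norm_charFun_le hΛ t ξ)
  obtain ⟨w, -, -, -, -, hw⟩ := exists_density_of_integrable_charFun hi
  rw [hw]
  exact withDensity_absolutelyContinuous _ _

/-- Small time bound for the probability of leaving a neighbourhood of the starting point. -/
theorem IsLevySemigroup.exists_measureReal_abs_gt_le (hp : IsLevySemigroup p b σ Λ)
    (hΛ : IsLevyMeasure Λ) {δ : ℝ} (hδ : 0 < δ) :
    ∃ C, 0 ≤ C ∧ ∀ t : ℝ≥0, (p t).real {x | δ < |x|} ≤ C * t := by
  obtain ⟨C, hC0, hC⟩ := exists_norm_levyExponent_le hΛ b σ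
  refine ⟨2 * (C * (1 + (2 * δ⁻¹) ^ 2)), by positivity, fun t => ?_⟩
  have := hp.prob t
  refine (measureReal_abs_gt_le_integral_charFun hδ).trans ?_
  -- The tail at `δ` is controlled by `1 - charFun` on the window `|ξ| ≤ 2 / δ`, where `1 - exp (t
  -- Ψ)` is `O(t)`.
  have hb : ∀ ξ ∈ uIoc (-2 * δ⁻¹) (2 * δ⁻¹), ‖1 - charFun (p t) ξ‖ ≤
      t * (C * (1 + (2 * δ⁻¹) ^ 2)) := by
    intro ξ hξ
    have hle : -2 * δ⁻¹ ≤ 2 * δ⁻¹ := by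
      have : 0 < δ⁻¹ := by positivity
      linarith
    rw [uIoc_of_le hle] at hξ
    have hξ2 : ξ ^ 2 ≤ (2 * δ⁻¹) ^ 2 := by
      refine sq_le_sq' ?_ hξ.2
      linarith [hξ.1]
    have h1 := norm_cexp_mul_sub_le (re_levyExponent_nonpos hΛ b σ ξ) le_rfl t.coe_nonneg
    rw [hp.charFun_eq, norm_sub_rev]
    simp only [Complex.ofReal_zero, zero_mul, Complex.exp_zero, sub_zero] at h1
    refine h1.trans ?_
    rw [mul_comm]
    refine mul_le_mul_of_nonneg_left ((hC ξ).trans ?_) t.coe_nonneg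
    gcongr
  have := intervalIntegral.norm_integral_le_of_norm_le_const hb
  refine (mul_le_mul_of_nonneg_left this (by positivity)).trans (le_of_eq ?_)
  rw [show 2 * δ⁻¹ - -2 * δ⁻¹ = 4 * δ⁻¹ by ring, abs_of_pos (by positivity)]
  field_simp
  ring

theorem conv_restrict_Iic_le {q κ : Measure ℝ} [IsProbabilityMeasure q] [IsFiniteMeasure κ]
    (hκ : κ (Ioi 0) = 0) (δ : ℝ) : (κ ∗ q) (Ioi δ) ≤ q (Ioi δ) * κ univ := by
  rw [Measure.conv, Measure.map_apply (by fun_prop) measurableSet_Ioi,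
    Measure.prod_apply (measurable_add measurableSet_Ioi)]
  have hle : ∀ᵐ x ∂κ, x ≤ 0 := by
    rw [ae_iff]; convert! hκ using 2; ext; simp
  calc ∫⁻ x, q (Prod.mk x ⁻¹' ((fun z : ℝ × ℝ => z.1 + z.2) ⁻¹' Ioi δ)) ∂κ
      ≤ ∫⁻ _, q (Ioi δ) ∂κ := by
        refine lintegral_mono_ae ?_
        filter_upwards [hle] with x hx
        refine measure_mono fun y hy => ?_
        have : δ < x + y := hy
        exact mem_Ioi.2 (by linarith)
    _ = q (Ioi δ) * κ univ := by rw [lintegral_const]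

theorem conv_univ (ν q : Measure ℝ) [SFinite ν] [IsProbabilityMeasure q] :
    (ν ∗ q) univ = ν univ := by
  rw [Measure.conv, Measure.map_apply measurable_add MeasurableSet.univ, preimage_univ,
    ← univ_prod_univ, Measure.prod_prod, measure_univ (μ := q), mul_one]

theorem isFiniteMeasure_killedStep (q ν : Measure ℝ) [IsFiniteMeasure q] [IsFiniteMeasure ν] :
    IsFiniteMeasure (killedStep q ν) := by
  unfold killedStep; infer_instance

theorem isFiniteMeasure_iterate_killedStep (q ν : Measure ℝ) [IsFiniteMeasure q]
    [IsFiniteMeasure ν] (m : ℕ) : IsFiniteMeasure ((killedStep q)^[m] ν) := by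
  induction m with
  | zero => simpa
  | succ m ih =>
    rw [Function.iterate_succ_apply']
    exact isFiniteMeasure_killedStep _ _

/-- A path which was killed has to jump back from `(-∞, 0]` in order to contribute to the mass
of `(δ, ∞)`. -/
theorem IsLevySemigroup.conv_add_le_iterate (hp : IsLevySemigroup p b σ Λ) (h : ℝ≥0) (δ : ℝ)
    {c : ℝ≥0∞} (m : ℕ) (hc : ∀ j ≤ m, p (j * h) (Ioi δ) ≤ c) (ν : Measure ℝ) [IsFiniteMeasure ν] :
    (ν ∗ p (m * h)) (Ioi δ) + c * ((killedStep (p h))^[m] ν) univ ≤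
      ((killedStep (p h))^[m] ν) (Ioi δ) + c * ν univ := by
  have hpr := hp.prob
  induction m generalizing ν with
  | zero =>
    simp only [Nat.cast_zero, zero_mul, Function.iterate_zero, id]
    rw [hp.zero, Measure.conv_dirac_zero]
  | succ m ih =>
    have := isFiniteMeasure_killedStep (p h) ν
    -- `κ` is the mass killed at the first step. It restarts in `(-∞, 0]`, so freely evolved it puts
    -- at most `c * κ univ` above `δ`; the survivors fall under the induction hypothesis, which is
    -- why `ν` is generalized. The inequality is written with sums to avoid truncated subtraction.
    set κ : Measure ℝ := (ν ∗ p h).restrict (Iic 0) with hκ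
    have hsplit : ν ∗ p h = killedStep (p h) ν + κ := by
      rw [killedStep, hκ, ← compl_Ioi, Measure.restrict_add_restrict_compl measurableSet_Ioi]
    have hmass : ν univ = killedStep (p h) ν univ + κ univ := by
      rw [← Measure.add_apply, ← hsplit, conv_univ]
    have hstep : ν ∗ p ((m + 1 : ℕ) * h) = killedStep (p h) ν ∗ p (m * h) + κ ∗ p (m * h) := by
      rw [← Measure.add_conv, ← hsplit, Measure.conv_assoc, hp.conv_eq]
      congr 2
      push_cast
      ring
    have hκ0 : κ (Ioi 0) = 0 := by
      rw [hκ, Measure.restrict_apply measurableSet_Ioi, Ioi_inter_Iic, Ioc_self, measure_empty]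
    rw [hstep, Measure.add_apply, Function.iterate_succ_apply, hmass, mul_add]
    have h1 := ih (fun j hj => hc j (by omega)) (killedStep (p h) ν)
    have h2 := (conv_restrict_Iic_le (q := p (m * h)) hκ0 δ).trans
      (mul_le_mul_left (hc m (by omega)) _)
    calc _ = ((killedStep (p h) ν ∗ p (m * h)) (Ioi δ) +
          c * ((killedStep (p h))^[m] (killedStep (p h) ν)) univ) + (κ ∗ p (m * h)) (Ioi δ) := by
          ring
      _ ≤ _ := add_le_add h1 h2
      _ = _ := by ring

theorem killedStep_mono {q ν ν' : Measure ℝ} [SFinite q] [SFinite ν] [SFinite ν'] (h : ν ≤ ν') :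
    killedStep q ν ≤ killedStep q ν' := by
  unfold killedStep
  exact Measure.restrict_mono le_rfl (Measure.map_mono (Measure.prod_mono h le_rfl) (by fun_prop))

theorem IsLevySemigroup.iterate_killedStep_le_conv (hp : IsLevySemigroup p b σ Λ) (h : ℝ≥0)
    (ν : Measure ℝ) [IsFiniteMeasure ν] (m : ℕ) :
    (killedStep (p h))^[m] ν ≤ ν ∗ p (m * h) := by
  have hpr := hp.prob
  induction m with
  | zero => simp [hp.zero]
  | succ m ih =>
    have := isFiniteMeasure_iterate_killedStep (p h) ν m
    rw [Function.iterate_succ_apply']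
    refine (killedStep_mono ih).trans (Measure.restrict_le_self.trans ?_)
    rw [Measure.conv_assoc, hp.conv_eq]
    refine le_of_eq ?_
    congr 2
    push_cast
    ring

end Semigroup

/-! ### Eigenmeasures of the killed semigroup, their excess and their exit measure. -/

theorem integrable_charFun_integrand (μ : Measure ℝ) [IsFiniteMeasure μ] (ξ : ℝ) :
    Integrable (fun x : ℝ => Complex.exp (ξ * x * Complex.I)) μ := by
  refine (integrable_const (1 : ℝ)).mono' (by fun_prop) (ae_of_all _ fun x => ?_)
  have : (ξ * x * Complex.I : ℂ) = ((ξ * x : ℝ) : ℂ) * Complex.I := by push_cast; rfl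
  rw [this, Complex.norm_exp_ofReal_mul_I]

theorem charFun_add_measure (μ ν : Measure ℝ) [IsFiniteMeasure μ] [IsFiniteMeasure ν] (ξ : ℝ) :
    charFun (μ + ν) ξ = charFun μ ξ + charFun ν ξ := by
  simp_rw [charFun_apply_real]
  exact integral_add_measure (integrable_charFun_integrand μ ξ) (integrable_charFun_integrand ν ξ)

theorem charFun_smul_measure (c : ℝ≥0∞) (μ : Measure ℝ) (ξ : ℝ) :
    charFun (c • μ) ξ = c.toReal * charFun μ ξ := by
  simp_rw [charFun_apply_real]
  rw [integral_smul_measure, Complex.real_smul]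

theorem two_pow_mul_div (t : ℝ≥0) (n : ℕ) : ((2 ^ n : ℕ) : ℝ≥0) * (t / 2 ^ n) = t := by
  push_cast
  field_simp

/-- `ν` is invariant up to the factor `e^{-rt}` for the limit of the discretely killed semigroups
of `p`. -/
def IsKilledEigenmeasure (p : ℝ≥0 → Measure ℝ) (ν : Measure ℝ) (r : ℝ) : Prop :=
  ∀ t : ℝ≥0, 0 < t → ∀ A, MeasurableSet A →
    Tendsto (fun n : ℕ => (killedStep (p (t / 2 ^ n)))^[2 ^ n] ν A) atTop
      (𝓝 (ENNReal.ofReal (Real.exp (-r * t)) * ν A))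

/-- `ν` loses mass at most at rate `r` under the semigroup of `p`. -/
def IsSubinvariant (p : ℝ≥0 → Measure ℝ) (ν : Measure ℝ) (r : ℝ) : Prop :=
  ∀ t : ℝ≥0, 0 < t → ENNReal.ofReal (Real.exp (-r * t)) • ν ≤ ν ∗ p t

/-- The excess of `ν ∗ p t` over `e^{-rt} ν`. -/
noncomputable def excess (p : ℝ≥0 → Measure ℝ) (ν : Measure ℝ) (r : ℝ) (t : ℝ≥0) : Measure ℝ :=
  ν ∗ p t - ENNReal.ofReal (Real.exp (-r * t)) • ν

section Semigroup

variable {p : ℝ≥0 → Measure ℝ} {b σ : ℝ} {Λ ν : Measure ℝ} {r : ℝ}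

/-- Every grid law lies below the law without killing, and the inequality passes to the limit. -/
theorem IsKilledEigenmeasure.isSubinvariant [IsProbabilityMeasure ν]
    (hν : IsKilledEigenmeasure p ν r) (hp : IsLevySemigroup p b σ Λ) : IsSubinvariant p ν r := by
  intro t ht
  refine Measure.le_iff.2 fun A hA => ?_
  rw [Measure.smul_apply, smul_eq_mul]
  refine le_of_tendsto' (hν t ht A hA) fun n => ?_
  have := hp.iterate_killedStep_le_conv (t / 2 ^ n) ν (2 ^ n) A
  rwa [two_pow_mul_div] at this

theorem IsSubinvariant.rate_nonneg [IsProbabilityMeasure ν]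
    (hν : IsSubinvariant p ν r) (hp : IsLevySemigroup p b σ Λ) : 0 ≤ r := by
  have hpr := hp.prob
  have := hν 1 zero_lt_one univ
  rw [conv_univ, Measure.smul_apply, measure_univ, smul_eq_mul, mul_one, ENNReal.ofReal_le_one,
    Real.exp_le_one_iff] at this
  simpa using this

/-- If `r = 0`, the domination between measures of equal mass forces `ν = ν ∗ p 1`. As `|charFun (p
1)| < 1` away from `0`, `charFun ν` would vanish there, against its continuity and its value `1` at
`0`. -/
theorem IsSubinvariant.rate_pos [IsProbabilityMeasure ν]
    (hν : IsSubinvariant p ν r) (hp : IsLevySemigroup p b σ Λ) (hΛ : IsLevyMeasure Λ)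
    (hσ : 0 < σ) : 0 < r := by
  have hpr := hp.prob
  refine lt_of_le_of_ne (hν.rate_nonneg hp) fun h0 => ?_
  have hle := hν 1 zero_lt_one
  rw [← h0] at hle
  simp only [neg_zero, zero_mul, Real.exp_zero, ENNReal.ofReal_one, one_smul] at hle
  have heq : ν = ν ∗ p 1 := by
    refine Measure.eq_of_le_of_measure_univ_eq hle ?_
    rw [conv_univ]
  have hone : ∀ ξ : ℝ, ξ ≠ 0 → charFun ν ξ = 0 := by
    intro ξ hξ
    by_contra hne
    have h1 := hp.charFun_conv_eq ν 1 ξ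
    rw [← heq, ← hp.charFun_eq] at h1
    have h2 : charFun (p 1) ξ = 1 := by
      have := mul_left_cancel₀ hne ((mul_one _).trans h1)
      exact this.symm
    have h3 := hp.norm_charFun_le hΛ 1 ξ
    rw [h2, norm_one] at h3
    have h4 : Real.exp (-((1 : ℝ≥0) * σ ^ 2 / 2) * ξ ^ 2) < 1 := by
      rw [Real.exp_lt_one_iff]
      have : 0 < σ ^ 2 * ξ ^ 2 := by positivity
      push_cast
      linarith
    exact absurd h3 (not_le.2 h4)
  have hc : Continuous (charFun ν) := continuous_charFun
  have h5 : Tendsto (charFun ν) (𝓝[≠] 0) (𝓝 (charFun ν 0)) :=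
    (hc.tendsto 0).mono_left nhdsWithin_le_nhds
  have h6 : Tendsto (charFun ν) (𝓝[≠] 0) (𝓝 0) :=
    tendsto_const_nhds.congr' (by
      filter_upwards [self_mem_nhdsWithin] with ξ hξ using (hone ξ hξ).symm)
  have h7 := tendsto_nhds_unique h5 h6
  rw [charFun_zero] at h7
  simp at h7

theorem IsSubinvariant.excess_add [IsProbabilityMeasure ν] (hν : IsSubinvariant p ν r)
    (hp : IsLevySemigroup p b σ Λ) {t : ℝ≥0} (ht : 0 < t) :
    excess p ν r t + ENNReal.ofReal (Real.exp (-r * t)) • ν = ν ∗ p t := by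
  have hpr := hp.prob
  have hfin : IsFiniteMeasure (ENNReal.ofReal (Real.exp (-r * t)) • ν) :=
    Measure.smul_finite ν ENNReal.ofReal_ne_top
  exact Measure.sub_add_cancel_of_le (hν t ht)

theorem isFiniteMeasure_excess [IsProbabilityMeasure ν] (hp : IsLevySemigroup p b σ Λ) (r : ℝ)
    (t : ℝ≥0) : IsFiniteMeasure (excess p ν r t) := by
  have hpr := hp.prob
  unfold excess
  infer_instance

theorem IsSubinvariant.excess_univ [IsProbabilityMeasure ν] (hν : IsSubinvariant p ν r)
    (hp : IsLevySemigroup p b σ Λ) {t : ℝ≥0} (ht : 0 < t) :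
    excess p ν r t univ = ENNReal.ofReal (1 - Real.exp (-r * t)) := by
  have hpr := hp.prob
  have h1 := congrArg (fun m : Measure ℝ => m univ) (hν.excess_add hp ht)
  simp only [Measure.add_apply, Measure.smul_apply, measure_univ, smul_eq_mul, mul_one] at h1
  rw [ENNReal.ofReal_sub 1 (Real.exp_pos _).le, ENNReal.ofReal_one, ← h1]
  exact (ENNReal.add_sub_cancel_right ENNReal.ofReal_ne_top).symm

/-- The excess per unit time converges weakly to a multiple of the measure `L* ν + r ν`, written
in Fourier variables. -/
theorem IsSubinvariant.exists_tendsto_excess [IsProbabilityMeasure ν]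
    (hν : IsSubinvariant p ν r) (hp : IsLevySemigroup p b σ Λ) (hΛ : IsLevyMeasure Λ)
    (hσ : 0 < σ) {t : ℕ → ℝ≥0} (ht : ∀ n, 0 < t n) (ht' : Tendsto t atTop (𝓝 0)) :
    ∃ (M : ℕ → ProbabilityMeasure ℝ) (μ : ProbabilityMeasure ℝ),
      (∀ n, (M n : Measure ℝ) =
        (ENNReal.ofReal (1 - Real.exp (-r * t n)))⁻¹ • excess p ν r (t n)) ∧
      Tendsto M atTop (𝓝 μ) ∧
      ∀ ξ, charFun (μ : Measure ℝ) ξ = charFun ν ξ * (levyExponent b σ Λ ξ + r) / r := by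
  have hpr := hp.prob
  have hr : 0 < r := hν.rate_pos hp hΛ hσ
  have ht0 : Tendsto (fun n => (t n : ℝ)) atTop (𝓝[>] 0) :=
    tendsto_nhdsWithin_iff.2 ⟨by simpa using (NNReal.tendsto_coe.2 ht'),
      Eventually.of_forall fun n => ht n⟩
  set e : ℕ → ℝ := fun n => Real.exp (-r * t n) with he
  have he1 : ∀ n, e n < 1 := fun n => by
    simp only [he]
    rw [Real.exp_lt_one_iff]
    have : (0 : ℝ) < t n := ht n
    nlinarith
  have he0 : ∀ n, 0 < e n := fun n => Real.exp_pos _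
  set κ : ℕ → Measure ℝ := fun n => excess p ν r (t n) with hκ
  have hfin : ∀ n, IsFiniteMeasure (ENNReal.ofReal (e n) • ν) := fun n =>
    Measure.smul_finite ν ENNReal.ofReal_ne_top
  have hκadd : ∀ n, κ n + ENNReal.ofReal (e n) • ν = ν ∗ p (t n) := fun n =>
    hν.excess_add hp (ht n)
  have hκfin : ∀ n, IsFiniteMeasure (κ n) := fun n => isFiniteMeasure_excess hp r (t n)
  have hκuniv : ∀ n, κ n univ = ENNReal.ofReal (1 - e n) := fun n => hν.excess_univ hp (ht n)
  have hm0 : ∀ n, ENNReal.ofReal (1 - e n) ≠ 0 := fun n =>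
    (ENNReal.ofReal_pos.2 (by linarith [he1 n])).ne'
  set m : ℕ → Measure ℝ := fun n => (ENNReal.ofReal (1 - e n))⁻¹ • κ n with hm
  have hmp : ∀ n, IsProbabilityMeasure (m n) := fun n => ⟨by
    simp only [hm, Measure.smul_apply, smul_eq_mul, hκuniv]
    exact ENNReal.inv_mul_cancel (hm0 n) ENNReal.ofReal_ne_top⟩
  set φ : ℝ → ℂ := fun ξ => charFun ν ξ * (levyExponent b σ Λ ξ + r) / r with hφ
  have hchar : ∀ n ξ, charFun (m n) ξ = ((1 - e n : ℝ) : ℂ)⁻¹ * (charFun ν ξ *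
      (Complex.exp ((t n : ℝ) * levyExponent b σ Λ ξ) - (e n : ℂ))) := by
    intro n ξ
    have h1 := congrArg (fun m : Measure ℝ => charFun m ξ) (hκadd n)
    rw [charFun_add_measure, charFun_smul_measure, hp.charFun_conv_eq,
      ENNReal.toReal_ofReal (he0 n).le] at h1
    simp only [hm]
    rw [charFun_smul_measure, ENNReal.toReal_inv, ENNReal.toReal_ofReal (by linarith [he1 n]),
      eq_sub_of_add_eq h1]
    push_cast
    ring
  have hder : ∀ z : ℂ, Tendsto (fun s : ℝ => (s : ℂ)⁻¹ * (Complex.exp (s * z) - 1)) (𝓝[>] 0)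
      (𝓝 z) := by
    intro z
    have h1 := hasDerivAt_iff_tendsto_slope.1 (hasDerivAt_cexp_mul z 0)
    have h2 := h1.mono_left (nhdsWithin_mono 0 (fun s (hs : 0 < s) => ne_of_gt hs))
    simp only [Complex.ofReal_zero, mul_zero, Complex.exp_zero, mul_one] at h2
    refine h2.congr fun s => ?_
    rw [slope_def_module, Complex.real_smul]
    simp [mul_comm]
  have hlim : ∀ ξ, Tendsto (fun n => charFun (m n) ξ) atTop (𝓝 (φ ξ)) := by
    intro ξ
    have h1 := (hder (levyExponent b σ Λ ξ)).comp ht0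
    have h2 := (hder (-(r : ℂ))).comp ht0
    have hrne : (r : ℂ) ≠ 0 := Complex.ofReal_ne_zero.2 hr.ne'
    -- After division by `t`, the numerator `(e^{tΨ} - 1) - (e^{-rt} - 1)` tends to `Ψ + r` and the
    -- mass `1 - e^{-rt}` tends to `r`.
    have h3 := ((h1.sub h2).div h2.neg (by simpa using hrne)).const_mul (charFun ν ξ)
    have h4 : charFun ν ξ * ((levyExponent b σ Λ ξ - -(r : ℂ)) / - -(r : ℂ)) = φ ξ := by
      simp only [hφ, sub_neg_eq_add, neg_neg]; ring
    rw [h4] at h3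
    refine h3.congr fun n => ?_
    rw [hchar]
    have htne : ((t n : ℝ) : ℂ) ≠ 0 := Complex.ofReal_ne_zero.2 (NNReal.coe_ne_zero.2 (ht n).ne')
    have hexp : Complex.exp (((t n : ℝ) : ℂ) * -(r : ℂ)) = (e n : ℂ) := by
      simp only [he]
      rw [Complex.ofReal_exp]
      congr 1
      push_cast
      ring
    have hene : (1 : ℂ) - (e n : ℂ) ≠ 0 := by
      have : ((1 - e n : ℝ) : ℂ) ≠ 0 := Complex.ofReal_ne_zero.2 (by linarith [he1 n])
      simpa using this
    simp only [Pi.div_apply, Function.comp, hexp]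
    have hden : -((((t n : ℝ) : ℂ))⁻¹ * ((e n : ℂ) - 1)) =
        ((t n : ℝ) : ℂ)⁻¹ * (1 - (e n : ℂ)) := by ring
    rw [hden]
    push_cast
    field_simp
    ring
  have hφc : ContinuousAt φ 0 := by
    have hz : ContinuousAt (levyExponent b σ Λ) 0 := by
      have hsf := hΛ.sigmaFinite
      have hj : ContinuousAt (fun ξ : ℝ => ∫ y, jumpChar ξ y ∂Λ) 0 := by
        refine continuousAt_of_dominated (bound := fun y => 2 * (1 + 1 ^ 2) * min 1 (y ^ 2)) ?_ ?_
          (hΛ.integrable_min.const_mul _) ?_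
        · exact Eventually.of_forall fun ξ => (measurable_jumpChar_right ξ).aestronglyMeasurable
        · filter_upwards [Icc_mem_nhds (show (-1 : ℝ) < 0 by norm_num) (show (0 : ℝ) < 1 by norm_num)]
            with ξ hξ
          refine ae_of_all _ fun y => (norm_jumpChar_le ξ y).trans ?_
          have : ξ ^ 2 ≤ 1 ^ 2 := sq_le_sq' hξ.1 hξ.2
          gcongr
        · refine ae_of_all _ fun y => Continuous.continuousAt ?_
          unfold jumpChar
          fun_prop
      have hq : Continuous fun ξ : ℝ => Complex.I * b * ξ - (σ : ℂ) ^ 2 * (ξ : ℂ) ^ 2 / 2 := by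
        fun_prop
      exact hq.continuousAt.add hj
    have hc : Continuous (charFun ν) := continuous_charFun
    exact (hc.continuousAt.mul (hz.add continuousAt_const)).div_const _
  -- Lévy's continuity theorem: continuity of the limit at `0` gives tightness, so a limit point
  -- exists along an ultrafilter. Its characteristic function must be `φ`, and then the whole
  -- sequence converges.
  have htight : IsTightMeasureSet (range m) := isTightMeasureSet_of_tendsto_charFun hφc hlim
  set M : ℕ → ProbabilityMeasure ℝ := fun n => ⟨m n, hmp n⟩ with hM
  have hcomp : IsCompact (closure (range M)) := by
    refine isCompact_closure_of_isTightMeasureSet ?_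
    convert! htight using 1
    ext q
    constructor
    · rintro ⟨x, ⟨n, rfl⟩, rfl⟩
      exact ⟨n, rfl⟩
    · rintro ⟨n, rfl⟩
      exact ⟨M n, ⟨n, rfl⟩, rfl⟩
  set U : Ultrafilter ℕ := Ultrafilter.of atTop with hU
  have hUle : (U : Filter ℕ) ≤ atTop := Ultrafilter.of_le atTop
  obtain ⟨μ', -, hμ'⟩ := hcomp.ultrafilter_le_nhds (U.map M)
    (.trans (by simp) (monotone_principal subset_closure))
  have hconv : Tendsto M U (𝓝 μ') := hμ'
  have hchar' : ∀ ξ, charFun (μ' : Measure ℝ) ξ = φ ξ := by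
    intro ξ
    refine tendsto_nhds_unique ?_ ((hlim ξ).mono_left hUle)
    have := (ProbabilityMeasure.tendsto_iff_forall_integral_rclike_tendsto ℂ).1 hconv
      (BoundedContinuousFunction.innerProbChar ξ)
    simp only [← charFun_eq_integral_innerProbChar] at this
    exact this
  refine ⟨M, μ', fun n => rfl, ?_, hchar'⟩
  refine ProbabilityMeasure.tendsto_iff_tendsto_charFun.2 fun ξ => ?_
  rw [hchar']
  exact hlim ξ

/-- The mass created on `(δ, ∞)` by not killing the paths is of smaller order. -/
theorem IsKilledEigenmeasure.conv_add_le [IsProbabilityMeasure ν]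
    (hν : IsKilledEigenmeasure p ν r) (hp : IsLevySemigroup p b σ Λ) {t : ℝ≥0} (ht : 0 < t)
    {δ : ℝ} {c : ℝ≥0∞} (hc : c ≠ ⊤) (hcp : ∀ s ≤ t, p s (Ioi δ) ≤ c) :
    (ν ∗ p t) (Ioi δ) + c * ENNReal.ofReal (Real.exp (-r * t)) ≤
      ENNReal.ofReal (Real.exp (-r * t)) * ν (Ioi δ) + c := by
  have h1 := hν t ht (Ioi δ) measurableSet_Ioi
  have h2 := hν t ht univ MeasurableSet.univ
  rw [measure_univ, mul_one] at h2
  refine le_of_tendsto_of_tendsto' (tendsto_const_nhds.add (ENNReal.Tendsto.const_mul h2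
    (Or.inr hc))) (h1.add tendsto_const_nhds) fun n => ?_
  have := hp.conv_add_le_iterate (t / 2 ^ n) δ (2 ^ n) (c := c) (fun j hj => hcp _ ?_) ν
  · rwa [two_pow_mul_div, measure_univ (μ := ν), mul_one] at this
  · calc (j : ℝ≥0) * (t / 2 ^ n) ≤ ((2 ^ n : ℕ) : ℝ≥0) * (t / 2 ^ n) := by gcongr
      _ = t := two_pow_mul_div t n

/-- The excess above `δ` comes from killed paths only: killed mass `1 - e^{-rt}` times the chance
`c` of climbing by `δ` in the remaining time. -/
theorem IsKilledEigenmeasure.excess_Ioi_le [IsProbabilityMeasure ν]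
    (hν : IsKilledEigenmeasure p ν r) (hp : IsLevySemigroup p b σ Λ) {t : ℝ≥0} (ht : 0 < t)
    {δ : ℝ} {c : ℝ≥0∞} (he1 : Real.exp (-r * t) ≤ 1) (hc : c ≠ ⊤) (hcp : ∀ s ≤ t, p s (Ioi δ) ≤ c) :
    excess p ν r t (Ioi δ) ≤ c * ENNReal.ofReal (1 - Real.exp (-r * t)) := by
  have h1 := hν.conv_add_le hp ht hc hcp
  have h2 := congrArg (fun m : Measure ℝ => m (Ioi δ)) ((hν.isSubinvariant hp).excess_add hp ht)
  simp only [Measure.add_apply, Measure.smul_apply, smul_eq_mul] at h2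
  rw [← h2] at h1
  set e := Real.exp (-r * t) with he
  have h3 : excess p ν r t (Ioi δ) + c * ENNReal.ofReal e ≤ c := by
    have hne : ENNReal.ofReal e * ν (Ioi δ) ≠ ⊤ :=
      ENNReal.mul_ne_top ENNReal.ofReal_ne_top (measure_ne_top _ _)
    refine (ENNReal.add_le_add_iff_left hne).1 (le_trans (le_of_eq ?_) h1)
    ring
  have h4 : c = c * ENNReal.ofReal (1 - e) + c * ENNReal.ofReal e := by
    rw [← mul_add, ← ENNReal.ofReal_add (by linarith) (Real.exp_pos _).le, sub_add_cancel,
      ENNReal.ofReal_one, mul_one]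
  rw [h4] at h3
  refine (ENNReal.add_le_add_iff_right (ENNReal.mul_ne_top hc ENNReal.ofReal_ne_top)).1
    (le_trans ?_ h3)
  rw [← h4]

/-- The instantaneous exit measure of a quasi-stationary distribution: a finite measure `μ` on
`(-∞, 0]` with `L* ν + r ν = μ`, written in Fourier variables. -/
theorem IsKilledEigenmeasure.exists_exitMeasure [IsProbabilityMeasure ν]
    (hν : IsKilledEigenmeasure p ν r) (hp : IsLevySemigroup p b σ Λ) (hΛ : IsLevyMeasure Λ)
    (hσ : 0 < σ) :
    ∃ μ : Measure ℝ, IsFiniteMeasure μ ∧ μ (Ioi 0) = 0 ∧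
      ∀ ξ, charFun μ ξ = charFun ν ξ * (levyExponent b σ Λ ξ + r) := by
  have hpr := hp.prob
  have hsub := hν.isSubinvariant hp
  have hr : 0 < r := hsub.rate_pos hp hΛ hσ
  set t : ℕ → ℝ≥0 := fun n => 1 / ((n : ℝ≥0) + 1) with htdef
  have ht : ∀ n, 0 < t n := fun n => by simp only [htdef]; positivity
  have ht0 : Tendsto t atTop (𝓝 0) := by
    rw [← NNReal.tendsto_coe]
    simp only [htdef]
    push_cast
    exact tendsto_one_div_add_atTop_nhds_zero_nat
  have he1 : ∀ n, Real.exp (-r * t n) < 1 := fun n => by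
    rw [Real.exp_lt_one_iff]
    have : (0 : ℝ) < t n := ht n
    nlinarith
  have hm0 : ∀ n, ENNReal.ofReal (1 - Real.exp (-r * t n)) ≠ 0 := fun n =>
    (ENNReal.ofReal_pos.2 (by linarith [he1 n])).ne'
  obtain ⟨M, μ', hM, hconv, hchar'⟩ := hsub.exists_tendsto_excess hp hΛ hσ ht ht0
  refine ⟨ENNReal.ofReal r • (μ' : Measure ℝ), Measure.smul_finite _ ENNReal.ofReal_ne_top, ?_,
    fun ξ => ?_⟩
  · rw [Measure.smul_apply, smul_eq_mul]
    have hδ : ∀ δ : ℝ, 0 < δ → (μ' : Measure ℝ) (Ioi δ) = 0 := by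
      intro δ hδ
      obtain ⟨C, hC0, hC⟩ := hp.exists_measureReal_abs_gt_le hΛ hδ
      -- Here the chance of climbing is itself `O(t n)`, so after normalization the mass above `δ`
      -- still vanishes; the portmanteau theorem on the open set `Ioi δ` transfers this to the
      -- limit.
      have hb : ∀ n, (M n : Measure ℝ) (Ioi δ) ≤ ENNReal.ofReal (C * t n) := by
        intro n
        rw [hM, Measure.smul_apply, smul_eq_mul]
        have h1 := hν.excess_Ioi_le hp (ht n) (δ := δ) (c := ENNReal.ofReal (C * t n))
          (by linarith [he1 n]) ENNReal.ofReal_ne_top ?_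
        · rw [ENNReal.inv_mul_le_iff (hm0 n) ENNReal.ofReal_ne_top, mul_comm]
          exact h1
        · intro s hs
          refine (measure_mono (fun x (hx : δ < x) => hx.trans_le (le_abs_self x))).trans
            (?_ : p s {x | δ < |x|} ≤ _)
          rw [← ofReal_measureReal]
          refine ENNReal.ofReal_le_ofReal ((hC s).trans ?_)
          gcongr
      have h2 := ProbabilityMeasure.le_liminf_measure_open_of_tendsto hconv
        (isOpen_Ioi (a := δ))
      have h3 : Tendsto (fun n => (M n : Measure ℝ) (Ioi δ)) atTop (𝓝 0) := by
        refine tendsto_of_tendsto_of_tendsto_of_le_of_le tendsto_const_nhds ?_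
          (fun n => zero_le) hb
        have := ENNReal.tendsto_ofReal ((NNReal.tendsto_coe.2 ht0).const_mul C)
        simpa using this
      rw [h3.liminf_eq] at h2
      exact le_antisymm h2 zero_le
    have hun : Ioi (0 : ℝ) = ⋃ n : ℕ, Ioi (1 / ((n : ℝ) + 1)) := by
      ext x
      simp only [mem_Ioi, mem_iUnion]
      constructor
      · intro hx; exact exists_nat_one_div_lt hx
      · rintro ⟨n, hn⟩
        exact lt_trans (by positivity) hn
    rw [hun, measure_iUnion_null fun n => hδ _ (by positivity), mul_zero]
  · rw [charFun_smul_measure, hchar', ENNReal.toReal_ofReal hr.le]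
    have hrne : (r : ℂ) ≠ 0 := Complex.ofReal_ne_zero.2 hr.ne'
    field_simp

end Semigroup

/-! ### Convolving measures on `(-∞, 0]` with kernels singular only at the origin. -/

theorem contDiffOn_two_of_hasDerivAt_complex {w w1 w2 : ℝ → ℂ} {U : Set ℝ} (hU : IsOpen U)
    (h1 : ∀ x ∈ U, HasDerivAt w (w1 x) x) (h2 : ∀ x ∈ U, HasDerivAt w1 (w2 x) x)
    (hc : ContinuousOn w2 U) : ContDiffOn ℝ 2 w U := by
  have e1 : ∀ x ∈ U, deriv w x = w1 x := fun x hx => (h1 x hx).deriv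
  refine (contDiffOn_succ_iff_deriv_of_isOpen (n := 1) hU).2
    ⟨fun x hx => (h1 x hx).differentiableAt.differentiableWithinAt, by simp, ?_⟩
  have : ContDiffOn ℝ 1 w1 U := by
    refine (contDiffOn_succ_iff_deriv_of_isOpen (n := 0) hU).2
      ⟨fun x hx => (h2 x hx).differentiableAt.differentiableWithinAt, by simp, ?_⟩
    exact contDiffOn_zero.2 (hc.congr fun x hx => (h2 x hx).deriv)
  exact this.congr e1

/-- Functions that are bounded on every `[δ, ∞)`, `δ > 0`. -/
def BoundedAwayFromZero (g : ℝ → ℂ) : Prop :=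
  ∀ δ : ℝ, 0 < δ → ∃ C : ℝ, ∀ z, δ ≤ z → ‖g z‖ ≤ C

theorem ae_nonpos_of_Ioi_eq_zero {μ : Measure ℝ} (hμ : μ (Ioi 0) = 0) : ∀ᵐ y ∂μ, y ≤ 0 := by
  rw [ae_iff]
  simpa only [not_le] using! hμ

section HalfLineConvolution

variable {μ : Measure ℝ} [IsFiniteMeasure μ] {g g1 g2 : ℝ → ℂ}

theorem integrable_halfLineConv (hμ : μ (Ioi 0) = 0) (hg : Measurable g)
    (hb : BoundedAwayFromZero g) {x : ℝ} (hx : 0 < x) : Integrable (fun y => g (x - y)) μ := by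
  obtain ⟨C, hC⟩ := hb x hx
  refine (integrable_const C).mono' (hg.comp (by fun_prop)).aestronglyMeasurable ?_
  filter_upwards [ae_nonpos_of_Ioi_eq_zero hμ] with y hy using hC _ (by linarith)

theorem continuousOn_halfLineConv (hμ : μ (Ioi 0) = 0) (hg : Measurable g)
    (hc : ContinuousOn g (Ioi 0)) (hb : BoundedAwayFromZero g) :
    ContinuousOn (fun x => ∫ y, g (x - y) ∂μ) (Ioi 0) := by
  intro x hx
  refine ContinuousAt.continuousWithinAt ?_
  have hx0 : (0 : ℝ) < x := hx
  obtain ⟨C, hC⟩ := hb (x / 2) (by positivity)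
  refine continuousAt_of_dominated (bound := fun _ => C)
    (Eventually.of_forall fun z => (hg.comp (by fun_prop)).aestronglyMeasurable) ?_
    (integrable_const C) ?_
  · filter_upwards [Ioi_mem_nhds (show x / 2 < x by linarith)] with z hz
    filter_upwards [ae_nonpos_of_Ioi_eq_zero hμ] with y hy
    exact hC _ (by have : x / 2 < z := hz; linarith)
  · filter_upwards [ae_nonpos_of_Ioi_eq_zero hμ] with y hy
    have : ContinuousAt g (x - y) := hc.continuousAt (Ioi_mem_nhds (by linarith))
    exact ContinuousAt.comp (f := fun z => z - y) this (by fun_prop)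

/-- For `y ≤ 0` and `z > x / 2` the argument `z - y` stays above `x / 2`, so bounds on `[x / 2, ∞)`
suffice to differentiate under the integral, whatever the kernel does at `0`. -/
theorem hasDerivAt_halfLineConv (hμ : μ (Ioi 0) = 0) (hg : Measurable g) (hg1 : Measurable g1)
    (h1 : ∀ z, 0 < z → HasDerivAt g (g1 z) z) (hb : BoundedAwayFromZero g)
    (hb1 : BoundedAwayFromZero g1) {x : ℝ} (hx : 0 < x) :
    HasDerivAt (fun x => ∫ y, g (x - y) ∂μ) (∫ y, g1 (x - y) ∂μ) x := by
  obtain ⟨C, hC⟩ := hb1 (x / 2) (by positivity)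
  refine (hasDerivAt_integral_of_dominated_loc_of_deriv_le (bound := fun _ => C)
    (F := fun x y => g (x - y)) (F' := fun x y => g1 (x - y))
    (Ioi_mem_nhds (show x / 2 < x by linarith))
    (Eventually.of_forall fun z => (hg.comp (by fun_prop)).aestronglyMeasurable)
    (integrable_halfLineConv hμ hg hb hx) (hg1.comp (by fun_prop)).aestronglyMeasurable ?_
    (integrable_const C) ?_).2
  · filter_upwards [ae_nonpos_of_Ioi_eq_zero hμ] with y hy z hz
    exact hC _ (by have : x / 2 < z := hz; linarith)
  · filter_upwards [ae_nonpos_of_Ioi_eq_zero hμ] with y hy z hz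
    have hz' : x / 2 < z := hz
    exact (h1 (z - y) (by linarith)).comp_sub_const z y

theorem contDiffOn_halfLineConv (hμ : μ (Ioi 0) = 0) (hg : Measurable g) (hg1 : Measurable g1)
    (hg2 : Measurable g2) (h1 : ∀ z, 0 < z → HasDerivAt g (g1 z) z)
    (h2 : ∀ z, 0 < z → HasDerivAt g1 (g2 z) z) (hc : ContinuousOn g2 (Ioi 0))
    (hb : BoundedAwayFromZero g) (hb1 : BoundedAwayFromZero g1) (hb2 : BoundedAwayFromZero g2) :
    ContDiffOn ℝ 2 (fun x => ∫ y, g (x - y) ∂μ) (Ioi 0) :=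
  contDiffOn_two_of_hasDerivAt_complex isOpen_Ioi
    (fun _ hx => hasDerivAt_halfLineConv hμ hg hg1 h1 hb hb1 hx)
    (fun _ hx => hasDerivAt_halfLineConv hμ hg1 hg2 h2 hb1 hb2 hx)
    (continuousOn_halfLineConv hμ hg2 hc hb2)

end HalfLineConvolution

theorem norm_fourier_le (G : ℝ → ℂ) (x : ℝ) : ‖𝓕 G x‖ ≤ ∫ v, ‖G v‖ := by
  rw [Real.fourier_real_eq]
  refine (norm_integral_le_integral_norm _).trans (le_of_eq ?_)
  congr 1
  ext v
  rw [Circle.norm_smul]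

theorem BoundedAwayFromZero.of_bound {g : ℝ → ℂ} {C : ℝ} (h : ∀ z, ‖g z‖ ≤ C) :
    BoundedAwayFromZero g := fun _ _ => ⟨C, fun z _ => h z⟩

theorem BoundedAwayFromZero.add {g h : ℝ → ℂ} (hg : BoundedAwayFromZero g)
    (hh : BoundedAwayFromZero h) : BoundedAwayFromZero (fun z => g z + h z) := by
  intro δ hδ
  obtain ⟨C, hC⟩ := hg δ hδ
  obtain ⟨D, hD⟩ := hh δ hδ
  exact ⟨C + D, fun z hz => (norm_add_le _ _).trans (add_le_add (hC z hz) (hD z hz))⟩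

theorem BoundedAwayFromZero.mul {g h : ℝ → ℂ} (hg : BoundedAwayFromZero g)
    (hh : BoundedAwayFromZero h) : BoundedAwayFromZero (fun z => g z * h z) := by
  intro δ hδ
  obtain ⟨C, hC⟩ := hg δ hδ
  obtain ⟨D, hD⟩ := hh δ hδ
  refine ⟨C * D, fun z hz => ?_⟩
  rw [norm_mul]
  exact mul_le_mul (hC z hz) (hD z hz) (norm_nonneg _) ((norm_nonneg _).trans (hC z hz))

theorem boundedAwayFromZero_inv_pow (n : ℕ) : BoundedAwayFromZero (fun z => ((z : ℂ) ^ n)⁻¹) := by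
  intro δ hδ
  refine ⟨(δ ^ n)⁻¹, fun z hz => ?_⟩
  rw [norm_inv, norm_pow, Complex.norm_real, Real.norm_of_nonneg (hδ.le.trans hz)]
  gcongr

theorem hasDerivAt_inv_pow (n : ℕ) {z : ℝ} (hz : z ≠ 0) :
    HasDerivAt (fun z : ℝ => ((z : ℂ) ^ n)⁻¹) (-n * ((z : ℂ) ^ (n + 1))⁻¹) z := by
  have hzc : (z : ℂ) ≠ 0 := Complex.ofReal_ne_zero.2 hz
  have h := (((hasDerivAt_id (z : ℂ)).pow n).inv (pow_ne_zero n hzc)).comp_ofReal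
  refine HasDerivAt.congr_deriv (f := fun z : ℝ => ((z : ℂ) ^ n)⁻¹) h ?_
  rcases n with _ | n
  · simp
  · simp
    field_simp
    ring

/-- A function whose Fourier transform has the decay of a resolvent symbol convolves finite
measures on `(-∞, 0]` into functions that are `C²` on `(0, ∞)`. -/
theorem contDiffOn_integral_fourier_sub {G G1 G2 : ℝ → ℂ} (hG : Integrable G)
    (h1 : ∀ v, HasDerivAt G (G1 v) v) (h2 : ∀ v, HasDerivAt G1 (G2 v) v) (hG1 : Integrable G1)
    (hG2 : Integrable G2) (hG2' : Integrable (fun v : ℝ => v • G2 v))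
    (hG2'' : Integrable (fun v : ℝ => v • v • G2 v)) {μ : Measure ℝ} [IsFiniteMeasure μ]
    (hμ : μ (Ioi 0) = 0) : ContDiffOn ℝ 2 (fun x => ∫ y, 𝓕 G (x - y) ∂μ) (Ioi 0) := by
  set a : ℂ := -2 * Real.pi * Complex.I with ha
  have ha0 : a ≠ 0 := by simp [ha, Real.pi_ne_zero]
  set k := 𝓕 G2 with hk
  have hK1 : Integrable (fun v : ℝ => (a * v) • G2 v) := by
    refine (hG2'.const_mul a).congr (ae_of_all _ fun v => ?_)
    simp only [Complex.real_smul, smul_eq_mul]; ring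
  have hK2 : Integrable (fun v : ℝ => (a * v) • (a * v) • G2 v) := by
    refine (hG2''.const_mul (a ^ 2)).congr (ae_of_all _ fun v => ?_)
    simp only [Complex.real_smul, smul_eq_mul]; ring
  have hK1' : Integrable (fun v : ℝ => v • ((a * v) • G2 v)) := by
    refine (hG2''.const_mul a).congr (ae_of_all _ fun v => ?_)
    simp only [Complex.real_smul, smul_eq_mul]; ring
  set k1 := 𝓕 (fun v : ℝ => (a * v) • G2 v) with hk1
  set k2 := 𝓕 (fun v : ℝ => (a * v) • (a * v) • G2 v) with hk2
  have hd1 : ∀ x, HasDerivAt k (k1 x) x := fun x => Real.hasDerivAt_fourier hG2 hG2' x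
  have hd2 : ∀ x, HasDerivAt k1 (k2 x) x := fun x => Real.hasDerivAt_fourier hK1 hK1' x
  have hkc := continuous_fourier hG2
  have hk1c := continuous_fourier hK1
  have hk2c := continuous_fourier hK2
  -- Differentiating `G` twice multiplies its transform by `x ^ 2` up to a constant. Away from `0`
  -- the kernel is therefore the transform of `G2`, which has two more moments, divided by `x ^ 2`.
  have hu : ∀ x : ℝ, x ≠ 0 → 𝓕 G x = (a ^ 2)⁻¹ * (k x * ((x : ℂ) ^ 2)⁻¹) := by
    intro x hx
    have e1 : deriv G = G1 := funext fun v => (h1 v).deriv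
    have e2 : deriv G1 = G2 := funext fun v => (h2 v).deriv
    have f1 := congrFun (Real.fourier_deriv hG (fun v => (h1 v).differentiableAt)
      (by rwa [e1])) x
    have f2 := congrFun (Real.fourier_deriv hG1 (fun v => (h2 v).differentiableAt)
      (by rwa [e2])) x
    rw [e1] at f1
    rw [e2, f1] at f2
    have hxc : (x : ℂ) ≠ 0 := Complex.ofReal_ne_zero.2 hx
    rw [hk, f2, ha]
    simp only [smul_eq_mul]
    have : (Real.pi : ℂ) ≠ 0 := Complex.ofReal_ne_zero.2 Real.pi_ne_zero
    have hI := Complex.I_ne_zero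
    field_simp
  set g : ℝ → ℂ := fun z => (a ^ 2)⁻¹ * (k z * ((z : ℂ) ^ 2)⁻¹) with hg
  set g1 : ℝ → ℂ := fun z => (a ^ 2)⁻¹ *
    (k1 z * ((z : ℂ) ^ 2)⁻¹ + k z * (-(2 : ℕ) * ((z : ℂ) ^ 3)⁻¹)) with hg1
  set g2 : ℝ → ℂ := fun z => (a ^ 2)⁻¹ *
    ((k2 z * ((z : ℂ) ^ 2)⁻¹ + k1 z * (-(2 : ℕ) * ((z : ℂ) ^ 3)⁻¹)) +
      (k1 z * (-(2 : ℕ) * ((z : ℂ) ^ 3)⁻¹) +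
        k z * (-(2 : ℕ) * (-(3 : ℕ) * ((z : ℂ) ^ 4)⁻¹)))) with hg2
  have bc : ∀ c : ℂ, BoundedAwayFromZero (fun _ => c) := fun c =>
    BoundedAwayFromZero.of_bound (C := ‖c‖) fun _ => le_rfl
  have bk : BoundedAwayFromZero k := .of_bound fun z => norm_fourier_le _ z
  have bk1 : BoundedAwayFromZero k1 := .of_bound fun z => norm_fourier_le _ z
  have bk2 : BoundedAwayFromZero k2 := .of_bound fun z => norm_fourier_le _ z
  have bp := boundedAwayFromZero_inv_pow
  have bg : BoundedAwayFromZero g := (bc _).mul (bk.mul (bp 2))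
  have bg1 : BoundedAwayFromZero g1 :=
    (bc _).mul ((bk1.mul (bp 2)).add (bk.mul ((bc _).mul (bp 3))))
  have bg2 : BoundedAwayFromZero g2 := (bc _).mul
    (((bk2.mul (bp 2)).add (bk1.mul ((bc _).mul (bp 3)))).add
      ((bk1.mul ((bc _).mul (bp 3))).add (bk.mul ((bc _).mul ((bc _).mul (bp 4))))))
  have dg : ∀ z, 0 < z → HasDerivAt g (g1 z) z := fun z hz =>
    ((hd1 z).fun_mul (hasDerivAt_inv_pow 2 hz.ne')).const_mul _
  have dg1 : ∀ z, 0 < z → HasDerivAt g1 (g2 z) z := fun z hz =>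
    (((hd2 z).fun_mul (hasDerivAt_inv_pow 2 hz.ne')).fun_add
      ((hd1 z).fun_mul ((hasDerivAt_inv_pow 3 hz.ne').const_mul _))).const_mul _
  have mk := hkc.measurable
  have mk1 := hk1c.measurable
  have mk2 := hk2c.measurable
  have mp : ∀ n : ℕ, Measurable fun z : ℝ => ((z : ℂ) ^ n)⁻¹ := fun n => by fun_prop
  have hconv := contDiffOn_halfLineConv hμ (g := g) (g1 := g1) (g2 := g2)
    ((mk.mul (mp 2)).const_mul _)
    (((mk1.mul (mp 2)).add (mk.mul ((mp 3).const_mul _))).const_mul _)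
    ((((mk2.mul (mp 2)).add (mk1.mul ((mp 3).const_mul _))).add
      ((mk1.mul ((mp 3).const_mul _)).add (mk.mul (((mp 4).const_mul _).const_mul _)))).const_mul _)
    dg dg1 ?_ bg bg1 bg2
  · refine hconv.congr fun x hx => integral_congr_ae ?_
    filter_upwards [ae_nonpos_of_Ioi_eq_zero hμ] with y hy
    exact hu _ (by have : (0 : ℝ) < x := hx; linarith)
  · have cp : ∀ n : ℕ, ContinuousOn (fun z : ℝ => ((z : ℂ) ^ n)⁻¹) (Ioi 0) := fun n z hz =>
      (hasDerivAt_inv_pow n (ne_of_gt hz)).continuousAt.continuousWithinAt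
    have c0 := hkc.continuousOn (s := Ioi (0 : ℝ))
    have c1 := hk1c.continuousOn (s := Ioi (0 : ℝ))
    have c2 := hk2c.continuousOn (s := Ioi (0 : ℝ))
    exact continuousOn_const.mul
      (((c2.mul (cp 2)).add (c1.mul (continuousOn_const.mul (cp 3)))).add
        ((c1.mul (continuousOn_const.mul (cp 3))).add
          (c0.mul (continuousOn_const.mul (continuousOn_const.mul (cp 4))))))

/-! ### Differentiability of the exponent once large jumps are removed. -/

/-- The measure of the jumps of size at most one. -/
noncomputable def smallJumps (Λ : Measure ℝ) : Measure ℝ := Λ.restrict {y | |y| ≤ 1}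

theorem measurableSet_abs_le_one : MeasurableSet {y : ℝ | |y| ≤ 1} :=
  measurableSet_le (by fun_prop) measurable_const

theorem IsLevyMeasure.smallJumps {Λ : Measure ℝ} (hΛ : IsLevyMeasure Λ) :
    IsLevyMeasure (smallJumps Λ) :=
  ⟨Measure.restrict_apply_le _ _ |>.trans_eq hΛ.1 |> le_antisymm <| zero_le,
    (lintegral_mono' Measure.restrict_le_self le_rfl).trans_lt hΛ.2⟩

theorem ae_smallJumps (Λ : Measure ℝ) : ∀ᵐ y ∂(smallJumps Λ), |y| ≤ 1 :=
  ae_restrict_mem measurableSet_abs_le_one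

theorem IsLevyMeasure.integrable_sq_smallJumps {Λ : Measure ℝ} (hΛ : IsLevyMeasure Λ) :
    Integrable (fun y : ℝ => y ^ 2) (_root_.smallJumps Λ) := by
  refine hΛ.smallJumps.integrable_min.congr ?_
  filter_upwards [ae_smallJumps Λ] with y hy using min_one_sq_of_le hy

/-- Removing the large jumps changes the exponent by a bounded amount. -/
theorem IsLevyMeasure.exists_norm_sub_smallJumps_le {Λ : Measure ℝ} (hΛ : IsLevyMeasure Λ)
    (b σ : ℝ) :
    ∃ C, ∀ ξ, ‖levyExponent b σ Λ ξ - levyExponent b σ (_root_.smallJumps Λ) ξ‖ ≤ C := by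
  refine ⟨∫ y in {y | |y| ≤ 1}ᶜ, 2 * (1 + 0 ^ 2) ∂Λ, fun ξ => ?_⟩
  have hfin : Λ {y | |y| ≤ 1}ᶜ ≠ ⊤ := by
    refine ((measure_mono fun y (hy : ¬ |y| ≤ 1) => ?_).trans_lt
      (hΛ.measure_le_abs_lt_top one_pos)).ne
    exact (not_le.1 hy).le
  have hi := integrable_jumpChar hΛ ξ
  rw [levyExponent_eq, levyExponent_eq, add_sub_add_left_eq_sub, _root_.smallJumps,
    ← integral_add_compl measurableSet_abs_le_one hi, add_sub_cancel_left]
  refine norm_integral_le_of_norm_le (integrableOn_const hfin) ?_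
  filter_upwards [ae_restrict_mem measurableSet_abs_le_one.compl] with y hy
  have hy1 : 1 < |y| := not_le.1 hy
  rw [jumpChar, truncJump_of_lt hy1]
  refine (norm_sub_le _ _).trans ?_
  simp only [Complex.ofReal_zero, mul_zero, norm_zero, add_zero]
  refine (norm_sub_le _ _).trans ?_
  rw [norm_cexp_I_mul, norm_one]
  norm_num

section SmallJumpExponent

variable {Λ : Measure ℝ}

/-- First derivative of the exponent of a Lévy process without large jumps. -/
noncomputable def levyExponentDeriv (b σ : ℝ) (Λ : Measure ℝ) (ξ : ℝ) : ℂ :=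
  Complex.I * b - (σ : ℂ) ^ 2 * ξ +
    ∫ y : ℝ, Complex.I * y * (Complex.exp (Complex.I * y * ξ) - 1) ∂(smallJumps Λ)

/-- Second derivative of the exponent of a Lévy process without large jumps. -/
noncomputable def levyExponentDeriv₂ (σ : ℝ) (Λ : Measure ℝ) (ξ : ℝ) : ℂ :=
  -(σ : ℂ) ^ 2 +
    ∫ y : ℝ, Complex.I * y * (Complex.I * y * Complex.exp (Complex.I * y * ξ)) ∂(smallJumps Λ)

theorem norm_I_mul_mul_cexp_sub_one_le (y ξ : ℝ) :
    ‖Complex.I * y * (Complex.exp (Complex.I * y * ξ) - 1)‖ ≤ |ξ| * y ^ 2 := by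
  have h : ‖Complex.exp (Complex.I * y * ξ) - 1‖ ≤ |y * ξ| := by
    have := Real.norm_exp_I_mul_ofReal_sub_one_le (x := y * ξ)
    rw [Real.norm_eq_abs] at this
    convert this using 4
    push_cast
    ring
  rw [norm_mul, norm_mul, Complex.norm_I, one_mul, Complex.norm_real, Real.norm_eq_abs]
  refine (mul_le_mul_of_nonneg_left h (abs_nonneg y)).trans (le_of_eq ?_)
  rw [abs_mul, ← sq_abs y]
  ring

theorem norm_I_mul_mul_cexp (y ξ : ℝ) :
    ‖Complex.I * y * (Complex.I * y * Complex.exp (Complex.I * y * ξ))‖ = y ^ 2 := by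
  rw [norm_mul, norm_mul (Complex.I * y), norm_cexp_I_mul, norm_mul, Complex.norm_I, one_mul,
    Complex.norm_real, Real.norm_eq_abs, mul_one, abs_mul_abs_self, sq]

/-- Differentiation under the integral is dominated by multiples of `y ^ 2`. This is why large jumps
are discarded: a Lévy measure need not have a second moment at infinity. -/
theorem IsLevyMeasure.hasDerivAt_levyExponent (hΛ : IsLevyMeasure Λ) (b σ ξ : ℝ) :
    HasDerivAt (levyExponent b σ (_root_.smallJumps Λ)) (levyExponentDeriv b σ Λ ξ) ξ := by
  have hj : HasDerivAt (fun ξ : ℝ => ∫ y, jumpChar ξ y ∂(_root_.smallJumps Λ))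
      (∫ y : ℝ, Complex.I * y * (Complex.exp (Complex.I * y * ξ) - 1) ∂(_root_.smallJumps Λ)) ξ := by
    refine (hasDerivAt_integral_of_dominated_loc_of_deriv_le
      (bound := fun y => (|ξ| + 1) * y ^ 2) (F := fun ξ y => jumpChar ξ y)
      (F' := fun ξ y => Complex.I * y * (Complex.exp (Complex.I * y * ξ) - 1))
      (Metric.ball_mem_nhds ξ one_pos)
      (Eventually.of_forall fun z => (measurable_jumpChar_right z).aestronglyMeasurable)
      (integrable_jumpChar hΛ.smallJumps ξ) (by fun_prop) ?_
      (hΛ.integrable_sq_smallJumps.const_mul _) ?_).2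
    · refine ae_of_all _ fun y z hz => (norm_I_mul_mul_cexp_sub_one_le y z).trans ?_
      gcongr
      have h1 : |z - ξ| < 1 := by simpa [Real.dist_eq] using hz
      have h2 := abs_sub_abs_le_abs_sub z ξ
      linarith
    · filter_upwards [ae_smallJumps Λ] with y hy z _
      unfold jumpChar
      rw [truncJump_of_le hy]
      have h1 := ((hasDerivAt_cexp_mul (Complex.I * y) z).sub_const 1).fun_sub
        ((Complex.ofRealCLM.hasDerivAt (x := z)).const_mul (Complex.I * y))
      refine (h1.congr_deriv ?_).congr_of_eventuallyEq (Eventually.of_forall fun u => ?_)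
      · simp; ring
      · simp only [Complex.ofRealCLM_apply]
        ring_nf
  have hq : HasDerivAt (fun ξ : ℝ => Complex.I * b * ξ - (σ : ℂ) ^ 2 * (ξ : ℂ) ^ 2 / 2)
      (Complex.I * b - (σ : ℂ) ^ 2 * ξ) ξ := by
    have h0 : HasDerivAt (fun ξ : ℝ => (ξ : ℂ)) 1 ξ := Complex.ofRealCLM.hasDerivAt (x := ξ)
    refine ((h0.const_mul (Complex.I * b)).fun_sub
      (((h0.fun_pow 2).const_mul ((σ : ℂ) ^ 2)).div_const 2)).congr_deriv ?_
    simp; ring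
  exact (hq.add hj).congr_of_eventuallyEq
    (Eventually.of_forall fun z => levyExponent_eq b σ _ z)

theorem IsLevyMeasure.hasDerivAt_levyExponentDeriv (hΛ : IsLevyMeasure Λ) (b σ ξ : ℝ) :
    HasDerivAt (levyExponentDeriv b σ Λ) (levyExponentDeriv₂ σ Λ ξ) ξ := by
  have hj : HasDerivAt
      (fun ξ : ℝ => ∫ y : ℝ, Complex.I * y * (Complex.exp (Complex.I * y * ξ) - 1)
        ∂(_root_.smallJumps Λ))
      (∫ y : ℝ, Complex.I * y * (Complex.I * y * Complex.exp (Complex.I * y * ξ))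
        ∂(_root_.smallJumps Λ)) ξ := by
    refine (hasDerivAt_integral_of_dominated_loc_of_deriv_le
      (bound := fun y => y ^ 2)
      (F := fun (ξ y : ℝ) => Complex.I * y * (Complex.exp (Complex.I * y * ξ) - 1))
      (F' := fun ξ y => Complex.I * y * (Complex.I * y * Complex.exp (Complex.I * y * ξ)))
      (Metric.ball_mem_nhds ξ one_pos)
      (Eventually.of_forall fun z => by fun_prop)
      ((hΛ.integrable_sq_smallJumps.const_mul |ξ|).mono' (by fun_prop)
        (ae_of_all _ fun y => norm_I_mul_mul_cexp_sub_one_le y ξ)) (by fun_prop)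
      (ae_of_all _ fun y z _ => (norm_I_mul_mul_cexp y z).le)
      hΛ.integrable_sq_smallJumps ?_).2
    exact ae_of_all _ fun y z _ =>
      ((hasDerivAt_cexp_mul (Complex.I * y) z).sub_const 1).const_mul (Complex.I * y)
  have hq : HasDerivAt (fun ξ : ℝ => Complex.I * b - (σ : ℂ) ^ 2 * (ξ : ℂ))
      (-(σ : ℂ) ^ 2) ξ := by
    have h0 : HasDerivAt (fun ξ : ℝ => (ξ : ℂ)) 1 ξ := Complex.ofRealCLM.hasDerivAt (x := ξ)
    simpa using (h0.const_mul ((σ : ℂ) ^ 2)).const_sub (Complex.I * b)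
  exact hq.add hj

theorem IsLevyMeasure.continuous_levyExponentDeriv₂ (hΛ : IsLevyMeasure Λ) (σ : ℝ) :
    Continuous (levyExponentDeriv₂ σ Λ) := by
  refine continuous_const.add (continuous_of_dominated (bound := fun y : ℝ => y ^ 2)
    (fun z => by fun_prop) (fun z => ae_of_all _ fun y => (norm_I_mul_mul_cexp y z).le)
    hΛ.integrable_sq_smallJumps (ae_of_all _ fun y => by fun_prop))

theorem IsLevyMeasure.exists_norm_levyExponentDeriv_le (hΛ : IsLevyMeasure Λ) (b σ : ℝ) :
    ∃ C, 0 ≤ C ∧ ∀ ξ, ‖levyExponentDeriv b σ Λ ξ‖ ≤ C * (1 + |ξ|) := by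
  set D := ∫ y : ℝ, y ^ 2 ∂(_root_.smallJumps Λ) with hD
  have hD0 : 0 ≤ D := integral_nonneg fun y => sq_nonneg y
  refine ⟨|b| + σ ^ 2 + D, by positivity, fun ξ => ?_⟩
  have h1 : ‖∫ y : ℝ, Complex.I * y * (Complex.exp (Complex.I * y * ξ) - 1)
      ∂(_root_.smallJumps Λ)‖ ≤ |ξ| * D := by
    rw [hD, ← integral_const_mul]
    exact norm_integral_le_of_norm_le (hΛ.integrable_sq_smallJumps.const_mul _)
      (ae_of_all _ fun y => norm_I_mul_mul_cexp_sub_one_le y ξ)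
  have h2 : ‖Complex.I * b - (σ : ℂ) ^ 2 * ξ‖ ≤ |b| + σ ^ 2 * |ξ| := by
    refine (norm_sub_le _ _).trans (le_of_eq ?_)
    simp [Complex.norm_real]
  refine (norm_add_le _ _).trans ((add_le_add h2 h1).trans ?_)
  nlinarith [abs_nonneg ξ, abs_nonneg b, mul_nonneg (abs_nonneg b) (abs_nonneg ξ), sq_nonneg σ]

theorem IsLevyMeasure.norm_levyExponentDeriv₂_le (hΛ : IsLevyMeasure Λ) (σ ξ : ℝ) :
    ‖levyExponentDeriv₂ σ Λ ξ‖ ≤ σ ^ 2 + ∫ y : ℝ, y ^ 2 ∂(_root_.smallJumps Λ) := by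
  refine (norm_add_le _ _).trans (add_le_add (le_of_eq (by simp)) ?_)
  exact norm_integral_le_of_norm_le hΛ.integrable_sq_smallJumps
      (ae_of_all _ fun y => (norm_I_mul_mul_cexp y ξ).le)

end SmallJumpExponent

/-! ### Regularity of the density from the exit equation. -/

theorem integrable_of_norm_le_inv_one_add_sq {g : ℝ → ℂ} (hg : Continuous g) {K : ℝ}
    (h : ∀ v, ‖g v‖ ≤ K * (1 + v ^ 2)⁻¹) : Integrable g :=
  (integrable_inv_one_add_sq.const_mul K).mono' hg.aestronglyMeasurable (ae_of_all _ h)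

theorem norm_pow_mul_le_of_decay {g : ℝ → ℂ} {K : ℝ}
    (h : ∀ v, ‖g v‖ ≤ K * ((1 + v ^ 2)⁻¹ * (1 + v ^ 2)⁻¹)) {n : ℕ} (hn : n ≤ 2) (v : ℝ) :
    |v| ^ n * ‖g v‖ ≤ K * (1 + v ^ 2)⁻¹ := by
  have h1 : |v| ^ n ≤ 1 + v ^ 2 := by
    have h0 := abs_nonneg v
    have h2 := sq_abs v
    interval_cases n
    · simp; positivity
    · rw [pow_one]; nlinarith [sq_nonneg (|v| - 1)]
    · rw [h2]; linarith
  have h3 : 0 < 1 + v ^ 2 := by positivity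
  calc |v| ^ n * ‖g v‖ ≤ (1 + v ^ 2) * (K * ((1 + v ^ 2)⁻¹ * (1 + v ^ 2)⁻¹)) :=
        mul_le_mul h1 (h v) (norm_nonneg _) h3.le
    _ = K * (1 + v ^ 2)⁻¹ := by field_simp

/-- Products become convolutions; this exhibits the irregular part of the density as a kernel
integrated against the exit measure. -/
theorem fourier_mul_charFun {G : ℝ → ℂ} (hG : Integrable G) (μ : Measure ℝ) [IsFiniteMeasure μ]
    (x : ℝ) :
    𝓕 (fun v => G v * charFun μ (2 * Real.pi * v)) x = ∫ y, 𝓕 G (x - y) ∂μ := by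
  have hn : ∀ v : ℝ, ‖Complex.exp (Complex.I * ((-(2 * Real.pi * v) : ℝ) : ℂ) * x)‖ = 1 :=
    fun v => norm_cexp_I_mul _ _
  have hH : Integrable fun v : ℝ =>
      Complex.exp (Complex.I * ((-(2 * Real.pi * v) : ℝ) : ℂ) * x) * G v := by
    refine hG.norm.mono' (Continuous.aestronglyMeasurable (by fun_prop) |>.mul hG.1)
      (ae_of_all _ fun v => ?_)
    rw [norm_mul, hn, one_mul]
  have h := integral_fourierSynth hH μ
  rw [Real.fourier_real_eq_integral_exp_smul]
  refine Eq.trans ?_ (h.symm.trans ?_)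
  · congr 1
    ext v
    rw [smul_eq_mul, ← mul_assoc]
    congr 3
    push_cast
    ring
  · congr 1
    ext y
    rw [Real.fourier_real_eq_integral_exp_smul, fourierSynth]
    congr 1
    ext v
    rw [smul_eq_mul, ← mul_assoc, ← Complex.exp_add]
    congr 2
    push_cast
    ring

/-- Smoothing on `(0, ∞)` by a Fourier multiplier `1 / D` with `D` of quadratic growth. -/
theorem contDiffOn_fourier_inv_mul_charFun {D D1 D2 : ℝ → ℂ} (h1 : ∀ v, HasDerivAt D (D1 v) v)
    (h2 : ∀ v, HasDerivAt D1 (D2 v) v) (hc2 : Continuous D2) {c C : ℝ} (hc : 0 < c)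
    (hC : 0 ≤ C) (hD : ∀ v, c * (1 + v ^ 2) ≤ ‖D v‖) (hD1 : ∀ v, ‖D1 v‖ ≤ C * (1 + |v|))
    (hD2 : ∀ v, ‖D2 v‖ ≤ C) {μ : Measure ℝ} [IsFiniteMeasure μ] (hμ : μ (Ioi 0) = 0) :
    ContDiffOn ℝ 2 (𝓕 (fun v => (D v)⁻¹ * charFun μ (2 * Real.pi * v))) (Ioi 0) := by
  have hp : ∀ v : ℝ, 0 < 1 + v ^ 2 := fun v => by positivity
  have hDpos : ∀ v, 0 < ‖D v‖ := fun v => lt_of_lt_of_le (by have := hp v; positivity) (hD v)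
  have hD0 : ∀ v, D v ≠ 0 := fun v => norm_pos_iff.1 (hDpos v)
  have cD : Continuous D := continuous_iff_continuousAt.2 fun v => (h1 v).continuousAt
  have cD1 : Continuous D1 := continuous_iff_continuousAt.2 fun v => (h2 v).continuousAt
  have hinv : ∀ v, ‖(D v)⁻¹‖ ≤ c⁻¹ * (1 + v ^ 2)⁻¹ := fun v => by
    rw [norm_inv, ← mul_inv]
    exact inv_anti₀ (by have := hp v; positivity) (hD v)
  set G : ℝ → ℂ := fun v => (D v)⁻¹ with hG
  set G1 : ℝ → ℂ := fun v => -D1 v * (G v * G v) with hG1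
  set G2 : ℝ → ℂ := fun v => -D2 v * (G v * G v) + -D1 v * (G1 v * G v + G v * G1 v) with hG2
  have dG : ∀ v, HasDerivAt G (G1 v) v := fun v => by
    refine ((h1 v).inv (hD0 v)).congr_deriv ?_
    simp only [hG1, hG]
    field_simp
  have dG1 : ∀ v, HasDerivAt G1 (G2 v) v := fun v => (h2 v).fun_neg.fun_mul ((dG v).fun_mul (dG v))
  have cG : Continuous G := continuous_iff_continuousAt.2 fun v => (dG v).continuousAt
  have cG1 : Continuous G1 := continuous_iff_continuousAt.2 fun v => (dG1 v).continuousAt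
  have cG2 : Continuous G2 := by
    simp only [hG2]
    fun_prop
  have habs : ∀ v : ℝ, (1 + |v|) * (1 + v ^ 2)⁻¹ ≤ 2 := fun v => by
    rw [← div_eq_mul_inv, div_le_iff₀ (hp v)]
    nlinarith [abs_nonneg v, sq_abs v, sq_nonneg (|v| - 1)]
  have habs2 : ∀ v : ℝ, (1 + |v|) * (1 + |v|) * (1 + v ^ 2)⁻¹ ≤ 2 := fun v => by
    rw [← div_eq_mul_inv, div_le_iff₀ (hp v)]
    nlinarith [abs_nonneg v, sq_abs v, sq_nonneg (|v| - 1)]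
  have bG1 : ∀ v, ‖G1 v‖ ≤ C * c⁻¹ ^ 2 * ((1 + |v|) * ((1 + v ^ 2)⁻¹ * (1 + v ^ 2)⁻¹)) := fun v => by
    simp only [hG1]
    rw [norm_mul, norm_neg, norm_mul]
    calc ‖D1 v‖ * (‖G v‖ * ‖G v‖)
        ≤ C * (1 + |v|) * ((c⁻¹ * (1 + v ^ 2)⁻¹) * (c⁻¹ * (1 + v ^ 2)⁻¹)) := by
          gcongr <;> first | exact hD1 v | exact hinv v
      _ = _ := by ring
  have bG1' : ∀ v, ‖G1 v‖ ≤ C * c⁻¹ ^ 2 * 2 * (1 + v ^ 2)⁻¹ := fun v => by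
    refine (bG1 v).trans ?_
    rw [mul_assoc (C * c⁻¹ ^ 2), ← mul_assoc (1 + |v|)]
    have := (inv_pos.2 (hp v)).le
    gcongr
    exact habs v
  -- The second derivative of `1 / D` consists of `D'' / D ^ 2` and `D' ^ 2 / D ^ 3`, both of order
  -- `v ^ (-4)`; this leaves the two moments needed for two derivatives of its transform.
  have bG2 : ∀ v, ‖G2 v‖ ≤ (C * c⁻¹ ^ 2 + 4 * (C ^ 2 * c⁻¹ ^ 3)) *
      ((1 + v ^ 2)⁻¹ * (1 + v ^ 2)⁻¹) := fun v => by
    have i0 := (inv_pos.2 (hp v)).le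
    have e1 : ‖-D2 v * (G v * G v)‖ ≤ C * c⁻¹ ^ 2 * ((1 + v ^ 2)⁻¹ * (1 + v ^ 2)⁻¹) := by
      rw [norm_mul, norm_neg, norm_mul]
      calc ‖D2 v‖ * (‖G v‖ * ‖G v‖)
          ≤ C * ((c⁻¹ * (1 + v ^ 2)⁻¹) * (c⁻¹ * (1 + v ^ 2)⁻¹)) := by
            gcongr <;> first | exact hD2 v | exact hinv v
        _ = _ := by ring
    have e2 : ‖-D1 v * (G1 v * G v + G v * G1 v)‖ ≤
        4 * (C ^ 2 * c⁻¹ ^ 3) * ((1 + v ^ 2)⁻¹ * (1 + v ^ 2)⁻¹) := by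
      rw [mul_comm (G v) (G1 v), ← two_mul, norm_mul, norm_neg, norm_mul, norm_mul]
      simp only [Complex.norm_ofNat]
      calc ‖D1 v‖ * (2 * (‖G1 v‖ * ‖G v‖))
          ≤ C * (1 + |v|) * (2 * (C * c⁻¹ ^ 2 * ((1 + |v|) * ((1 + v ^ 2)⁻¹ * (1 + v ^ 2)⁻¹)) *
              (c⁻¹ * (1 + v ^ 2)⁻¹))) := by
            gcongr <;> first | exact hD1 v | exact bG1 v | exact hinv v
        _ = 2 * (C ^ 2 * c⁻¹ ^ 3) * ((1 + v ^ 2)⁻¹ * (1 + v ^ 2)⁻¹) *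
              ((1 + |v|) * (1 + |v|) * (1 + v ^ 2)⁻¹) := by ring
        _ ≤ 2 * (C ^ 2 * c⁻¹ ^ 3) * ((1 + v ^ 2)⁻¹ * (1 + v ^ 2)⁻¹) * 2 := by
            gcongr
            exact habs2 v
        _ = _ := by ring
    refine (norm_add_le _ _).trans ((add_le_add e1 e2).trans (le_of_eq ?_))
    ring
  have iG : Integrable G := integrable_of_norm_le_inv_one_add_sq cG hinv
  have iG1 : Integrable G1 := integrable_of_norm_le_inv_one_add_sq cG1 bG1'
  have iG2 : ∀ n : ℕ, n ≤ 2 → Integrable (fun v : ℝ => v ^ n • G2 v) := fun n hn => by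
    refine integrable_of_norm_le_inv_one_add_sq (by fun_prop)
      (fun v => ?_) (K := C * c⁻¹ ^ 2 + 4 * (C ^ 2 * c⁻¹ ^ 3))
    rw [norm_smul, norm_pow, Real.norm_eq_abs]
    exact norm_pow_mul_le_of_decay bG2 hn v
  refine (contDiffOn_integral_fourier_sub iG dG dG1 iG1 (by simpa using iG2 0 (by norm_num))
    (by simpa using iG2 1 (by norm_num)) ?_ hμ).congr fun x _ => fourier_mul_charFun iG μ x
  simpa [sq, mul_smul] using iG2 2 le_rfl

/-- Regularity of a probability measure `ν` with `L* ν + r ν = μ` carried by `(-∞, 0]`. -/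
theorem exists_regular_density {ν μ : Measure ℝ} [IsProbabilityMeasure ν] [IsFiniteMeasure μ]
    {b σ r : ℝ} {Λ : Measure ℝ} (hΛ : IsLevyMeasure Λ) (hσ : 0 < σ) (hμ : μ (Ioi 0) = 0)
    (hchar : ∀ ξ, charFun μ ξ = charFun ν ξ * (levyExponent b σ Λ ξ + r)) :
    ∃ w : ℝ → ℝ, Continuous w ∧ (∀ x, 0 ≤ w x) ∧ Integrable w ∧
      ν = volume.withDensity (fun x => ENNReal.ofReal (w x)) ∧ (∃ C, ∀ x, |w x| ≤ C) ∧
      ContDiffOn ℝ 2 w (Ioi 0) := by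
  set Ψ0 := levyExponent b σ (smallJumps Λ) with hΨ0
  obtain ⟨B, hB⟩ := hΛ.exists_norm_sub_smallJumps_le b σ
  -- Chosen so that `Ψ + r = s - (1 - Ψ0)`, with `s` bounded since removing the large jumps changes
  -- `Ψ` by a bounded amount. The equation becomes `(1 - Ψ0) ν̂ = s ν̂ - μ̂`, whose left factor is
  -- `C²` and of quadratic size.
  set s : ℝ → ℂ := fun ξ => levyExponent b σ Λ ξ - Ψ0 ξ + 1 + r with hs
  have hsb : ∀ ξ, ‖s ξ‖ ≤ B + 1 + |r| := fun ξ => by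
    refine (norm_add_le _ _).trans (add_le_add ((norm_add_le _ _).trans
      (add_le_add (hB ξ) (by simp))) (by simp))
  set S := B + 1 + |r| with hS
  have hS0 : 0 ≤ S := (norm_nonneg _).trans (hsb 0)
  set c : ℝ := min 1 (σ ^ 2 / 2) with hc
  have hc0 : 0 < c := by positivity
  have hre : ∀ ξ, c * (1 + ξ ^ 2) ≤ ‖1 - Ψ0 ξ‖ := fun ξ => by
    have h1 := re_levyExponent_le (b := b) hΛ.smallJumps σ ξ
    have h2 : 1 + σ ^ 2 * ξ ^ 2 / 2 ≤ (1 - Ψ0 ξ).re := by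
      rw [Complex.sub_re, Complex.one_re]
      linarith
    refine le_trans ?_ (h2.trans (Complex.re_le_norm _))
    have h3 : c ≤ 1 := min_le_left _ _
    have h4 : c ≤ σ ^ 2 / 2 := min_le_right _ _
    nlinarith [sq_nonneg ξ]
  have hne : ∀ ξ, 1 - Ψ0 ξ ≠ 0 := fun ξ => norm_pos_iff.1
    (lt_of_lt_of_le (by positivity) (hre ξ))
  have hinv : ∀ ξ, ‖(1 - Ψ0 ξ)⁻¹‖ ≤ c⁻¹ * (1 + ξ ^ 2)⁻¹ := fun ξ => by
    rw [norm_inv, ← mul_inv]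
    exact inv_anti₀ (by positivity) (hre ξ)
  have hid : ∀ ξ, charFun ν ξ = (1 - Ψ0 ξ)⁻¹ * (s ξ * charFun ν ξ) -
      (1 - Ψ0 ξ)⁻¹ * charFun μ ξ := fun ξ => by
    rw [hchar]
    have := hne ξ
    simp only [hs]
    field_simp
    ring
  have hcν : Continuous (charFun ν) := continuous_charFun
  have hcμ : Continuous (charFun μ) := continuous_charFun
  set K := c⁻¹ * (S + μ.real univ) with hK
  -- First gain: the right-hand side is bounded, so `ν̂` decays like `ξ ^ (-2)`.
  have hνb : ∀ ξ, ‖charFun ν ξ‖ ≤ K * (1 + ξ ^ 2)⁻¹ := fun ξ => by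
    rw [hid, ← mul_sub, norm_mul]
    have h1 : ‖s ξ * charFun ν ξ - charFun μ ξ‖ ≤ S + μ.real univ := by
      refine (norm_sub_le _ _).trans (add_le_add ?_ (norm_charFun_le ξ))
      rw [norm_mul]
      exact (mul_le_mul (hsb ξ) (norm_charFun_le_one ξ) (norm_nonneg _) hS0).trans_eq (mul_one _)
    refine (mul_le_mul (hinv ξ) h1 (norm_nonneg _) (by positivity)).trans_eq ?_
    rw [hK]; ring
  have hK0 : 0 ≤ K := by positivity
  have hνi : Integrable (charFun ν) := integrable_of_norm_le_inv_one_add_sq hcν hνb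
  obtain ⟨w, hwc, hw0, hwi, hwF, hwd⟩ := exists_density_of_integrable_charFun hνi
  refine ⟨w, hwc, hw0, hwi, hwd, ⟨∫ v : ℝ, ‖charFun ν (2 * Real.pi * v)‖, fun x => ?_⟩, ?_⟩
  · rw [← Real.norm_eq_abs, ← Complex.norm_real, hwF]
    exact norm_fourier_le _ x
  have hd0 : ∀ ξ, HasDerivAt Ψ0 (levyExponentDeriv b σ Λ ξ) ξ := hΛ.hasDerivAt_levyExponent b σ
  have hcΨ : Continuous Ψ0 := continuous_iff_continuousAt.2 fun ξ => (hd0 ξ).continuousAt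
  have hpi : (1 : ℝ) ≤ 2 * Real.pi := by linarith [Real.pi_gt_three]
  have hsq : ∀ v : ℝ, 1 + v ^ 2 ≤ 1 + (2 * Real.pi * v) ^ 2 := fun v => by
    rw [mul_pow]
    nlinarith [sq_nonneg v, one_le_pow₀ hpi (n := 2)]
  have hsqi : ∀ v : ℝ, (1 + (2 * Real.pi * v) ^ 2)⁻¹ ≤ (1 + v ^ 2)⁻¹ := fun v =>
    inv_anti₀ (by positivity) (hsq v)
  set D : ℝ → ℂ := fun v => 1 - Ψ0 (2 * Real.pi * v) with hD
  set V : ℝ → ℂ := fun v => charFun ν (2 * Real.pi * v) with hV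
  set M : ℝ → ℂ := fun v => charFun μ (2 * Real.pi * v) with hM
  have hVc : Continuous V := hcν.comp (by fun_prop)
  have hMc : Continuous M := hcμ.comp (by fun_prop)
  have hDc : Continuous D := continuous_const.sub (hcΨ.comp (by fun_prop))
  have hDinvc : Continuous fun v => (D v)⁻¹ := hDc.inv₀ fun v => hne _
  have hDM : Integrable fun v => (D v)⁻¹ * M v := by
    refine integrable_of_norm_le_inv_one_add_sq (hDinvc.mul hMc) (K := c⁻¹ * μ.real univ)
      fun v => ?_
    rw [norm_mul]
    refine (mul_le_mul ((hinv _).trans (mul_le_mul_of_nonneg_left (hsqi v) (by positivity)))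
      (norm_charFun_le _) (norm_nonneg _) (by positivity)).trans_eq ?_
    ring
  -- Second gain: `F = s ν̂ / D` decays like `v ^ (-4)`, so its transform is `C²` on the whole line.
  -- The rest, `μ̂ / D`, is smooth only on `(0, ∞)`.
  set F : ℝ → ℂ := fun v => V v + (D v)⁻¹ * M v with hF
  have hVi : Integrable V := integrable_charFun_two_pi hνi
  have hFb : ∀ v, ‖F v‖ ≤ c⁻¹ * S * K * ((1 + v ^ 2)⁻¹ * (1 + v ^ 2)⁻¹) := fun v => by
    have h1 : F v = (D v)⁻¹ * (s (2 * Real.pi * v) * charFun ν (2 * Real.pi * v)) := by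
      have := hid (2 * Real.pi * v)
      simp only [hF, hV, hM, hD]
      exact eq_sub_iff_add_eq.1 this
    rw [h1, norm_mul, norm_mul]
    calc _ ≤ (c⁻¹ * (1 + v ^ 2)⁻¹) * (S * (K * (1 + v ^ 2)⁻¹)) := by
          refine mul_le_mul ((hinv _).trans (mul_le_mul_of_nonneg_left (hsqi v) (by positivity)))
            (mul_le_mul (hsb _) ((hνb _).trans (mul_le_mul_of_nonneg_left (hsqi v) hK0))
              (norm_nonneg _) hS0) (by positivity) (by positivity)
      _ = _ := by ring
  have hFc : Continuous F := hVc.add (hDinvc.mul hMc)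
  have hFsmooth : ContDiff ℝ 2 (𝓕 F) := by
    have := Real.contDiff_fourier (f := F) (N := 2) (fun n hn => ?_)
    · exact this
    · have hn2 : n ≤ 2 := by exact_mod_cast hn
      have : Integrable (fun v : ℝ => v ^ n • F v) := by
        refine integrable_of_norm_le_inv_one_add_sq (by fun_prop) (K := c⁻¹ * S * K) fun v => ?_
        rw [norm_smul, norm_pow, Real.norm_eq_abs]
        exact norm_pow_mul_le_of_decay hFb hn2 v
      refine this.norm.congr (ae_of_all _ fun v => ?_)
      simp only [norm_smul, norm_pow]
  obtain ⟨C1, hC1, hb1⟩ := hΛ.exists_norm_levyExponentDeriv_le b σ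
  set C2 := σ ^ 2 + ∫ y : ℝ, y ^ 2 ∂(smallJumps Λ) with hC2
  have hC20 : 0 ≤ C2 := add_nonneg (sq_nonneg _) (integral_nonneg fun y => sq_nonneg y)
  have hlin : ∀ v : ℝ, HasDerivAt (fun v : ℝ => 2 * Real.pi * v) (2 * Real.pi) v := fun v => by
    simpa using (hasDerivAt_id v).const_mul (2 * Real.pi)
  have hMs : ContDiffOn ℝ 2 (𝓕 (fun v => (D v)⁻¹ * M v)) (Ioi 0) := by
    refine contDiffOn_fourier_inv_mul_charFun (D := D)
      (D1 := fun v => -((2 * Real.pi) • levyExponentDeriv b σ Λ (2 * Real.pi * v)))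
      (D2 := fun v => -((2 * Real.pi) • ((2 * Real.pi) •
        levyExponentDeriv₂ σ Λ (2 * Real.pi * v))))
      -- A sum of the constants for the first and second derivatives, so that a single `C` serves
      -- both; the powers of `2 π` come from the chain rule.
      (C := (2 * Real.pi) * (C1 * (2 * Real.pi)) + (2 * Real.pi) * ((2 * Real.pi) * C2))
      (fun v => ?_) (fun v => ?_) ?_ hc0 (by positivity) (fun v => ?_) (fun v => ?_)
      (fun v => ?_) hμ
    · exact ((hd0 (2 * Real.pi * v)).scomp v (hlin v)).const_sub 1
    · exact (((hΛ.hasDerivAt_levyExponentDeriv b σ (2 * Real.pi * v)).scomp v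
        (hlin v)).const_smul (2 * Real.pi)).fun_neg
    · have := (hΛ.continuous_levyExponentDeriv₂ σ).comp
        (show Continuous fun v : ℝ => 2 * Real.pi * v by fun_prop)
      exact ((this.const_smul (2 * Real.pi)).const_smul (2 * Real.pi)).neg
    · exact (mul_le_mul_of_nonneg_left (hsq v) hc0.le).trans (hre _)
    · rw [norm_neg, norm_smul, Real.norm_of_nonneg (by positivity)]
      have h1 : ‖levyExponentDeriv b σ Λ (2 * Real.pi * v)‖ ≤
          C1 * (2 * Real.pi) * (1 + |v|) := by
        refine (hb1 _).trans ?_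
        rw [abs_mul, abs_of_nonneg (by positivity : 0 ≤ 2 * Real.pi),
          mul_assoc C1]
        refine mul_le_mul_of_nonneg_left ?_ hC1
        linarith
      have h2 := mul_le_mul_of_nonneg_left h1 (by positivity : 0 ≤ 2 * Real.pi)
      refine h2.trans ?_
      rw [← mul_assoc]
      refine mul_le_mul_of_nonneg_right ?_ (by positivity)
      exact le_add_of_nonneg_right (by positivity)
    · rw [norm_neg, norm_smul, norm_smul, Real.norm_of_nonneg (by positivity)]
      refine le_trans ?_ (le_add_of_nonneg_left (by positivity))
      gcongr
      exact hΛ.norm_levyExponentDeriv₂_le σ _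
  have hwV : ∀ x, (w x : ℂ) = 𝓕 F x - 𝓕 (fun v => (D v)⁻¹ * M v) x := fun x => by
    rw [hwF]
    change 𝓕 V x = _
    have h1 : F = V + fun v => (D v)⁻¹ * M v := rfl
    have h2 : 𝓕 (V + fun v => (D v)⁻¹ * M v) = 𝓕 V + 𝓕 (fun v => (D v)⁻¹ * M v) :=
      VectorFourier.fourierIntegral_add Real.continuous_fourierChar continuous_inner hVi hDM
    rw [h1, h2, Pi.add_apply, add_sub_cancel_right]
  have hw2 : ContDiffOn ℝ 2 (fun x => (w x : ℂ)) (Ioi 0) :=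
    (hFsmooth.contDiffOn.sub hMs).congr fun x _ => hwV x
  exact (Complex.reCLM.contDiff.comp_contDiffOn hw2).congr fun x _ => by simp

/-! ### Traveling waves reduced to their profiles. -/

section TravelingWave

variable {b σ r c : ℝ} {Λ : Measure ℝ} {w : ℝ → ℝ}

theorem adjointJumpIntegrand_comp_sub (w : ℝ → ℝ) (a x y : ℝ) :
    adjointJumpIntegrand (fun x => w (x - a)) x y = adjointJumpIntegrand w (x - a) y := by
  unfold adjointJumpIntegrand
  rw [deriv_comp_sub_const, sub_right_comm]

theorem adjointGenerator_comp_sub (w : ℝ → ℝ) (a x : ℝ) :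
    adjointGenerator b σ Λ (fun x => w (x - a)) x = adjointGenerator b σ Λ w (x - a) := by
  unfold adjointGenerator
  have h1 : deriv (fun x => w (x - a)) = fun x => deriv w (x - a) :=
    funext fun x => deriv_comp_sub_const w a x
  rw [h1, deriv_comp_sub_const]
  simp_rw [adjointJumpIntegrand_comp_sub]

/-- Passing to the moving frame is a change of drift: the term `c w'` makes the profile equation the
stationary equation for the triplet of `Z^c`. -/
theorem adjointGenerator_sub_drift (w : ℝ → ℝ) (x : ℝ) :
    adjointGenerator (b - c) σ Λ w x = adjointGenerator b σ Λ w x + c * deriv w x := by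
  unfold adjointGenerator
  ring

theorem setIntegral_Ioi_comp_sub (w : ℝ → ℝ) (a : ℝ) :
    ∫ y in Ioi a, w (y - a) = ∫ y in Ioi 0, w y := by
  rw [← integral_indicator measurableSet_Ioi, ← integral_indicator measurableSet_Ioi,
    ← integral_sub_right_eq_self ((Ioi 0).indicator w) a]
  congr 1
  ext y
  by_cases h : a < y
  · rw [indicator_of_mem (show y ∈ Ioi a from h), indicator_of_mem (show y - a ∈ Ioi 0 by simpa)]
  · rw [indicator_of_notMem (show y ∉ Ioi a from h),
      indicator_of_notMem (show y - a ∉ Ioi 0 by simpa using h)]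

/-- Profiles of traveling waves are the solutions of the profile equation which vanish
continuously on `(-∞, 0]` and have unit mass. -/
theorem isTravelingWave_iff : IsTravelingWave b σ Λ r c w ↔
    Continuous w ∧ SolvesProfileEquation b σ Λ r c w ∧ (∀ x, x ≤ 0 → w x = 0) ∧
      ∫ x in Ioi 0, w x = 1 := by
  constructor
  · intro h
    -- Regularity is required only at positive times, so it is read off at time `1` and translated
    -- back; the boundary values and the mass come from time `0`.
    have hw : Continuous w := by
      have := (h.continuous 1 one_pos).comp (continuous_add_const (c * 1))
      simpa [Function.comp_def] using this
    have hC : ContDiffOn ℝ 2 w (Ioi 0) := by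
      have := (h.contDiffOn 1 one_pos).comp (g := fun x => w (x - c * 1))
        (f := fun x => x + c * 1) (s := Ioi 0) (by fun_prop) (fun x hx => by simpa using hx)
      simpa [Function.comp_def] using this
    have hi : ∀ x, 0 < x → Integrable (adjointJumpIntegrand w x) Λ := fun x hx => by
      have := h.integrable 1 one_pos (x + c * 1) (by simpa)
      refine this.congr (ae_of_all _ fun y => ?_)
      simp only [adjointJumpIntegrand_comp_sub, add_sub_cancel_right]
    have hv : ∀ x, x ≤ 0 → w x = 0 := fun x hx => by
      simpa using h.vanish 0 le_rfl x (by simpa)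
    refine ⟨hw, ⟨hC, fun x hx => ⟨hi x hx, ?_⟩⟩, hv, ?_⟩
    · have h1 := h.equation 1 one_pos (x + c * 1) (by simpa)
      simp only [adjointGenerator_comp_sub, add_sub_cancel_right] at h1
      have h2 : HasDerivAt w (deriv w x) x := (hC.hasDerivAt_deriv_two isOpen_Ioi).1 x hx
      have h3 : HasDerivAt (fun s => w (x + c * 1 - c * s)) (deriv w x * -c) 1 := by
        have hlin : HasDerivAt (fun s : ℝ => x + c * 1 - c * s) (-c) 1 := by
          simpa using ((hasDerivAt_id (1 : ℝ)).const_mul c).const_sub (x + c * 1)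
        have h2' : HasDerivAt w (deriv w x) (x + c * 1 - c * 1) := by simpa using h2
        exact h2'.comp 1 hlin
      have := h1.unique h3
      linarith
    · have := h.mass 0 le_rfl
      simpa using this
  · rintro ⟨hw, ⟨hC, hE⟩, hv, hm⟩
    refine ⟨fun t _ => hw.comp (continuous_sub_right _), fun t _ => ?_, fun t _ x hx => ?_,
      fun t _ x hx => ?_, fun t _ => ?_, fun t _ x hx => hv _ (by simpa using hx), fun x _ => by simp⟩
    · exact hC.comp (f := fun x => x - c * t) (by fun_prop) fun x hx => by simpa using hx
    · refine (hE (x - c * t) (by simpa using hx)).1.congr (ae_of_all _ fun y => ?_)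
      simp only [adjointJumpIntegrand_comp_sub]
    · have hx' : 0 < x - c * t := by simpa using hx
      rw [adjointGenerator_comp_sub]
      have h2 : HasDerivAt w (deriv w (x - c * t)) (x - c * t) :=
        (hC.hasDerivAt_deriv_two isOpen_Ioi).1 _ hx'
      have hlin : HasDerivAt (fun s : ℝ => x - c * s) (-c) t := by
        simpa using ((hasDerivAt_id t).const_mul c).const_sub x
      refine (h2.comp t hlin).congr_deriv ?_
      have := (hE _ hx').2
      linarith
    · rw [setIntegral_Ioi_comp_sub, hm]

end TravelingWave

/-! ### From the Fourier form of the exit equation to the pointwise equation. -/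

section ProfileEquation

variable {b σ r : ℝ} {Λ ν μ : Measure ℝ} {w : ℝ → ℝ}

/-- Weak form of `L* ν + r ν = μ`. -/
theorem integral_levyGenerator_add (hΛ : IsLevyMeasure Λ) [IsFiniteMeasure ν] [IsFiniteMeasure μ]
    (hchar : ∀ ξ, charFun μ ξ = charFun ν ξ * (levyExponent b σ Λ ξ + r)) {f : ℝ → ℝ}
    (hf : ContDiff ℝ ((⊤ : ℕ∞) : WithTop ℕ∞) f) (hfc : HasCompactSupport f) :
    ∫ x, levyGenerator b σ Λ f x ∂ν + r * ∫ x, f x ∂ν = ∫ x, f x ∂μ := by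
  obtain ⟨F, hFc, hF, hfF⟩ := exists_fourierSynth_eq hf hfc
  have hFm := hFc.aestronglyMeasurable (μ := volume)
  have i0 : Integrable F := by
    have := integrable_of_one_add_sq hFm hF (k := fun _ => 1) (C := 1) (by fun_prop)
      (fun v => by rw [norm_one]; nlinarith [sq_nonneg (2 * Real.pi * v)])
    simpa using this
  obtain ⟨C, hC0, hC⟩ := exists_norm_levyExponent_le hΛ b σ
  have hΨm : Measurable fun v : ℝ => levyExponent b σ Λ (2 * Real.pi * v) :=
    (measurable_levyExponent hΛ b σ).comp (by fun_prop)
  have i1 : Integrable fun v : ℝ => levyExponent b σ Λ (2 * Real.pi * v) * F v :=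
    integrable_of_one_add_sq hFm hF hΨm.aestronglyMeasurable fun v => hC _
  have e1 : ((∫ x, levyGenerator b σ Λ f x ∂ν : ℝ) : ℂ) = ∫ v : ℝ,
      levyExponent b σ Λ (2 * Real.pi * v) * F v * charFun ν (2 * Real.pi * v) := by
    rw [← integral_complex_ofReal, ← integral_fourierSynth i1]
    exact integral_congr_ae (ae_of_all _ fun x => levyGenerator_eq_fourierSynth hΛ b σ hFc hF hfF x)
  have e2 : ∀ (ρ : Measure ℝ) [IsFiniteMeasure ρ], ((∫ x, f x ∂ρ : ℝ) : ℂ) = ∫ v : ℝ,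
      F v * charFun ρ (2 * Real.pi * v) := fun ρ _ => by
    rw [← integral_complex_ofReal, ← integral_fourierSynth i0]
    exact integral_congr_ae (ae_of_all _ hfF)
  have hcν : Continuous fun v : ℝ => charFun ν (2 * Real.pi * v) :=
    continuous_charFun.comp (by fun_prop)
  have hb : ∀ {H : ℝ → ℂ}, Integrable H →
      Integrable fun v => H v * charFun ν (2 * Real.pi * v) := fun {H} hH =>
    hH.mul_bdd (c := ν.real univ) hcν.aestronglyMeasurable (ae_of_all _ fun v => norm_charFun_le _)
  have : ((∫ x, levyGenerator b σ Λ f x ∂ν + r * ∫ x, f x ∂ν : ℝ) : ℂ) =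
      ((∫ x, f x ∂μ : ℝ) : ℂ) := by
    rw [Complex.ofReal_add, Complex.ofReal_mul, e1, e2 ν, e2 μ, ← integral_const_mul,
      ← integral_add (hb i1) ((hb i0).const_mul _)]
    congr 1
    ext v
    rw [hchar]
    ring
  exact_mod_cast this

theorem integral_density (hw : Measurable w) (hw0 : ∀ x, 0 ≤ w x)
    (hwd : ν = volume.withDensity (fun x => ENNReal.ofReal (w x))) (g : ℝ → ℝ) :
    ∫ x, g x ∂ν = ∫ x, w x * g x := by
  rw [hwd, integral_withDensity_eq_integral_toReal_smul (by fun_prop) (by simp)]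
  simp_rw [ENNReal.toReal_ofReal (hw0 _), smul_eq_mul]

/-- Taylor's bound handles `|y| < δ`. For `|y| ≥ δ` the integrand is bounded and `min 1 (y ^ 2) ≥ δ
^ 2`, which explains the factor `(δ ^ 2)⁻¹`. The bound is uniform on `K`, as continuity of the jump
term requires. -/
theorem exists_adjointJumpIntegrand_le_of_bounded {C : ℝ} (hb : ∀ x, |w x| ≤ C) {U K : Set ℝ}
    (hU : IsOpen U) (hw : ContDiffOn ℝ 2 w U) (hK : IsCompact K) (hKU : K ⊆ U) :
    ∃ M, ∀ x ∈ K, ∀ y, |adjointJumpIntegrand w x y| ≤ M * min 1 (y ^ 2) := by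
  obtain ⟨δ, M, hδ, hδ1, hM0, hM⟩ := exists_adjointJumpIntegrand_le hU hw hK hKU
  obtain ⟨-, -, hc1, -⟩ := hw.hasDerivAt_deriv_two hU
  obtain ⟨D, hD⟩ := hK.exists_bound_of_continuousOn (hc1.mono hKU)
  have hC0 : 0 ≤ C := (abs_nonneg _).trans (hb 0)
  refine ⟨M + (2 * C + |D|) * (δ ^ 2)⁻¹, fun x hx y => ?_⟩
  have hmin : 0 ≤ min 1 (y ^ 2) := by positivity
  rcases lt_or_ge |y| δ with hy | hy
  · refine (hM x hx y hy).trans (mul_le_mul_of_nonneg_right ?_ hmin)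
    exact le_add_of_nonneg_right (by positivity)
  · have ht : |truncJump y| ≤ 1 := by
      unfold truncJump
      split_ifs with h
      · exact h
      · simp
    have h1 : |adjointJumpIntegrand w x y| ≤ 2 * C + |D| := by
      unfold adjointJumpIntegrand
      have h2 : |truncJump y * deriv w x| ≤ 1 * |D| := by
        rw [abs_mul]
        exact mul_le_mul ht ((hD x hx).trans (le_abs_self D)) (abs_nonneg _) zero_le_one
      have h3 := abs_add_le (w (x - y) - w x) (truncJump y * deriv w x)
      have h4 := abs_sub (w (x - y)) (w x)
      linarith [hb (x - y), hb x]
    have h2 : δ ^ 2 ≤ min 1 (y ^ 2) := by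
      refine le_min (pow_le_one₀ hδ.le hδ1) ?_
      rw [← sq_abs y]
      gcongr
    refine h1.trans ?_
    rw [add_mul, mul_assoc]
    refine le_add_of_nonneg_of_le (by positivity) ?_
    refine le_mul_of_one_le_right (by positivity) ?_
    rw [← div_eq_inv_mul]
    exact (one_le_div (by positivity)).2 h2

theorem continuousOn_adjointGenerator (hΛ : IsLevyMeasure Λ) (hwc : Continuous w) {C : ℝ}
    (hb : ∀ x, |w x| ≤ C) {U : Set ℝ} (hU : IsOpen U) (hw : ContDiffOn ℝ 2 w U) :
    ContinuousOn (adjointGenerator b σ Λ w) U := by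
  obtain ⟨-, -, hc1, hc2⟩ := hw.hasDerivAt_deriv_two hU
  refine ((hc2.const_mul _).sub (hc1.const_mul _)).add fun x hx => ?_
  obtain ⟨K, hK, hxK, hKU⟩ := exists_compact_subset hU hx
  obtain ⟨M, hM⟩ := exists_adjointJumpIntegrand_le_of_bounded hb hU hw hK hKU
  refine (continuousAt_of_dominated (bound := fun y => M * min 1 (y ^ 2)) ?_ ?_
    (hΛ.integrable_min.const_mul M) (ae_of_all _ fun y => ?_)).continuousWithinAt
  · exact Eventually.of_forall fun z => ((measurable_adjointJumpIntegrand hwc.measurable).comp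
      measurable_prodMk_left).aestronglyMeasurable
  · filter_upwards [mem_interior_iff_mem_nhds.1 hxK] with z hz using ae_of_all _ fun y => hM z hz y
  · unfold adjointJumpIntegrand
    have := hc1.continuousAt (hU.mem_nhds hx)
    have h1 : ContinuousAt (fun z => w (z - y) - w z) x := by fun_prop
    exact h1.add (this.const_mul _)

theorem integrable_adjointJumpIntegrand (hΛ : IsLevyMeasure Λ) (hwc : Continuous w) {C : ℝ}
    (hb : ∀ x, |w x| ≤ C) {U : Set ℝ} (hU : IsOpen U) (hw : ContDiffOn ℝ 2 w U) {x : ℝ}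
    (hx : x ∈ U) : Integrable (adjointJumpIntegrand w x) Λ := by
  obtain ⟨M, hM⟩ := exists_adjointJumpIntegrand_le_of_bounded hb hU hw isCompact_singleton
    (singleton_subset_iff.2 hx)
  exact (hΛ.integrable_min.const_mul M).mono' ((measurable_adjointJumpIntegrand
    hwc.measurable).comp measurable_prodMk_left).aestronglyMeasurable
    (ae_of_all _ fun y => hM x rfl y)

/-- A density that is `C²` on `(0, ∞)` solves the profile equation there. -/
theorem adjointGenerator_add_eq_zero [IsFiniteMeasure ν] [IsFiniteMeasure μ]
    (hΛ : IsLevyMeasure Λ) (hμ : μ (Ioi 0) = 0)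
    (hchar : ∀ ξ, charFun μ ξ = charFun ν ξ * (levyExponent b σ Λ ξ + r))
    (hwc : Continuous w) (hw0 : ∀ x, 0 ≤ w x) (hwi : Integrable w)
    (hwd : ν = volume.withDensity (fun x => ENNReal.ofReal (w x))) {C : ℝ}
    (hb : ∀ x, |w x| ≤ C) (hw : ContDiffOn ℝ 2 w (Ioi 0)) {x : ℝ} (hx : 0 < x) :
    adjointGenerator b σ Λ w x + r * w x = 0 := by
  have hcont : ContinuousOn (fun x => adjointGenerator b σ Λ w x + r * w x) (Ioi 0) :=
    (continuousOn_adjointGenerator hΛ hwc hb isOpen_Ioi hw).add (by fun_prop)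
  -- Testing against functions supported in `(0, ∞)` does not see `μ`, so the left-hand side
  -- vanishes almost everywhere there, hence everywhere by continuity.
  have hae := isOpen_Ioi.ae_eq_zero_of_integral_contDiff_smul_eq_zero (μ := volume)
    (hcont.locallyIntegrableOn measurableSet_Ioi) (fun f hf hfc hfU => ?_)
  · have h1 : (fun x => adjointGenerator b σ Λ w x + r * w x) =ᵐ[volume.restrict (Ioi 0)]
        fun _ => 0 := (ae_restrict_iff' measurableSet_Ioi).2 hae
    exact Measure.eqOn_open_of_ae_eq h1 isOpen_Ioi hcont continuousOn_const hx
  · have h2 : ContDiff ℝ 2 f := contDiff_infty.1 hf 2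
    obtain ⟨i1, e1⟩ := integral_mul_levyGenerator hΛ b σ isOpen_Ioi hwi hwc hw h2 hfc hfU
    have e2 := integral_levyGenerator_add hΛ hchar hf hfc
    rw [integral_density hwc.measurable hw0 hwd, integral_density hwc.measurable hw0 hwd, e1] at e2
    have e3 : ∫ x, f x ∂μ = 0 := by
      refine integral_eq_zero_of_ae ?_
      filter_upwards [ae_nonpos_of_Ioi_eq_zero hμ] with x hx
      exact image_eq_zero_of_notMem_tsupport fun h => absurd (hfU h) (not_lt.2 hx)
    have i2 : Integrable fun x => w x * f x :=
      (hwc.mul hf.continuous).integrable_of_hasCompactSupport hfc.mul_left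
    rw [e3, ← integral_const_mul, ← integral_add i1 (i2.const_mul r)] at e2
    rw [← e2]
    congr 1
    ext x
    rw [smul_eq_mul]
    ring

end ProfileEquation

/-! ### Quasi-stationary distributions are wave profiles. -/

section QuasiStationaryToWave

variable {Ω : Type*} [MeasurableSpace Ω] {P : Measure Ω} [IsProbabilityMeasure P]
  {Y : ℝ≥0 → Ω → ℝ} {b σ r : ℝ} {Λ ν : Measure ℝ}

/-- The eigenvalue relation at time `1` gives `e^{-r} ν ≤ ν ∗ p 1`, and the Gaussian part makes the
right-hand side absolutely continuous. -/
theorem IsQSDWithEigenvalue.absolutelyContinuous (hq : IsQSDWithEigenvalue Y P ν r)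
    (hY : ∀ t, Measurable (Y t)) (hΛ : IsLevyMeasure Λ) (hT : HasLevyTriplet Y P b σ Λ)
    (hσ : 0 < σ) : ν ≪ volume := by
  have := hq.isProbabilityMeasure
  have hp := isLevySemigroup_map hY hT
  have hpr : IsProbabilityMeasure (P.map (Y 1)) := hp.prob 1
  refine Measure.AbsolutelyContinuous.mk fun A hA h0 => ?_
  have h1 : (ν ∗ P.map (Y 1)) A = 0 :=
    Measure.conv_absolutelyContinuous (hp.absolutelyContinuous hΛ hσ one_pos) h0
  have h2 := killedLaw_le_conv (P := P) hY ν 1 hA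
  rw [hq.eigenvalue 1 A hA, h1, nonpos_iff_eq_zero, mul_eq_zero] at h2
  exact h2.resolve_left (ENNReal.ofReal_pos.2 (Real.exp_pos _)).ne'

theorem IsQSDWithEigenvalue.isKilledEigenmeasure (hq : IsQSDWithEigenvalue Y P ν r)
    (hY : IsLevyProcess Y P) (hΛ : IsLevyMeasure Λ) (hT : HasLevyTriplet Y P b σ Λ)
    (hσ : 0 < σ) : IsKilledEigenmeasure (fun t => P.map (Y t)) ν r := by
  have := hq.isProbabilityMeasure
  intro t ht A hA
  have := hY.tendsto_iterate_killedStep hq.supported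
    (hq.absolutelyContinuous hY.measurable hΛ hT hσ) ht hA
  rwa [hq.eigenvalue t A hA] at this

/-- A quasi-stationary distribution has a density that is the profile of a traveling wave. -/
theorem IsQSDWithEigenvalue.exists_isTravelingWave {Z : ℝ≥0 → Ω → ℝ} {c : ℝ}
    (hq : IsQSDWithEigenvalue (drifted Z c) P ν r) (hZ : IsLevyProcess Z P)
    (hΛ : IsLevyMeasure Λ) (hT : HasLevyTriplet Z P b σ Λ) (hσ : 0 < σ) :
    ∃ w : ℝ → ℝ, Continuous w ∧ IsDensityOf w ν ∧ IsTravelingWave b σ Λ r c w := by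
  have := hq.isProbabilityMeasure
  have hY := hZ.drifted c
  have hTY := hT.drifted hZ.measurable c
  obtain ⟨μ, hμf, hμ, hchar⟩ := (hq.isKilledEigenmeasure hY hΛ hTY hσ).exists_exitMeasure
    (isLevySemigroup_map hY.measurable hTY) hΛ hσ
  obtain ⟨w, hwc, hw0, hwi, hwd, ⟨C, hb⟩, hw⟩ := exists_regular_density hΛ hσ hμ hchar
  have hneg : ∀ x, x ≤ 0 → w x = 0 := by
    have h1 : ∫⁻ x in Iic 0, ENNReal.ofReal (w x) = 0 := by
      rw [← withDensity_apply _ measurableSet_Iic, ← hwd, hq.supported]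
    rw [lintegral_eq_zero_iff (by fun_prop)] at h1
    -- Upgrading to every point requires an open set, so `0` is dropped here and recovered by taking
    -- the closure.
    have h2 : w =ᵐ[volume.restrict (Iio 0)] fun _ => 0 := by
      filter_upwards [ae_restrict_of_ae_restrict_of_subset Iio_subset_Iic_self h1] with x hx
      exact le_antisymm (ENNReal.ofReal_eq_zero.1 hx) (hw0 x)
    have h3 := Measure.eqOn_open_of_ae_eq h2 isOpen_Iio hwc.continuousOn continuousOn_const
    have h4 := h3.closure hwc continuous_const
    rw [closure_Iio] at h4
    exact fun x hx => h4 hx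
  refine ⟨w, hwc, ⟨hwc.measurable, hw0, hwd⟩, isTravelingWave_iff.2 ⟨hwc, ⟨hw, fun x hx =>
    ⟨integrable_adjointJumpIntegrand hΛ hwc hb isOpen_Ioi hw hx, ?_⟩⟩, hneg, ?_⟩⟩
  · rw [← adjointGenerator_sub_drift]
    exact adjointGenerator_add_eq_zero hΛ hμ hchar hwc hw0 hwi hwd hb hw hx
  · have h1 : ∫ x, (1 : ℝ) ∂ν = 1 := by simp
    rw [integral_density hwc.measurable hw0 hwd] at h1
    simp only [mul_one] at h1
    rw [← h1]
    refine setIntegral_eq_integral_of_forall_compl_eq_zero fun x hx => hneg x (not_lt.1 hx)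

end QuasiStationaryToWave

/-! ### Kato's inequality for a smooth convex truncation. -/

/-- A smooth step from `0` on `(-∞, ε]` to `1` on `[2ε, ∞)`. -/
noncomputable def smoothStep (ε s : ℝ) : ℝ := Real.smoothTransition (s / ε - 1)

/-- A smooth convex approximation of the positive part, vanishing on `(-∞, ε]`. -/
noncomputable def softPos (ε u : ℝ) : ℝ := ∫ s in (0 : ℝ)..u, smoothStep ε s

section SoftPos

variable {ε : ℝ}

theorem contDiff_smoothStep (ε : ℝ) {n : ℕ∞} : ContDiff ℝ n (smoothStep ε) := by
  unfold smoothStep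
  exact Real.smoothTransition.contDiff.comp (by fun_prop)

theorem continuous_smoothStep (ε : ℝ) : Continuous (smoothStep ε) :=
  (contDiff_smoothStep ε (n := 0)).continuous

theorem smoothStep_nonneg (ε s : ℝ) : 0 ≤ smoothStep ε s := Real.smoothTransition.nonneg _

theorem smoothStep_le_one (ε s : ℝ) : smoothStep ε s ≤ 1 := Real.smoothTransition.le_one _

theorem smoothStep_of_le (hε : 0 < ε) {s : ℝ} (hs : s ≤ ε) : smoothStep ε s = 0 :=
  Real.smoothTransition.zero_of_nonpos (by rw [sub_nonpos, div_le_one hε]; exact hs)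

theorem smoothStep_of_ge (hε : 0 < ε) {s : ℝ} (hs : 2 * ε ≤ s) : smoothStep ε s = 1 :=
  Real.smoothTransition.one_of_one_le (by rw [le_sub_iff_add_le, le_div_iff₀ hε]; linarith)

theorem monotone_smoothStep (hε : 0 < ε) : Monotone (smoothStep ε) := fun s t hst =>
  Real.smoothTransition.monotone (by gcongr)

theorem hasDerivAt_softPos (ε u : ℝ) : HasDerivAt (softPos ε) (smoothStep ε u) u :=
  ((continuous_smoothStep ε).integral_hasStrictDerivAt 0 u).hasDerivAt

theorem continuous_softPos (ε : ℝ) : Continuous (softPos ε) :=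
  continuous_iff_continuousAt.2 fun u => (hasDerivAt_softPos ε u).continuousAt

theorem softPos_of_le (hε : 0 < ε) {u : ℝ} (hu : u ≤ ε) : softPos ε u = 0 := by
  unfold softPos
  have : ∫ s in (0 : ℝ)..u, smoothStep ε s = ∫ _ in (0 : ℝ)..u, (0 : ℝ) :=
    intervalIntegral.integral_congr fun s hs =>
      smoothStep_of_le hε ((hs.2).trans (max_le hε.le hu))
  rw [this, intervalIntegral.integral_zero]

/-- The tangent-line inequality of a convex function, obtained from the monotonicity of its
derivative. Applied to `w (x - y)` and `w x`, it is exactly what the nonlocal term needs. -/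
theorem softPos_add_le (hε : 0 < ε) (u v : ℝ) :
    softPos ε u + smoothStep ε u * (v - u) ≤ softPos ε v := by
  have hc := continuous_smoothStep ε
  have h1 : softPos ε v - softPos ε u = ∫ s in u..v, smoothStep ε s :=
    intervalIntegral.integral_interval_sub_left (hc.intervalIntegrable _ _)
      (hc.intervalIntegrable _ _)
  have h2 : smoothStep ε u * (v - u) = ∫ _ in u..v, smoothStep ε u := by
    rw [intervalIntegral.integral_const, smul_eq_mul, mul_comm]
  have h3 : ∫ _ in u..v, smoothStep ε u ≤ ∫ s in u..v, smoothStep ε s := by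
    rcases le_total u v with huv | huv
    · exact intervalIntegral.integral_mono_on huv (by simp) (hc.intervalIntegrable _ _)
        fun s hs => monotone_smoothStep hε hs.1
    · rw [intervalIntegral.integral_symm, intervalIntegral.integral_symm v u, neg_le_neg_iff]
      exact intervalIntegral.integral_mono_on huv (hc.intervalIntegrable _ _) (by simp)
        fun s hs => monotone_smoothStep hε hs.2
  linarith

theorem softPos_nonneg (hε : 0 < ε) (u : ℝ) : 0 ≤ softPos ε u := by
  have := softPos_add_le hε 0 u
  rw [softPos_of_le hε hε.le, smoothStep_of_le hε hε.le] at this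
  linarith

theorem softPos_le (ε : ℝ) {u : ℝ} (hu : 0 ≤ u) : softPos ε u ≤ u := by
  have hc := continuous_smoothStep ε
  have : softPos ε u ≤ ∫ _ in (0 : ℝ)..u, (1 : ℝ) :=
    intervalIntegral.integral_mono_on hu (hc.intervalIntegrable _ _) (by simp)
      fun s _ => smoothStep_le_one ε s
  simpa using this

theorem sub_le_softPos (hε : 0 < ε) (u : ℝ) : u - 2 * ε ≤ softPos ε u := by
  have := softPos_add_le hε (2 * ε) u
  rw [smoothStep_of_ge hε le_rfl] at this
  linarith [softPos_nonneg hε (2 * ε)]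

end SoftPos

section Kato

variable {b σ r : ℝ} {Λ : Measure ℝ} {w : ℝ → ℝ} {ε : ℝ}

/-- Truncating from below turns a function that vanishes continuously on `(-∞, 0]` into a function
that is `C²` on the whole line. -/
theorem softPos_comp_regular (hε : 0 < ε) (hwc : Continuous w) (hw : ContDiffOn ℝ 2 w (Ioi 0))
    (hv : ∀ x, x ≤ 0 → w x = 0) :
    (∀ x, HasDerivAt (fun x => softPos ε (w x)) (smoothStep ε (w x) * deriv w x) x) ∧
      (∀ x, HasDerivAt (fun x => smoothStep ε (w x) * deriv w x)
        (deriv (smoothStep ε) (w x) * deriv w x * deriv w x +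
          smoothStep ε (w x) * deriv (deriv w) x) x) ∧
      ContDiff ℝ 2 fun x => softPos ε (w x) := by
  obtain ⟨h1, h2, hc1, hc2⟩ := hw.hasDerivAt_deriv_two isOpen_Ioi
  have hθ : ∀ u, HasDerivAt (smoothStep ε) (deriv (smoothStep ε) u) u := fun u =>
    ((contDiff_smoothStep ε (n := 1)).differentiable (by simp) u).hasDerivAt
  have hθc : Continuous (deriv (smoothStep ε)) :=
    (contDiff_smoothStep ε (n := 1)).continuous_deriv le_rfl
  have hV : IsOpen {x | w x < ε} := isOpen_lt hwc continuous_const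
  have hθ0 : ∀ u, u < ε → deriv (smoothStep ε) u = 0 := fun u hu => by
    have : smoothStep ε =ᶠ[𝓝 u] fun _ => 0 := by
      filter_upwards [Iio_mem_nhds hu] with s hs using smoothStep_of_le hε (le_of_lt hs)
    rw [this.deriv_eq, deriv_const]
  -- Either `w` is `C²` near `x`, or by continuity `w < ε` near `x` and the truncation vanishes
  -- identically there. The two open sets cover the line, so the kink of `w` at `0` disappears.
  have hcase : ∀ x, 0 < x ∨ w x < ε := fun x => by
    rcases lt_or_ge 0 x with hx | hx
    · exact Or.inl hx
    · exact Or.inr (by rw [hv x hx]; exact hε)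
  have d1 : ∀ x, HasDerivAt (fun x => softPos ε (w x)) (smoothStep ε (w x) * deriv w x) x := by
    intro x
    rcases hcase x with hx | hx
    · exact (hasDerivAt_softPos ε (w x)).comp x (h1 x hx)
    · have : (fun x => softPos ε (w x)) =ᶠ[𝓝 x] fun _ => 0 := by
        filter_upwards [hV.mem_nhds hx] with z hz using softPos_of_le hε (le_of_lt hz)
      rw [smoothStep_of_le hε (le_of_lt hx), zero_mul]
      exact (hasDerivAt_const x (0 : ℝ)).congr_of_eventuallyEq this
  have d2 : ∀ x, HasDerivAt (fun x => smoothStep ε (w x) * deriv w x)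
        (deriv (smoothStep ε) (w x) * deriv w x * deriv w x +
          smoothStep ε (w x) * deriv (deriv w) x) x := by
    intro x
    rcases hcase x with hx | hx
    · exact ((hθ (w x)).comp x (h1 x hx)).fun_mul (h2 x hx)
    · have : (fun x => smoothStep ε (w x) * deriv w x) =ᶠ[𝓝 x] fun _ => 0 := by
        filter_upwards [hV.mem_nhds hx] with z hz
        rw [smoothStep_of_le hε (le_of_lt hz), zero_mul]
      rw [smoothStep_of_le hε (le_of_lt hx), hθ0 _ hx, zero_mul, zero_mul, zero_mul, add_zero]
      exact (hasDerivAt_const x (0 : ℝ)).congr_of_eventuallyEq this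
  refine ⟨d1, d2, contDiffOn_univ.1 (contDiffOn_two_of_hasDerivAt isOpen_univ (fun x _ => d1 x)
    (fun x _ => d2 x) (continuousOn_univ.2 (continuous_iff_continuousAt.2 fun x => ?_)))⟩
  rcases hcase x with hx | hx
  · have c1 := hc1.continuousAt (Ioi_mem_nhds hx)
    have c2 := hc2.continuousAt (Ioi_mem_nhds hx)
    have c3 := hwc.continuousAt (x := x)
    have c4 := (hθc.comp hwc).continuousAt (x := x)
    have c5 := ((continuous_smoothStep ε).comp hwc).continuousAt (x := x)
    exact ((c4.mul c1).mul c1).add (c5.mul c2)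
  · refine (continuousAt_const (y := (0 : ℝ))).congr ?_
    filter_upwards [hV.mem_nhds hx] with z hz
    rw [smoothStep_of_le hε (le_of_lt hz), hθ0 _ hz, zero_mul, zero_mul, zero_mul, add_zero]

/-- The profile is not assumed bounded, so large jumps are controlled through `0 ≤ softPos ε w ≤ w`
and the assumed integrability for `w` itself; small jumps use that the truncation is `C²`. -/
theorem integrable_adjointJumpIntegrand_softPos (hΛ : IsLevyMeasure Λ) (hε : 0 < ε)
    (hw0 : ∀ x, 0 ≤ w x) (hv2 : ContDiff ℝ 2 fun x => softPos ε (w x)) {x : ℝ}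
    (hi : Integrable (adjointJumpIntegrand w x) Λ) :
    Integrable (adjointJumpIntegrand (fun x => softPos ε (w x)) x) Λ := by
  set v := fun x => softPos ε (w x) with hv
  obtain ⟨δ, M, hδ, hδ1, hM0, hM⟩ := exists_adjointJumpIntegrand_le isOpen_univ
    (contDiffOn_univ.2 hv2) (isCompact_singleton (x := x)) (subset_univ _)
  set D := 2 * w x + |deriv w x| + |deriv v x| with hD
  have hD0 : 0 ≤ D := by have := hw0 x; positivity
  have hvc : Continuous v := hv2.continuous
  refine (hi.norm.add (hΛ.integrable_min.const_mul (M + D * (δ ^ 2)⁻¹))).mono'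
    ((measurable_adjointJumpIntegrand hvc.measurable).comp
      measurable_prodMk_left).aestronglyMeasurable (ae_of_all _ fun y => ?_)
  rw [Pi.add_apply, Real.norm_eq_abs, Real.norm_eq_abs]
  have hmin : 0 ≤ min 1 (y ^ 2) := by positivity
  rcases lt_or_ge |y| δ with hy | hy
  · refine (hM x rfl y hy).trans (le_add_of_nonneg_of_le (abs_nonneg _)
      (mul_le_mul_of_nonneg_right (le_add_of_nonneg_right (by positivity)) hmin))
  · have ht : |truncJump y| ≤ 1 := by
      unfold truncJump
      split_ifs with h
      · exact h
      · simp
    have h1 : |adjointJumpIntegrand v x y| ≤ |adjointJumpIntegrand w x y| + D := by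
      unfold adjointJumpIntegrand
      have a1 : |truncJump y * deriv v x| ≤ 1 * |deriv v x| := by rw [abs_mul]; gcongr
      have a2 : |truncJump y * deriv w x| ≤ 1 * |deriv w x| := by rw [abs_mul]; gcongr
      have a3 := abs_add_le (v (x - y) - v x) (truncJump y * deriv v x)
      have b0 : 0 ≤ v (x - y) := softPos_nonneg hε _
      have b1 : v (x - y) ≤ w (x - y) := softPos_le ε (hw0 _)
      have b2 : 0 ≤ v x := softPos_nonneg hε _
      have b3 : v x ≤ w x := softPos_le ε (hw0 _)
      have a4 : |v (x - y) - v x| ≤ w (x - y) + w x := abs_le.2 ⟨by linarith [hw0 (x - y)], by linarith [hw0 x]⟩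
      have a5 := le_abs_self (w (x - y) - w x + truncJump y * deriv w x)
      have a6 := neg_le_of_abs_le a2
      linarith
    have h2 : δ ^ 2 ≤ min 1 (y ^ 2) := by
      refine le_min (pow_le_one₀ hδ.le hδ1) ?_
      rw [← sq_abs y]
      gcongr
    refine h1.trans (add_le_add le_rfl ?_)
    rw [add_mul, mul_assoc]
    refine le_add_of_nonneg_of_le (by positivity) ?_
    refine le_mul_of_one_le_right hD0 ?_
    rw [← div_eq_inv_mul]
    exact (one_le_div (by positivity)).2 h2

/-- Kato's inequality for the convex truncation of a solution of the profile equation. -/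
theorem le_adjointGenerator_softPos (hΛ : IsLevyMeasure Λ) (hε : 0 < ε) (hwc : Continuous w)
    (hw0 : ∀ x, 0 ≤ w x) (hw : ContDiffOn ℝ 2 w (Ioi 0)) (hv : ∀ x, x ≤ 0 → w x = 0)
    (hi : ∀ x, 0 < x → Integrable (adjointJumpIntegrand w x) Λ)
    (heq : ∀ x, 0 < x → adjointGenerator b σ Λ w x + r * w x = 0) (x : ℝ) :
    -(r * (smoothStep ε (w x) * w x)) ≤
      adjointGenerator b σ Λ (fun x => softPos ε (w x)) x := by
  obtain ⟨d1, d2, hv2⟩ := softPos_comp_regular hε hwc hw hv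
  have e1 : deriv (fun x => softPos ε (w x)) = fun x => smoothStep ε (w x) * deriv w x :=
    funext fun x => (d1 x).deriv
  unfold adjointGenerator
  rw [e1, (d2 x).deriv]
  have hjump : ∀ y, smoothStep ε (w x) * adjointJumpIntegrand w x y ≤
      adjointJumpIntegrand (fun x => softPos ε (w x)) x y := fun y => by
    unfold adjointJumpIntegrand
    rw [e1]
    have := softPos_add_le hε (w x) (w (x - y))
    have h2 : smoothStep ε (w x) * (w (x - y) - w x + truncJump y * deriv w x) =
      smoothStep ε (w x) * (w (x - y) - w x) +
        truncJump y * (smoothStep ε (w x) * deriv w x) := by ring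
    rw [h2]
    linarith
  rcases lt_or_ge 0 x with hx | hx
  · have hθ' : 0 ≤ deriv (smoothStep ε) (w x) := (monotone_smoothStep hε).deriv_nonneg
    have h1 : smoothStep ε (w x) * ∫ y, adjointJumpIntegrand w x y ∂Λ ≤
        ∫ y, adjointJumpIntegrand (fun x => softPos ε (w x)) x y ∂Λ := by
      rw [← integral_const_mul]
      exact integral_mono ((hi x hx).const_mul _)
        (integrable_adjointJumpIntegrand_softPos hΛ hε hw0 hv2 (hi x hx)) hjump
    have h2 := heq x hx
    unfold adjointGenerator at h2
    have h3 : smoothStep ε (w x) * (σ ^ 2 / 2 * deriv (deriv w) x - b * deriv w x +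
      ∫ y, adjointJumpIntegrand w x y ∂Λ) = -(r * (smoothStep ε (w x) * w x)) := by
      rw [eq_neg_of_add_eq_zero_left h2]; ring
    have h4 : 0 ≤ σ ^ 2 / 2 * (deriv (smoothStep ε) (w x) * (deriv w x * deriv w x)) :=
      mul_nonneg (by positivity) (mul_nonneg hθ' (mul_self_nonneg _))
    rw [← h3]
    linarith
  -- Where `w = 0` all local terms vanish, and only jumps to nonnegative values remain.
  · have hz : smoothStep ε (w x) = 0 := smoothStep_of_le hε (by rw [hv x hx]; exact hε.le)
    have hz' : deriv (smoothStep ε) (w x) = 0 := by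
      have : smoothStep ε =ᶠ[𝓝 (w x)] fun _ => 0 := by
        filter_upwards [Iio_mem_nhds (show w x < ε by rw [hv x hx]; exact hε)] with s hs
          using smoothStep_of_le hε (le_of_lt hs)
      rw [this.deriv_eq, deriv_const]
    have h1 : 0 ≤ ∫ y, adjointJumpIntegrand (fun x => softPos ε (w x)) x y ∂Λ :=
      integral_nonneg fun y => by
        have := hjump y
        rwa [hz, zero_mul] at this
    rw [hz, hz']
    simpa [hz] using h1

end Kato

/-! ### From weak supersolutions on the line to subinvariant measures. -/

theorem exists_smooth_between {K U : Set ℝ} (hK : IsCompact K) (hU : IsOpen U) (hKU : K ⊆ U) :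
    ∃ f : ℝ → ℝ, ContDiff ℝ ((⊤ : ℕ∞) : WithTop ℕ∞) f ∧ HasCompactSupport f ∧
      tsupport f ⊆ U ∧ (∀ x, 0 ≤ f x) ∧ (∀ x ∈ K, 1 ≤ f x) ∧ ∀ x, f x ≤ U.indicator 1 x := by
  obtain ⟨L, hL, hKL, hLU⟩ := exists_compact_between hK hU hKU
  obtain ⟨f, h0, h1, h01⟩ := exists_contMDiffMap_zero_one_of_isClosed (n := (⊤ : ℕ∞))
    (modelWithCornersSelf ℝ ℝ) (s := (interior L)ᶜ) (t := K) isOpen_interior.isClosed_compl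
    hK.isClosed (disjoint_left.2 fun x hx hxK => hx (hKL hxK))
  have hsupp : Function.support f ⊆ L := fun x hx => by
    by_contra hxL
    exact hx (h0 fun h => hxL (interior_subset h))
  refine ⟨f, f.contMDiff.contDiff, HasCompactSupport.of_support_subset_isCompact hL hsupp,
    (closure_minimal hsupp hL.isClosed).trans hLU, fun x => (h01 x).1, fun x hx => (h1 hx).ge,
    fun x => ?_⟩
  · by_cases hx : x ∈ U
    · rw [indicator_of_mem hx]; exact (h01 x).2
    · rw [indicator_of_notMem hx]
      exact (h0 fun h => hx (hLU (interior_subset h))).le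

/-- Finite measures on the line are compared by their integrals of smooth test functions. -/
theorem Measure.le_of_forall_integral_smooth_le {μ₁ μ₂ : Measure ℝ} [IsFiniteMeasure μ₁]
    [IsFiniteMeasure μ₂] (h : ∀ f : ℝ → ℝ, ContDiff ℝ ((⊤ : ℕ∞) : WithTop ℕ∞) f →
      HasCompactSupport f → (∀ x, 0 ≤ f x) → ∫ x, f x ∂μ₁ ≤ ∫ x, f x ∂μ₂) : μ₁ ≤ μ₂ := by
  have h1 : ∀ K : Set ℝ, IsCompact K → ∀ U, K ⊆ U → IsOpen U → μ₁ K ≤ μ₂ U := by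
    intro K hK U hKU hU
    obtain ⟨f, hf, hfc, -, hf0, hf1, hfU⟩ := exists_smooth_between hK hU hKU
    have hi : ∀ (μ : Measure ℝ) [IsFiniteMeasure μ], Integrable f μ := fun μ _ =>
      hf.continuous.integrable_of_hasCompactSupport hfc
    have a1 : μ₁.real K ≤ ∫ x, f x ∂μ₁ := by
      rw [← integral_indicator_one hK.measurableSet]
      refine integral_mono ((integrable_const (1 : ℝ)).indicator hK.measurableSet) (hi μ₁)
        fun x => ?_
      by_cases hx : x ∈ K
      · rw [indicator_of_mem hx]; exact hf1 x hx
      · rw [indicator_of_notMem hx]; exact hf0 x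
    have a2 : ∫ x, f x ∂μ₂ ≤ μ₂.real U := by
      rw [← integral_indicator_one hU.measurableSet]
      exact integral_mono (hi μ₂) ((integrable_const (1 : ℝ)).indicator hU.measurableSet) hfU
    rw [← ofReal_measureReal, ← ofReal_measureReal (μ := μ₂)]
    exact ENNReal.ofReal_le_ofReal (a1.trans ((h f hf hfc hf0).trans a2))
  refine Measure.le_iff.2 fun A hA => ?_
  -- Inner regularity for `μ₁` and outer regularity for `μ₂` reduce the comparison to a compact set
  -- inside an open one, with a smooth bump between them.
  rw [hA.measure_eq_iSup_isCompact_of_ne_top (measure_ne_top _ _)]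
  refine iSup₂_le fun K hKA => iSup_le fun hK => le_trans ?_ (measure_mono hKA)
  rw [K.measure_eq_iInf_isOpen μ₂]
  exact le_iInf₂ fun U hKU => le_iInf fun hU => h1 K hK U hKU hU

section TestFunctions

variable {b σ r : ℝ} {Λ ν : Measure ℝ} {f : ℝ → ℝ}

theorem levyGenerator_comp_add (b σ : ℝ) (Λ : Measure ℝ) (f : ℝ → ℝ) (a x : ℝ) :
    levyGenerator b σ Λ (fun x => f (x + a)) x = levyGenerator b σ Λ f (x + a) := by
  unfold levyGenerator
  have h1 : deriv (fun x => f (x + a)) = fun x => deriv f (x + a) :=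
    funext fun x => deriv_comp_add_const f a x
  rw [h1, deriv_comp_add_const]
  simp_rw [add_right_comm]

/-- Continuity and boundedness follow at once from the representation as the transform of an
integrable function; they justify integrating `levyGenerator` against arbitrary probability
measures. -/
theorem exists_levyGenerator_bound (hΛ : IsLevyMeasure Λ) (b σ : ℝ)
    (hf : ContDiff ℝ ((⊤ : ℕ∞) : WithTop ℕ∞) f) (hfc : HasCompactSupport f) :
    Continuous (levyGenerator b σ Λ f) ∧ ∃ C, ∀ x, |levyGenerator b σ Λ f x| ≤ C := by
  obtain ⟨F, hFc, hF, hfF⟩ := exists_fourierSynth_eq hf hfc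
  obtain ⟨C, hC0, hC⟩ := exists_norm_levyExponent_le hΛ b σ
  have hΨm : Measurable fun v : ℝ => levyExponent b σ Λ (2 * Real.pi * v) :=
    (measurable_levyExponent hΛ b σ).comp (by fun_prop)
  have i1 : Integrable fun v : ℝ => levyExponent b σ Λ (2 * Real.pi * v) * F v :=
    integrable_of_one_add_sq hFc.aestronglyMeasurable hF hΨm.aestronglyMeasurable fun v => hC _
  have e : ∀ x, levyGenerator b σ Λ f x =
      (fourierSynth (fun v => levyExponent b σ Λ (2 * Real.pi * v) * F v) x).re := fun x => by
    rw [← levyGenerator_eq_fourierSynth hΛ b σ hFc hF hfF x, Complex.ofReal_re]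
  refine ⟨?_, ∫ v : ℝ, ‖levyExponent b σ Λ (2 * Real.pi * v) * F v‖, fun x => ?_⟩
  · rw [funext e]
    exact Complex.continuous_re.comp (continuous_fourierSynth i1)
  · rw [e, fourierSynth_eq_fourier]
    exact (Complex.abs_re_le_norm _).trans (norm_fourier_le _ _)

/-- Weak form of `L* w + r w ≥ 0` on the whole line. -/
theorem integral_mul_levyGenerator_add_nonneg (hΛ : IsLevyMeasure Λ) {w : ℝ → ℝ}
    (hwc : Continuous w) (hw0 : ∀ x, 0 ≤ w x) (hwi : Integrable w) (hw : ContDiffOn ℝ 2 w (Ioi 0))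
    (hv : ∀ x, x ≤ 0 → w x = 0) (hi : ∀ x, 0 < x → Integrable (adjointJumpIntegrand w x) Λ)
    (heq : ∀ x, 0 < x → adjointGenerator b σ Λ w x + r * w x = 0)
    (hf : ContDiff ℝ ((⊤ : ℕ∞) : WithTop ℕ∞) f) (hfc : HasCompactSupport f) (hf0 : ∀ x, 0 ≤ f x) :
    0 ≤ (∫ x, w x * levyGenerator b σ Λ f x) + r * ∫ x, w x * f x := by
  set ε : ℕ → ℝ := fun n => 1 / ((n : ℝ) + 1) with hεdef
  have hε : ∀ n, 0 < ε n := fun n => by simp only [hεdef]; positivity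
  have hε0 : Tendsto ε atTop (𝓝 0) := tendsto_one_div_add_atTop_nhds_zero_nat
  obtain ⟨hLc, C, hC⟩ := exists_levyGenerator_bound hΛ b σ hf hfc
  obtain ⟨B, hB⟩ := hfc.exists_bound_of_continuous hf.continuous
  have hle : ∀ n x, softPos (ε n) (w x) ≤ w x := fun n x => softPos_le _ (hw0 x)
  have hnn : ∀ n x, 0 ≤ softPos (ε n) (w x) := fun n x => softPos_nonneg (hε n) _
  have hvc : ∀ n, Continuous fun x => softPos (ε n) (w x) := fun n =>
    (continuous_softPos (ε n)).comp hwc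
  have hθc : ∀ n, Continuous fun x => smoothStep (ε n) (w x) := fun n =>
    (continuous_smoothStep (ε n)).comp hwc
  have hbound : ∀ n x, |softPos (ε n) (w x)| ≤ w x := fun n x => by
    rw [abs_of_nonneg (hnn n x)]; exact hle n x
  have hvi : ∀ n, Integrable fun x => softPos (ε n) (w x) := fun n =>
    hwi.mono' (hvc n).aestronglyMeasurable (ae_of_all _ (hbound n))
  have key : ∀ n, 0 ≤ (∫ x, softPos (ε n) (w x) * levyGenerator b σ Λ f x) +
      r * ∫ x, smoothStep (ε n) (w x) * w x * f x := by
    intro n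
    obtain ⟨i1, e1⟩ := integral_mul_levyGenerator hΛ b σ isOpen_univ (hvi n) (hvc n)
      (softPos_comp_regular (hε n) hwc hw hv).2.2.contDiffOn (contDiff_infty.1 hf 2) hfc
      (subset_univ _)
    have i2 : Integrable fun x => smoothStep (ε n) (w x) * w x * f x :=
      (((hθc n).mul hwc).mul hf.continuous).integrable_of_hasCompactSupport hfc.mul_left
    rw [e1, ← integral_const_mul, ← integral_add i1 (i2.const_mul r)]
    refine integral_nonneg fun x => ?_
    have := le_adjointGenerator_softPos (b := b) (σ := σ) hΛ (hε n) hwc hw0 hw hv hi heq x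
    have := mul_nonneg (hf0 x) (neg_le_iff_add_nonneg.1 this)
    simp only [Pi.zero_apply]
    linarith
  have t1 : Tendsto (fun n => ∫ x, softPos (ε n) (w x) * levyGenerator b σ Λ f x) atTop
      (𝓝 (∫ x, w x * levyGenerator b σ Λ f x)) := by
    refine tendsto_integral_of_dominated_convergence (fun x => w x * C)
      (fun n => ((hvc n).mul hLc).aestronglyMeasurable) (hwi.mul_const C)
      (fun n => ae_of_all _ fun x => ?_) (ae_of_all _ fun x => ?_)
    · rw [norm_mul]
      exact mul_le_mul (hbound n x) (hC x) (norm_nonneg _) (hw0 x)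
    · refine Tendsto.mul_const _ ?_
      refine tendsto_of_tendsto_of_tendsto_of_le_of_le (g := fun n => w x - 2 * ε n) ?_
        tendsto_const_nhds (fun n => sub_le_softPos (hε n) _) (fun n => hle n x)
      simpa using (hε0.const_mul 2).const_sub (w x)
  have t2 : Tendsto (fun n => ∫ x, smoothStep (ε n) (w x) * w x * f x) atTop
      (𝓝 (∫ x, w x * f x)) := by
    refine tendsto_integral_of_dominated_convergence (fun x => w x * B)
      (fun n => (((hθc n).mul hwc).mul hf.continuous).aestronglyMeasurable) (hwi.mul_const B)
      (fun n => ae_of_all _ fun x => ?_) (ae_of_all _ fun x => ?_)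
    · rw [norm_mul, Real.norm_of_nonneg (mul_nonneg (smoothStep_nonneg _ _) (hw0 x))]
      exact mul_le_mul (mul_le_of_le_one_left (hw0 x) (smoothStep_le_one _ _)) (hB x)
        (norm_nonneg _) (hw0 x)
    · refine Tendsto.mul_const _ ?_
      -- The step function tends to the indicator of `w > 0`; where `w = 0` the factor `w` already
      -- vanishes.
      rcases (hw0 x).eq_or_lt with h | h
      · simp [← h]
      · refine tendsto_const_nhds.congr' ?_
        have := hε0.eventually (gt_mem_nhds (show (0 : ℝ) < w x / 2 by positivity))
        filter_upwards [this] with n hn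
        rw [smoothStep_of_ge (hε n) (by linarith), one_mul]
  exact ge_of_tendsto' (t1.add (t2.const_mul r)) key

/-- Weak form of `L* ν + r ν ≥ 0`. -/
def IsWeaklyExcessive (b σ : ℝ) (Λ ν : Measure ℝ) (r : ℝ) : Prop :=
  ∀ f : ℝ → ℝ, ContDiff ℝ ((⊤ : ℕ∞) : WithTop ℕ∞) f → HasCompactSupport f → (∀ x, 0 ≤ f x) →
    0 ≤ ∫ x, levyGenerator b σ Λ f x ∂ν + r * ∫ x, f x ∂ν

/-- The generator commutes with translations and a convolution is an average of translates, so the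
inequality is inherited. -/
theorem IsWeaklyExcessive.conv [IsProbabilityMeasure ν] (hν : IsWeaklyExcessive b σ Λ ν r)
    (hΛ : IsLevyMeasure Λ) (q : Measure ℝ) [IsProbabilityMeasure q] :
    IsWeaklyExcessive b σ Λ (ν ∗ q) r := by
  intro f hf hfc hf0
  obtain ⟨hLc, C, hC⟩ := exists_levyGenerator_bound hΛ b σ hf hfc
  obtain ⟨B, hB⟩ := hfc.exists_bound_of_continuous hf.continuous
  have hi : ∀ (ρ : Measure ℝ) [IsProbabilityMeasure ρ], Integrable (levyGenerator b σ Λ f) ρ :=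
    fun ρ _ => (integrable_const C).mono' hLc.aestronglyMeasurable (ae_of_all _ hC)
  have hi' : ∀ (ρ : Measure ℝ) [IsProbabilityMeasure ρ], Integrable f ρ :=
    fun ρ _ => (integrable_const B).mono' hf.continuous.aestronglyMeasurable (ae_of_all _ hB)
  have a1 : Integrable (fun z => levyGenerator b σ Λ f z + r * f z) (q ∗ ν) :=
    (hi _).add ((hi' _).const_mul r)
  have a2 : ∀ (ρ : Measure ℝ) [IsProbabilityMeasure ρ] (y : ℝ),
      Integrable (fun x => levyGenerator b σ Λ f (x + y)) ρ := fun ρ _ y =>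
    (integrable_const C).mono' (hLc.comp (continuous_add_const y)).aestronglyMeasurable
      (ae_of_all _ fun x => hC _)
  have a3 : ∀ (ρ : Measure ℝ) [IsProbabilityMeasure ρ] (y : ℝ),
      Integrable (fun x => f (x + y)) ρ := fun ρ _ y =>
    (integrable_const B).mono' (hf.continuous.comp (continuous_add_const y)).aestronglyMeasurable
      (ae_of_all _ fun x => hB _)
  rw [Measure.conv_comm, ← integral_const_mul, ← integral_add (hi _) ((hi' _).const_mul r),
    integral_conv a1]
  refine integral_nonneg fun y => ?_
  have h1 := hν (fun x => f (x + y)) (hf.comp (by fun_prop))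
    (hfc.comp_homeomorph (Homeomorph.addRight y)) (fun x => hf0 _)
  simp_rw [levyGenerator_comp_add] at h1
  rw [← integral_const_mul, ← integral_add (a2 ν y) ((a3 ν y).const_mul r)] at h1
  simp only [add_comm y, Pi.zero_apply]
  exact h1

/-- The function `s ↦ e^{rs} ∫ f d(ν ∗ p s)` has right derivative `e^{rs}` times the weak expression
for `ν ∗ p s`, which is nonnegative, so it is nondecreasing. The comparison principle is applied to
its negative because it yields upper bounds. -/
theorem IsWeaklyExcessive.isSubinvariant {p : ℝ≥0 → Measure ℝ} [IsProbabilityMeasure ν]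
    (hν : IsWeaklyExcessive b σ Λ ν r) (hΛ : IsLevyMeasure Λ) (hp : IsLevySemigroup p b σ Λ) :
    IsSubinvariant p ν r := by
  intro t ht
  have hpr := hp.prob
  have hfin : IsFiniteMeasure (ENNReal.ofReal (Real.exp (-r * t)) • ν) :=
    Measure.smul_finite ν ENNReal.ofReal_ne_top
  refine Measure.le_of_forall_integral_smooth_le fun f hf hfc hf0 => ?_
  rw [integral_smul_measure, ENNReal.toReal_ofReal (Real.exp_pos _).le, smul_eq_mul]
  set F : ℝ → ℝ := fun s => ∫ x, f x ∂(ν ∗ p s.toNNReal) with hF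
  have hexp : ∀ s : ℝ, HasDerivAt (fun s => Real.exp (r * s)) (Real.exp (r * s) * r) s := fun s => by
    have := ((hasDerivAt_id s).const_mul r).exp
    simpa using this
  have hFc : ContinuousOn F (Ici 0) := hp.continuousOn_integral_conv hΛ ν hf hfc
  have hmono := image_le_of_deriv_right_le_deriv_boundary (a := 0) (b := (t : ℝ))
    (f := fun s => -(Real.exp (r * s) * F s))
    (f' := fun s => -(Real.exp (r * s) * r * F s + Real.exp (r * s) *
      ∫ x, levyGenerator b σ Λ f x ∂(ν ∗ p s.toNNReal)))
    (B := fun _ => -F 0) (B' := fun _ => 0) ?_ ?_ ?_ continuousOn_const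
    (fun x _ => hasDerivWithinAt_const _ _ _) ?_ (right_mem_Icc.2 t.coe_nonneg)
  · have h0 : F 0 = ∫ x, f x ∂ν := by
      simp only [hF]
      rw [Real.toNNReal_zero, hp.zero, Measure.conv_dirac_zero]
    have ht' : F t = ∫ x, f x ∂(ν ∗ p t) := by
      simp only [hF]
      rw [Real.toNNReal_coe]
    rw [← h0, ← ht']
    have h1 : F 0 ≤ Real.exp (r * t) * F t := by linarith
    calc Real.exp (-r * t) * F 0 ≤ Real.exp (-r * t) * (Real.exp (r * t) * F t) := by gcongr
      _ = F t := by rw [← mul_assoc, ← Real.exp_add]; simp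
  · have : Continuous fun s : ℝ => Real.exp (r * s) := by fun_prop
    exact (this.continuousOn.mul (hFc.mono Icc_subset_Ici_self)).neg
  · intro s hs
    exact ((hexp s).hasDerivWithinAt.mul
      (hp.hasDerivWithinAt_integral_conv hΛ ν hf hfc hs.1)).neg
  · simp
  · intro s hs
    have h1 := hν.conv hΛ (p s.toNNReal) f hf hfc hf0
    have h2 := mul_nonneg (Real.exp_pos (r * s)).le h1
    simp only [hF]
    linarith

end TestFunctions

/-! ### The excess of a wave profile is negligible away from the origin. -/

/-- Weak form of `L* ν + r ν = 0` on `(0, ∞)`. -/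
def IsWeaklyInvariant (b σ : ℝ) (Λ ν : Measure ℝ) (r : ℝ) : Prop :=
  ∀ f : ℝ → ℝ, ContDiff ℝ ((⊤ : ℕ∞) : WithTop ℕ∞) f → HasCompactSupport f → tsupport f ⊆ Ioi 0 →
    ∫ x, levyGenerator b σ Λ f x ∂ν + r * ∫ x, f x ∂ν = 0

/-- The excess of one step has mass `1 - e^{-rh}`; over all `2 ^ n` steps the total stays bounded by
`r t`. Boundedness is all that this gives: smallness must come from elsewhere. -/
theorem two_pow_mul_one_sub_exp_le (r : ℝ) (t : ℝ≥0) (n : ℕ) :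
    (2 : ℝ≥0∞) ^ n * ENNReal.ofReal (1 - Real.exp (-r * (t / 2 ^ n : ℝ≥0))) ≤
      ENNReal.ofReal (r * t) := by
  have h3 : (2 : ℝ≥0∞) ^ n = ENNReal.ofReal (2 ^ n) := by
    rw [ENNReal.ofReal_pow (by norm_num), ENNReal.ofReal_ofNat]
  rw [h3, ← ENNReal.ofReal_mul (by positivity)]
  refine ENNReal.ofReal_le_ofReal ?_
  have h4 := Real.add_one_le_exp (-r * (t / 2 ^ n : ℝ≥0))
  push_cast at h4 ⊢
  calc (2 : ℝ) ^ n * (1 - Real.exp (-r * (t / 2 ^ n))) ≤ 2 ^ n * (r * (t / 2 ^ n)) := by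
        gcongr
        linarith
    _ = r * t := by field_simp

theorem tendsto_div_two_pow (t : ℝ≥0) : Tendsto (fun n : ℕ => t / 2 ^ n) atTop (𝓝 0) := by
  have := (tendsto_pow_atTop_nhds_zero_of_lt_one (r := (1 / 2 : ℝ≥0)) zero_le
    (by rw [← NNReal.coe_lt_coe]; norm_num)).const_mul t
  rw [mul_zero] at this
  refine this.congr fun n => ?_
  rw [one_div, inv_pow, div_eq_mul_inv]

section Excess

variable {b σ r : ℝ} {Λ ν : Measure ℝ}

theorem isWeaklyExcessive_of_density (hΛ : IsLevyMeasure Λ) {w : ℝ → ℝ}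
    (hwc : Continuous w) (hw0 : ∀ x, 0 ≤ w x) (hwi : Integrable w) (hw : ContDiffOn ℝ 2 w (Ioi 0))
    (hv : ∀ x, x ≤ 0 → w x = 0) (hi : ∀ x, 0 < x → Integrable (adjointJumpIntegrand w x) Λ)
    (heq : ∀ x, 0 < x → adjointGenerator b σ Λ w x + r * w x = 0)
    (hwd : ν = volume.withDensity (fun x => ENNReal.ofReal (w x))) :
    IsWeaklyExcessive b σ Λ ν r := by
  intro f hf hfc hf0
  rw [integral_density hwc.measurable hw0 hwd, integral_density hwc.measurable hw0 hwd]
  exact integral_mul_levyGenerator_add_nonneg hΛ hwc hw0 hwi hw hv hi heq hf hfc hf0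

theorem isWeaklyInvariant_of_density (hΛ : IsLevyMeasure Λ) {w : ℝ → ℝ}
    (hwc : Continuous w) (hw0 : ∀ x, 0 ≤ w x) (hwi : Integrable w) (hw : ContDiffOn ℝ 2 w (Ioi 0))
    (heq : ∀ x, 0 < x → adjointGenerator b σ Λ w x + r * w x = 0)
    (hwd : ν = volume.withDensity (fun x => ENNReal.ofReal (w x))) :
    IsWeaklyInvariant b σ Λ ν r := by
  intro f hf hfc hfU
  rw [integral_density hwc.measurable hw0 hwd, integral_density hwc.measurable hw0 hwd]
  obtain ⟨i1, e1⟩ := integral_mul_levyGenerator hΛ b σ isOpen_Ioi hwi hwc hw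
    (contDiff_infty.1 hf 2) hfc hfU
  have i2 : Integrable fun x => w x * f x :=
    (hwc.mul hf.continuous).integrable_of_hasCompactSupport hfc.mul_left
  rw [e1, ← integral_const_mul, ← integral_add i1 (i2.const_mul r)]
  refine integral_eq_zero_of_ae (ae_of_all _ fun x => ?_)
  by_cases hx : 0 < x
  · have := heq x hx
    simp only [Pi.zero_apply]
    linear_combination f x * this
  · have : f x = 0 := image_eq_zero_of_notMem_tsupport fun h => hx (hfU h)
    simp [this]

/-- The weak form identifies `∫ f dμ` with an expression that vanishes for test functions supported
in `(0, ∞)`; bumps above compact sets then show that `μ` has no mass there. -/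
theorem IsWeaklyInvariant.exitMeasure_Ioi_eq_zero [IsFiniteMeasure ν]
    (hν : IsWeaklyInvariant b σ Λ ν r) (hΛ : IsLevyMeasure Λ) {μ : Measure ℝ} [IsFiniteMeasure μ]
    (hchar : ∀ ξ, charFun μ ξ = charFun ν ξ * (levyExponent b σ Λ ξ + r)) : μ (Ioi 0) = 0 := by
  rw [isOpen_Ioi.measure_eq_iSup_isCompact]
  simp only [ENNReal.iSup_eq_zero]
  intro K hK0 hK
  obtain ⟨f, hf, hfc, hfU, hf0, hf1, -⟩ := exists_smooth_between hK isOpen_Ioi hK0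
  have h1 := integral_levyGenerator_add hΛ hchar hf hfc
  rw [hν f hf hfc hfU] at h1
  have h2 : μ.real K ≤ ∫ x, f x ∂μ := by
    rw [← integral_indicator_one hK.measurableSet]
    refine integral_mono ((integrable_const (1 : ℝ)).indicator hK.measurableSet)
      (hf.continuous.integrable_of_hasCompactSupport hfc) fun x => ?_
    by_cases hx : x ∈ K
    · rw [indicator_of_mem hx]; exact hf1 x hx
    · rw [indicator_of_notMem hx]; exact hf0 x
  rw [← h1] at h2
  exact (measureReal_eq_zero_iff (measure_ne_top _ _)).1 (le_antisymm h2 measureReal_nonneg)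

/-- The normalized excess converges to a measure carried by `(-∞, 0]`, so its mass on the closed set
`[δ, ∞)` tends to zero, while the normalizations sum to at most `r t`. -/
theorem IsSubinvariant.tendsto_excess_Ioi {p : ℝ≥0 → Measure ℝ} [IsProbabilityMeasure ν]
    (hs : IsSubinvariant p ν r) (hν : IsWeaklyInvariant b σ Λ ν r) (hp : IsLevySemigroup p b σ Λ)
    (hΛ : IsLevyMeasure Λ) (hσ : 0 < σ) {t : ℝ≥0} (ht : 0 < t) {δ : ℝ} (hδ : 0 < δ) :
    Tendsto (fun n : ℕ => (2 : ℝ≥0∞) ^ n * excess p ν r (t / 2 ^ n) (Ioi δ)) atTop (𝓝 0) := by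
  have hr : 0 < r := hs.rate_pos hp hΛ hσ
  have ht2 : ∀ n : ℕ, 0 < t / 2 ^ n := fun n => by positivity
  have ht0 := tendsto_div_two_pow t
  obtain ⟨M, μ, hM, hMμ, hchar⟩ := hs.exists_tendsto_excess hp hΛ hσ ht2 ht0
  have hrc : (r : ℂ) ≠ 0 := Complex.ofReal_ne_zero.2 hr.ne'
  have hμ0 : (μ : Measure ℝ) (Ioi 0) = 0 := by
    have hfin : IsFiniteMeasure (ENNReal.ofReal r • (μ : Measure ℝ)) :=
      Measure.smul_finite _ ENNReal.ofReal_ne_top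
    have h := hν.exitMeasure_Ioi_eq_zero hΛ (μ := ENNReal.ofReal r • (μ : Measure ℝ))
      (fun ξ => by
        rw [charFun_smul_measure, hchar, ENNReal.toReal_ofReal hr.le]
        field_simp)
    rw [Measure.smul_apply, smul_eq_mul, mul_eq_zero] at h
    exact h.resolve_left (ENNReal.ofReal_pos.2 hr).ne'
  have hlim : Tendsto (fun n => (M n : Measure ℝ) (Ici δ)) atTop (𝓝 0) := by
    refine tendsto_of_le_liminf_of_limsup_le zero_le ?_
    refine (ProbabilityMeasure.limsup_measure_closed_le_of_tendsto hMμ isClosed_Ici).trans ?_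
    rw [← hμ0]
    exact measure_mono fun x hx => hδ.trans_le hx
  have hlim' := ENNReal.Tendsto.const_mul hlim (a := ENNReal.ofReal (r * t))
    (Or.inr ENNReal.ofReal_ne_top)
  rw [mul_zero] at hlim'
  refine tendsto_of_tendsto_of_tendsto_of_le_of_le tendsto_const_nhds hlim' (fun n => zero_le)
    fun n => ?_
  have hlt : Real.exp (-r * (t / 2 ^ n : ℝ≥0)) < 1 := by
    rw [Real.exp_lt_one_iff]
    have : (0 : ℝ) < (t / 2 ^ n : ℝ≥0) := ht2 n
    nlinarith
  set e := ENNReal.ofReal (1 - Real.exp (-r * (t / 2 ^ n : ℝ≥0))) with he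
  have he0 : e ≠ 0 := (ENNReal.ofReal_pos.2 (by linarith)).ne'
  have h1 : excess p ν r (t / 2 ^ n) (Ioi δ) = e * (M n : Measure ℝ) (Ioi δ) := by
    rw [hM, Measure.smul_apply, smul_eq_mul, ← mul_assoc,
      ENNReal.mul_inv_cancel he0 ENNReal.ofReal_ne_top, one_mul]
  have h2 : (2 : ℝ≥0∞) ^ n * e ≤ ENNReal.ofReal (r * t) := two_pow_mul_one_sub_exp_le r t n
  rw [h1, ← mul_assoc]
  exact mul_le_mul' h2 (measure_mono Ioi_subset_Ici_self)

end Excess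

/-! ### Paths started near the origin become negative immediately. -/

section SmallTimes

variable {b σ : ℝ} {Λ : Measure ℝ} {p : ℝ≥0 → Measure ℝ}

/-- By the central limit theorem at small times, the process is negative with a probability that
is bounded below. -/
theorem IsLevySemigroup.exists_eventually_lt_measureReal_Iio (hp : IsLevySemigroup p b σ Λ)
    (hΛ : IsLevyMeasure Λ) (hσ : 0 < σ) {t : ℕ → ℝ≥0} (ht : ∀ n, 0 < t n)
    (ht0 : Tendsto t atTop (𝓝 0)) :
    ∃ q : ℝ, 0 < q ∧ q < 1 ∧ ∀ᶠ n in atTop, q < (p (t n)).real (Iio 0) := by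
  have hpr := hp.prob
  set s : ℕ → ℝ := fun n => Real.sqrt (t n) with hs
  have hs0 : ∀ n, 0 < s n := fun n => Real.sqrt_pos.2 (ht n)
  have hslim : Tendsto s atTop (𝓝[>] 0) := by
    refine tendsto_nhdsWithin_iff.2 ⟨?_, Eventually.of_forall hs0⟩
    have := (Real.continuous_sqrt.tendsto 0).comp (NNReal.tendsto_coe.2 ht0)
    rw [Real.sqrt_zero] at this
    exact this
  set M : ℕ → ProbabilityMeasure ℝ := fun n => ⟨(p (t n)).map ((s n)⁻¹ * ·),
    Measure.isProbabilityMeasure_map (by fun_prop)⟩ with hM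
  set G : ProbabilityMeasure ℝ := ⟨gaussianReal 0 (σ ^ 2).toNNReal, inferInstance⟩ with hG
  -- At scale `√t` the exponent `t Ψ (ξ / √t)` retains only its Gaussian part. The limit law charges
  -- the open half-line, and rescaling does not change the sign.
  have hlim : Tendsto M atTop (𝓝 G) := by
    refine ProbabilityMeasure.tendsto_iff_tendsto_charFun.2 fun ξ => ?_
    have h1 := ((tendsto_levyExponent_div_sq hΛ b σ ξ).comp hslim).cexp
    have h2 : Complex.exp (-((σ : ℂ) ^ 2 * (ξ : ℂ) ^ 2 / 2)) = charFun (G : Measure ℝ) ξ := by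
      change _ = charFun (gaussianReal 0 (σ ^ 2).toNNReal) ξ
      rw [charFun_gaussianReal]
      congr 1
      have hv : (((σ ^ 2).toNNReal : ℝ) : ℂ) = (σ : ℂ) ^ 2 := by
        rw [Real.coe_toNNReal _ (sq_nonneg σ), Complex.ofReal_pow]
      rw [hv]
      simp
    rw [h2] at h1
    refine h1.congr fun n => ?_
    change _ = charFun ((p (t n)).map ((s n)⁻¹ * ·)) ξ
    rw [charFun_map_mul, hp.charFun_eq]
    simp only [Function.comp, hs]
    rw [Real.sq_sqrt (t n).coe_nonneg, div_eq_inv_mul]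
  have hpos : 0 < (G : Measure ℝ) (Iio 0) := by
    refine pos_iff_ne_zero.2 fun h => ?_
    have hv : (σ ^ 2).toNNReal ≠ 0 :=
      (Real.toNNReal_pos.2 (by positivity)).ne'
    have := gaussianReal_absolutelyContinuous' 0 hv h
    simp at this
  have hle := ProbabilityMeasure.le_liminf_measure_open_of_tendsto hlim (isOpen_Iio (a := (0 : ℝ)))
  obtain ⟨q, hq0, hq⟩ := ENNReal.lt_iff_exists_nnreal_btwn.1 (hpos.trans_le hle)
  have hq0' : (0 : ℝ≥0) < q := by exact_mod_cast hq0
  have hev := eventually_lt_of_lt_liminf hq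
  have hev' : ∀ᶠ n in atTop, (q : ℝ) < (p (t n)).real (Iio 0) := by
    filter_upwards [hev] with n hn
    have h1 : (M n : Measure ℝ) (Iio 0) = (p (t n)) (Iio 0) := by
      change ((p (t n)).map ((s n)⁻¹ * ·)) (Iio 0) = _
      rw [Measure.map_apply (by fun_prop) measurableSet_Iio]
      congr 1
      ext x
      have := inv_pos.2 (hs0 n)
      simp only [mem_preimage, mem_Iio]
      constructor
      · intro h; by_contra hx; exact absurd h (not_lt.2 (mul_nonneg this.le (not_lt.1 hx)))
      · intro h; exact mul_neg_of_pos_of_neg this h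
    rw [h1] at hn
    have := (ENNReal.toReal_lt_toReal ENNReal.coe_ne_top (measure_ne_top _ _)).2 hn
    exact this
  refine ⟨q, hq0', ?_, hev'⟩
  obtain ⟨n, hn⟩ := hev'.exists
  exact hn.trans_le measureReal_le_one

end SmallTimes

section Lacunary

variable {Ω : Type*} [MeasurableSpace Ω] {P : Measure Ω} {Y : ℝ≥0 → Ω → ℝ} {b σ : ℝ}
  {Λ : Measure ℝ}

/-- The event that a path stays above `-δ` at the first `m` times of a sequence. -/
def staysAbove (Y : ℝ≥0 → Ω → ℝ) (u : ℕ → ℝ≥0) (m : ℕ) (δ : ℝ) : Set Ω :=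
  {ω | ∀ j, 1 ≤ j → j ≤ m → -δ < Y (u j) ω}

theorem IsLevyProcess.measureReal_staysAbove_inter [IsProbabilityMeasure P]
    (hY : IsLevyProcess Y P) {u : ℕ → ℝ≥0} (hu : Monotone u) (h0 : u 0 = 0) (m : ℕ) (δ c : ℝ) :
    P.real (staysAbove Y u m δ ∩ {ω | c < Y (u (m + 1)) ω - Y (u m) ω}) =
      P.real (staysAbove Y u m δ) * P.real {ω | c < Y (u (m + 1)) ω - Y (u m) ω} := by
  have hm := hY.measurable
  set V : Ω → Fin (m + 1) → ℝ := fun ω j => Y (u j) ω with hV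
  set D : Ω → ℝ := fun ω => Y (u (m + 1)) ω - Y (u m) ω with hD
  have hVm : Measurable V := measurable_pi_lambda _ fun j => hm _
  have hDm : Measurable D := (hm _).sub (hm _)
  have h1 := hY.map_past_increment hu h0 m
  have h2 : P.map D = P.map (Y (u (m + 1) - u m)) := by
    have := (hY.stationary_increments (u m) (u (m + 1) - u m)).map_eq
    rwa [add_tsub_cancel_of_le (hu (Nat.le_succ m))] at this
  rw [← h2] at h1
  have hind : IndepFun V D P :=
    (indepFun_iff_map_prod_eq_prod_map_map hVm.aemeasurable hDm.aemeasurable).2 h1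
  set E : Set (Fin (m + 1) → ℝ) := {z | ∀ j : Fin (m + 1), 1 ≤ (j : ℕ) → -δ < z j} with hE
  have hEm : MeasurableSet E := by
    have : E = ⋂ (j : Fin (m + 1)) (_ : 1 ≤ (j : ℕ)), {z | -δ < z j} := by
      ext z; simp [hE]
    rw [this]
    refine MeasurableSet.iInter fun j => MeasurableSet.iInter fun _ => ?_
    exact measurableSet_lt measurable_const (by fun_prop)
  have hVE : V ⁻¹' E = staysAbove Y u m δ := by
    ext ω
    simp only [hE, hV, staysAbove, mem_preimage, mem_ofPred_eq]
    constructor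
    · intro h j h1 h2
      exact h ⟨j, by omega⟩ h1
    · intro h j h1
      exact h j h1 (by have := j.2; omega)
  have := hind.measure_inter_preimage_eq_mul E (Ioi c) hEm measurableSet_Ioi
  rw [hVE] at this
  simp only [Measure.real]
  rw [← ENNReal.toReal_mul]
  exact congrArg ENNReal.toReal this

/-- A Lévy process with a Gaussian component does not stay positive along small dyadic times. -/
theorem IsLevyProcess.exists_staysAbove_le [IsProbabilityMeasure P] (hY : IsLevyProcess Y P)
    (hΛ : IsLevyMeasure Λ) (hT : HasLevyTriplet Y P b σ Λ) (hσ : 0 < σ) {t : ℝ≥0} (ht : 0 < t) :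
    ∃ a : ℝ, 0 < a ∧ a < 1 ∧ ∀ k : ℕ, ∀ s₀ : ℝ≥0, 0 < s₀ → ∃ (u : ℕ → ℝ≥0) (m : ℕ) (δ : ℝ),
      0 < δ ∧ Monotone u ∧ u 0 = 0 ∧ (∀ j, 1 ≤ j → j ≤ m → ∃ i : ℕ, u j = t / 2 ^ i) ∧
      u m ≤ s₀ ∧ P.real (staysAbove Y u m δ) ≤ a ^ k := by
  have hm := hY.measurable
  have hp := isLevySemigroup_map hm hT
  have hmap : ∀ (s : ℝ≥0) {B : Set ℝ}, MeasurableSet B → (P.map (Y s)).real B = P.real (Y s ⁻¹' B) :=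
    fun s B hB => by simp only [Measure.real]; rw [Measure.map_apply (hm s) hB]
  have ht2 : ∀ n : ℕ, 0 < t / 2 ^ n := fun n => by positivity
  have ht0 := tendsto_div_two_pow t
  obtain ⟨q, hq0, hq1, hq⟩ := hp.exists_eventually_lt_measureReal_Iio hΛ hσ ht2 ht0
  -- One more time gives a survival factor near `1 - q`; half of `q` is sacrificed to the errors due
  -- to dependence. All dyadic times are chosen very far apart, so that successive positions are
  -- almost independent.
  refine ⟨1 - q / 2, by linarith, by linarith, fun k => ?_⟩
  have ha0 : 0 < 1 - q / 2 := by linarith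
  induction k with
  | zero =>
    intro s₀ hs₀
    refine ⟨fun _ => 0, 0, 1, one_pos, monotone_const, rfl, fun j h1 h2 => by omega, zero_le, ?_⟩
    rw [pow_zero]
    exact measureReal_le_one
  | succ k ih =>
    intro s₀ hs₀
    obtain ⟨i, hi, his⟩ := (hq.and (ht0.eventually (ge_mem_nhds hs₀))).exists
    set T := t / 2 ^ i with hTdef
    rw [hmap _ measurableSet_Iio] at hi
    -- The margin `3 L` lets a displacement of at most `L` at the earlier times be ignored twice:
    -- once when the position at `T` is replaced by an increment, once when it is recovered.
    obtain ⟨L, hL, hLq⟩ : ∃ L : ℝ, 0 < L ∧ q < P.real {ω | Y T ω ≤ -(3 * L)} := by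
      have hun : Y T ⁻¹' Iio 0 = ⋃ n : ℕ, {ω | Y T ω ≤ -(3 * (1 / ((n : ℝ) + 1)))} := by
        ext ω
        simp only [mem_preimage, mem_Iio, mem_iUnion, mem_ofPred_eq]
        constructor
        · intro h
          obtain ⟨n, hn⟩ := exists_nat_one_div_lt (show 0 < -(Y T ω) / 3 by linarith)
          exact ⟨n, by linarith⟩
        · rintro ⟨n, hn⟩
          have : (0 : ℝ) < 1 / ((n : ℝ) + 1) := by positivity
          linarith
      have hmono : Monotone fun n : ℕ => {ω | Y T ω ≤ -(3 * (1 / ((n : ℝ) + 1)))} := by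
        intro n n' hn ω (hω : Y T ω ≤ _)
        refine hω.trans ?_
        have := one_div_le_one_div_of_le (by positivity : (0 : ℝ) < n + 1)
          (by exact_mod_cast Nat.succ_le_succ hn : (n : ℝ) + 1 ≤ n' + 1)
        linarith
      have hlim := (ENNReal.tendsto_toReal (measure_ne_top P _)).comp
        (tendsto_measure_iUnion_atTop (μ := P) hmono)
      rw [← hun] at hlim
      obtain ⟨n, hn⟩ := (hlim.eventually (lt_mem_nhds hi)).exists
      exact ⟨1 / ((n : ℝ) + 1), by positivity, hn⟩
    obtain ⟨C, hC0, hC⟩ := hp.exists_measureReal_abs_gt_le hΛ hL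
    have habs : ∀ s : ℝ≥0, P.real {ω | L < |Y s ω|} ≤ C * s := fun s => by
      have := hC s
      rwa [hmap _ (measurableSet_lt measurable_const (by fun_prop))] at this
    -- The earlier times are taken below `η`, so that moving by more than `L` before `u m` has
    -- probability at most a quarter of `q` times the target `(1 - q / 2) ^ k`.
    set η : ℝ := (1 - q / 2) ^ k * (q / 4) / (C + 1) with hη
    have hη0 : 0 < η := by positivity
    obtain ⟨u, m, δ, hδ, hu, hu0, hdy, hum, hP⟩ := ih (min T η.toNNReal)
      (lt_min (ht2 i) (Real.toNNReal_pos.2 hη0))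
    have humT : u m ≤ T := hum.trans (min_le_left _ _)
    have humη : (u m : ℝ) ≤ η := by
      have := hum.trans (min_le_right _ _)
      rwa [← NNReal.coe_le_coe, Real.coe_toNNReal _ hη0.le] at this
    have hCu : C * u m ≤ (1 - q / 2) ^ k * (q / 4) := by
      calc C * u m ≤ (C + 1) * η := by gcongr; linarith
        _ = _ := by rw [hη]; field_simp
    set u' : ℕ → ℝ≥0 := fun j => if j ≤ m then u j else T with hu'
    have hu'm : ∀ j, j ≤ m → u' j = u j := fun j hj => if_pos hj
    have hu'T : u' (m + 1) = T := if_neg (by omega)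
    have hmono' : Monotone u' := by
      intro j j' hj
      simp only [hu']
      split_ifs with h1 h2 h2
      · exact hu hj
      · exact (hu h1).trans humT
      · omega
      · exact le_rfl
    refine ⟨u', m + 1, min δ L, lt_min hδ hL, hmono', by rw [hu'm 0 (Nat.zero_le _), hu0],
      fun j h1 h2 => ?_, by rw [hu'T]; exact his, ?_⟩
    · rcases Nat.lt_or_ge m j with h | h
      · exact ⟨i, if_neg (by omega)⟩
      · rw [hu'm j h]; exact hdy j h1 h
    have hA : staysAbove Y u' m δ = staysAbove Y u m δ := by
      ext ω
      simp only [staysAbove, mem_ofPred_eq]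
      exact forall₃_congr fun j _ h2 => by rw [hu'm j h2]
    set A := staysAbove Y u m δ with hAdef
    set Dset := {ω | -(2 * L) < Y (u' (m + 1)) ω - Y (u' m) ω} with hDdef
    set Bad := {ω | L < |Y (u m) ω|} with hBad
    -- If `Y` at `u m` is at most `L` and at `T` is above `-L`, the increment exceeds `-2 L`; this
    -- event is independent of the past. Two errors of size `q / 4` then give `1 - q + q / 4 + q / 4
    -- = 1 - q / 2`.
    have hsub : staysAbove Y u' (m + 1) (min δ L) ⊆ (A ∩ Dset) ∪ Bad := by
      intro ω hω
      by_cases hb : L < |Y (u m) ω|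
      · exact Or.inr hb
      · refine Or.inl ⟨?_, ?_⟩
        · rw [← hA]
          intro j h1 h2
          exact lt_of_le_of_lt (neg_le_neg (min_le_left _ _)) (hω j h1 (by omega))
        · have h1 := hω (m + 1) (by omega) le_rfl
          have h2 := (abs_le.1 (not_lt.1 hb)).2
          have h3 := min_le_right δ L
          simp only [hDdef, mem_ofPred_eq]
          rw [hu'm m le_rfl]
          linarith
    have hDle : P.real Dset ≤ (1 - q) + C * u m := by
      have hsub2 : Dset ⊆ {ω | Y T ω ≤ -(3 * L)}ᶜ ∪ Bad := by
        intro ω hω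
        by_cases hb : L < |Y (u m) ω|
        · exact Or.inr hb
        · refine Or.inl fun (h : Y T ω ≤ -(3 * L)) => ?_
          have h2 := (abs_le.1 (not_lt.1 hb)).1
          have h1 : -(2 * L) < Y (u' (m + 1)) ω - Y (u' m) ω := hω
          rw [hu'm m le_rfl, hu'T] at h1
          linarith
      refine (measureReal_mono hsub2).trans ((measureReal_union_le _ _).trans ?_)
      refine add_le_add ?_ (habs (u m))
      rw [probReal_compl_eq_one_sub (measurableSet_le (hm T) measurable_const)]
      linarith
    have hind := hY.measureReal_staysAbove_inter hmono' (by rw [hu'm 0 (Nat.zero_le _), hu0]) m δ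
      (-(2 * L))
    rw [hA] at hind
    have hPA0 : 0 ≤ P.real A := measureReal_nonneg
    have hPD0 : 0 ≤ P.real Dset := measureReal_nonneg
    have hapow1 : (1 - q / 2) ^ k ≤ 1 := pow_le_one₀ ha0.le (by linarith)
    calc P.real (staysAbove Y u' (m + 1) (min δ L)) ≤ P.real ((A ∩ Dset) ∪ Bad) :=
          measureReal_mono hsub
      _ ≤ P.real (A ∩ Dset) + P.real Bad := measureReal_union_le _ _
      _ ≤ P.real A * P.real Dset + C * u m := add_le_add hind.le (habs (u m))
      _ ≤ (1 - q / 2) ^ k * ((1 - q) + C * u m) + C * u m := by gcongr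
      _ ≤ (1 - q / 2) ^ k * ((1 - q) + q / 4) + (1 - q / 2) ^ k * (q / 4) := by
          gcongr
          refine hCu.trans (mul_le_of_le_one_left (by linarith) hapow1)
      _ = (1 - q / 2) ^ (k + 1) := by ring

end Lacunary

/-! ### Wave profiles are quasi-stationary: summing the errors of the killed steps. -/

section LinearKilling

variable {q ν ε : Measure ℝ} {a : ℝ≥0∞}

theorem iterate_killedStep_smul_add [IsFiniteMeasure q] [IsFiniteMeasure ν] [IsFiniteMeasure ε]
    (ha : a ≠ ⊤) (m : ℕ) :
    (killedStep q)^[m] (a • ν + ε) = a • (killedStep q)^[m] ν + (killedStep q)^[m] ε := by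
  induction m with
  | zero => rfl
  | succ m ih =>
    have h1 := isFiniteMeasure_iterate_killedStep q ν m
    have h2 := isFiniteMeasure_iterate_killedStep q ε m
    have h3 : IsFiniteMeasure (a • (killedStep q)^[m] ν) := Measure.smul_finite _ ha
    rw [Function.iterate_succ_apply', Function.iterate_succ_apply', Function.iterate_succ_apply',
      ih]
    generalize (killedStep q)^[m] ν = ν' at *
    generalize (killedStep q)^[m] ε = ε' at *
    unfold killedStep
    rw [Measure.add_conv, Measure.conv_smul_left, Measure.restrict_add, Measure.restrict_smul]

/-- Iterating a perturbed eigenvalue relation. -/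
theorem iterate_killedStep_apply_bounds [IsFiniteMeasure q] [IsFiniteMeasure ν]
    [IsFiniteMeasure ε] (ha : a ≤ 1) (h : killedStep q ν = a • ν + ε) (m : ℕ) (A : Set ℝ) :
    a ^ m * ν A ≤ (killedStep q)^[m] ν A ∧
      (killedStep q)^[m] ν A ≤ a ^ m * ν A +
        ∑ i ∈ Finset.range m, (killedStep q)^[i] ε univ := by
  induction m with
  | zero => simp
  | succ m ih =>
    rw [Function.iterate_succ_apply, h,
      iterate_killedStep_smul_add (ne_top_of_le_ne_top ENNReal.one_ne_top ha), Measure.add_apply,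
      Measure.smul_apply, smul_eq_mul, Finset.sum_range_succ, pow_succ']
    constructor
    · rw [mul_assoc]
      exact le_add_right (by gcongr; exact ih.1)
    · rw [← add_assoc]
      refine add_le_add ?_ (measure_mono (subset_univ A))
      calc a * (killedStep q)^[m] ν A
          ≤ a * (a ^ m * ν A + ∑ i ∈ Finset.range m, (killedStep q)^[i] ε univ) := by
            gcongr; exact ih.2
        _ = a * a ^ m * ν A + a * ∑ i ∈ Finset.range m, (killedStep q)^[i] ε univ := by ring
        _ ≤ _ := by gcongr; exact mul_le_of_le_one_left zero_le ha

end LinearKilling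

section WaveToQuasiStationary

variable {Ω : Type*} [MeasurableSpace Ω] {P : Measure Ω} [IsProbabilityMeasure P]
  {Y : ℝ≥0 → Ω → ℝ} {b σ r : ℝ} {Λ ν : Measure ℝ}

theorem IsLevyProcess.iterate_killedStep_univ_le (hY : IsLevyProcess Y P) (ε : Measure ℝ)
    [IsFiniteMeasure ε] (h : ℝ≥0) (k : ℕ) :
    (killedStep (P.map (Y h)))^[k] ε univ ≤ ε univ := by
  have hX : Measurable (fun q : ℝ × Ω => q.1 + Y (k * h) q.2) :=
    measurable_fst.add ((hY.measurable _).comp measurable_snd)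
  rw [hY.iterate_killedStep_eq ε h k, Measure.map_apply hX MeasurableSet.univ, preimage_univ]
  refine (Measure.restrict_apply_le _ _).trans ?_
  rw [← univ_prod_univ, Measure.prod_prod, measure_univ (μ := P), mul_one]

/-- Mass started near `0` survives only if the path stays above `-δ`. -/
theorem IsLevyProcess.iterate_killedStep_univ_le_staysAbove (hY : IsLevyProcess Y P)
    (ε : Measure ℝ) [IsFiniteMeasure ε] (h : ℝ≥0) (k : ℕ) {u : ℕ → ℝ≥0} {m : ℕ} (δ : ℝ)
    (hu : ∀ j, 1 ≤ j → j ≤ m → ∃ l : ℕ, 1 ≤ l ∧ l ≤ k ∧ u j = l * h) :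
    (killedStep (P.map (Y h)))^[k] ε univ ≤
      ε (Ioi δ) + ε univ * P (staysAbove Y u m δ) := by
  have hX : Measurable (fun q : ℝ × Ω => q.1 + Y (k * h) q.2) :=
    measurable_fst.add ((hY.measurable _).comp measurable_snd)
  rw [hY.iterate_killedStep_eq ε h k, Measure.map_apply hX MeasurableSet.univ, preimage_univ,
    Measure.restrict_apply_univ]
  have hsub : positiveAt Y (fun j => j * h) k ⊆ Ioi δ ×ˢ univ ∪ univ ×ˢ staysAbove Y u m δ := by
    intro z hz
    rcases lt_or_ge δ z.1 with hx | hx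
    · exact Or.inl ⟨hx, trivial⟩
    · refine Or.inr ⟨trivial, fun j h1 h2 => ?_⟩
      obtain ⟨l, hl1, hl2, hl⟩ := hu j h1 h2
      have : 0 < z.1 + Y (l * h) z.2 := hz l hl1 hl2
      rw [hl]
      linarith
  refine (measure_mono hsub).trans ((measure_union_le _ _).trans ?_)
  rw [Measure.prod_prod, Measure.prod_prod, measure_univ (μ := P), mul_one]

/-- An exact eigenvalue relation with a nonnegative error, the part of the excess that lands in `(0,
∞)`; the part landing in `(-∞, 0]` is precisely what a step kills. -/
theorem IsSubinvariant.killedStep_eq {p : ℝ≥0 → Measure ℝ} [IsProbabilityMeasure ν]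
    (hs : IsSubinvariant p ν r) (hp : IsLevySemigroup p b σ Λ) (hν0 : ν (Iic 0) = 0) {h : ℝ≥0}
    (hh : 0 < h) :
    killedStep (p h) ν =
      ENNReal.ofReal (Real.exp (-r * h)) • ν + (excess p ν r h).restrict (Ioi 0) := by
  have h1 : ν.restrict (Ioi 0) = ν := by
    refine Measure.restrict_eq_self_of_ae_mem ?_
    rw [ae_iff]
    convert! hν0 using 2
    ext x
    simp
  unfold killedStep
  rw [← hs.excess_add hp hh, Measure.restrict_add, Measure.restrict_smul, h1, add_comm]

/-- The total mass produced by the excess before the time horizon is negligible. -/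
theorem IsLevyProcess.tendsto_sum_excess (hY : IsLevyProcess Y P) (hΛ : IsLevyMeasure Λ)
    (hT : HasLevyTriplet Y P b σ Λ) (hσ : 0 < σ) [IsProbabilityMeasure ν]
    (hs : IsSubinvariant (fun t => P.map (Y t)) ν r) (hν : IsWeaklyInvariant b σ Λ ν r)
    {t : ℝ≥0} (ht : 0 < t) :
    Tendsto (fun n : ℕ => ∑ i ∈ Finset.range (2 ^ n), (killedStep (P.map (Y (t / 2 ^ n))))^[i]
      ((excess (fun t => P.map (Y t)) ν r (t / 2 ^ n)).restrict (Ioi 0)) univ) atTop (𝓝 0) := by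
  have hm := hY.measurable
  have hp := isLevySemigroup_map hm hT
  obtain ⟨a, ha0, ha1, hlac⟩ := hY.exists_staysAbove_le hΛ hT hσ ht
  set R := ENNReal.ofReal (r * t) with hR
  rw [ENNReal.tendsto_nhds_zero]
  intro e he
  have he3 : 0 < e / 3 := ENNReal.div_pos he.ne' (by norm_num)
  have hpow : ∀ {x : ℝ≥0∞}, x < 1 → ∃ k : ℕ, R * x ^ k ≤ e / 3 := fun {x} hx => by
    have h1 := ENNReal.Tendsto.const_mul (ENNReal.tendsto_pow_atTop_nhds_zero_of_lt_one hx)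
      (a := R) (Or.inr ENNReal.ofReal_ne_top)
    rw [mul_zero] at h1
    exact (h1.eventually (ge_mem_nhds he3)).exists
  -- Three thirds: `l` makes the iterates before time `t / 2 ^ l` few enough, `k` makes survival
  -- from near `0` unlikely after that time, and mass starting above `δ` is negligible by
  -- `IsSubinvariant.tendsto_excess_Ioi`.
  obtain ⟨l, hl⟩ := hpow (x := 2⁻¹) (by norm_num)
  obtain ⟨k, hk⟩ := hpow (x := ENNReal.ofReal a) (ENNReal.ofReal_lt_one.2 ha1)
  obtain ⟨u, m, δ, hδ, hu, hu0, hdy, hum, hP⟩ := hlac k (t / 2 ^ l) (by positivity)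
  have hP' : P (staysAbove Y u m δ) ≤ ENNReal.ofReal a ^ k := by
    rw [← ENNReal.ofReal_pow ha0.le, ← ofReal_measureReal]
    exact ENNReal.ofReal_le_ofReal hP
  -- The finitely many dyadic test times lie on every sufficiently fine grid, so surviving on the
  -- grid forces staying above `-δ` at those times.
  have hgrid : ∀ᶠ n : ℕ in atTop, ∀ j ∈ Finset.Icc 1 m, ∃ i ≤ n, u j = t / 2 ^ i := by
    refine (Filter.eventually_all_finset _).2 fun j hj => ?_
    obtain ⟨i, hi⟩ := hdy j (Finset.mem_Icc.1 hj).1 (Finset.mem_Icc.1 hj).2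
    filter_upwards [eventually_ge_atTop i] with n hn using ⟨i, hn, hi⟩
  have hex := (hs.tendsto_excess_Ioi hν hp hΛ hσ ht hδ).eventually (ge_mem_nhds he3)
  filter_upwards [hgrid, hex, eventually_ge_atTop l] with n hn1 hn2 hn3
  set h : ℝ≥0 := t / 2 ^ n with hh
  have hh0 : 0 < h := by positivity
  set κ := excess (fun t => P.map (Y t)) ν r h with hκ
  have hκf : IsFiniteMeasure κ := isFiniteMeasure_excess hp r h
  set ε := κ.restrict (Ioi 0) with hε
  have hdyad : ∀ i ≤ n, t / 2 ^ i = ((2 ^ (n - i) : ℕ) : ℝ≥0) * h := fun i hi => by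
    have h2 : (2 : ℝ≥0) ^ n = 2 ^ i * 2 ^ (n - i) := by rw [← pow_add, Nat.add_sub_cancel' hi]
    rw [hh, h2]
    push_cast
    field_simp
  have hεu : (2 : ℝ≥0∞) ^ n * ε univ ≤ R := by
    refine le_trans ?_ (two_pow_mul_one_sub_exp_le r t n)
    gcongr
    refine (Measure.restrict_apply_le _ _).trans ?_
    rw [hκ, hs.excess_univ hp hh0]
  have hεδ : ε (Ioi δ) ≤ κ (Ioi δ) := Measure.restrict_apply_le _ _
  set η := ENNReal.ofReal a ^ k with hη
  have hterm : ∀ i ∈ Finset.range (2 ^ n), (killedStep (P.map (Y h)))^[i] ε univ ≤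
      (if i < 2 ^ (n - l) then ε univ else 0) + (κ (Ioi δ) + ε univ * η) := by
    intro i _
    split_ifs with hi
    · exact le_add_right (hY.iterate_killedStep_univ_le ε h i)
    · rw [zero_add]
      refine (hY.iterate_killedStep_univ_le_staysAbove ε h i δ (u := u) (m := m)
        fun j h1 h2 => ?_).trans (add_le_add hεδ (by gcongr))
      obtain ⟨i', hi', hui⟩ := hn1 j (Finset.mem_Icc.2 ⟨h1, h2⟩)
      refine ⟨2 ^ (n - i'), Nat.one_le_two_pow, le_trans ?_ (not_lt.1 hi), by
        rw [hui, hdyad i' hi']⟩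
      have h3 : ((2 ^ (n - i') : ℕ) : ℝ≥0) * h ≤ ((2 ^ (n - l) : ℕ) : ℝ≥0) * h := by
        rw [← hdyad i' hi', ← hdyad l hn3, ← hui]
        exact (hu h2).trans hum
      exact_mod_cast le_of_mul_le_mul_right h3 hh0
  refine (Finset.sum_le_sum hterm).trans ?_
  rw [Finset.sum_add_distrib, Finset.sum_const, Finset.card_range, ← Finset.sum_filter,
    Finset.sum_const, nsmul_eq_mul, nsmul_eq_mul]
  have hcard : (((Finset.range (2 ^ n)).filter (· < 2 ^ (n - l))).card : ℝ≥0∞) ≤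
      2 ^ (n - l) := by
    have h4 : ((Finset.range (2 ^ n)).filter (· < 2 ^ (n - l))).card ≤ 2 ^ (n - l) := by
      refine (Finset.card_le_card (t := Finset.range (2 ^ (n - l))) fun i hi => ?_).trans
        (Finset.card_range _).le
      exact Finset.mem_range.2 (Finset.mem_filter.1 hi).2
    exact_mod_cast h4
  have hfirst : (2 : ℝ≥0∞) ^ (n - l) * ε univ ≤ e / 3 := by
    refine le_trans ?_ hl
    have h2 : (2 : ℝ≥0∞) ^ n = 2 ^ l * 2 ^ (n - l) := by rw [← pow_add, Nat.add_sub_cancel' hn3]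
    calc (2 : ℝ≥0∞) ^ (n - l) * ε univ = (2 ^ l * 2⁻¹ ^ l) * (2 ^ (n - l) * ε univ) := by
          rw [← mul_pow, ENNReal.mul_inv_cancel (by norm_num) (by norm_num), one_pow, one_mul]
      _ = (2 ^ n * ε univ) * 2⁻¹ ^ l := by rw [h2]; ring
      _ ≤ R * 2⁻¹ ^ l := by gcongr
  have hlast : (2 : ℝ≥0∞) ^ n * (ε univ * η) ≤ e / 3 := by
    rw [← mul_assoc]
    exact le_trans (by gcongr) hk
  calc _ ≤ (2 : ℝ≥0∞) ^ (n - l) * ε univ + (2 ^ n * κ (Ioi δ) + 2 ^ n * (ε univ * η)) := by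
        rw [← mul_add]
        push_cast
        gcongr
    _ ≤ e / 3 + (e / 3 + e / 3) := add_le_add hfirst (add_le_add hn2 hlast)
    _ = e := by rw [← add_assoc, ENNReal.add_thirds]

/-- The product of the `2 ^ n` one-step factors is exactly `e^{-rt}`, and the accumulated errors,
all nonnegative, tend to zero: the grid laws are squeezed. -/
theorem IsLevyProcess.isKilledEigenmeasure (hY : IsLevyProcess Y P) (hΛ : IsLevyMeasure Λ)
    (hT : HasLevyTriplet Y P b σ Λ) (hσ : 0 < σ) [IsProbabilityMeasure ν] (hν0 : ν (Iic 0) = 0)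
    (hs : IsSubinvariant (fun t => P.map (Y t)) ν r) (hν : IsWeaklyInvariant b σ Λ ν r) :
    IsKilledEigenmeasure (fun t => P.map (Y t)) ν r := by
  intro t ht A _
  have hp := isLevySemigroup_map hY.measurable hT
  have hr := hs.rate_nonneg hp
  have hpr := hp.prob
  have hbd : ∀ n : ℕ, _ := fun n => by
    have hf := isFiniteMeasure_excess (ν := ν) hp r (t / 2 ^ n)
    have hf' : IsFiniteMeasure (P.map (Y (t / 2 ^ n))) := by
      have hp' : IsProbabilityMeasure (P.map (Y (t / 2 ^ n))) := hpr _
      infer_instance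
    refine iterate_killedStep_apply_bounds (a := ENNReal.ofReal (Real.exp (-r * (t / 2 ^ n : ℝ≥0))))
      ?_ (hs.killedStep_eq hp hν0 (show 0 < t / 2 ^ n by positivity)) (2 ^ n) A
    rw [ENNReal.ofReal_le_one, Real.exp_le_one_iff]
    have : (0 : ℝ) ≤ (t / 2 ^ n : ℝ≥0) := NNReal.coe_nonneg _
    nlinarith
  have hpow : ∀ n : ℕ, ENNReal.ofReal (Real.exp (-r * (t / 2 ^ n : ℝ≥0))) ^ (2 ^ n) =
      ENNReal.ofReal (Real.exp (-r * t)) := fun n => by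
    rw [← ENNReal.ofReal_pow (Real.exp_pos _).le, ← Real.exp_nat_mul]
    congr 2
    push_cast
    field_simp
  have hlim := (hY.tendsto_sum_excess hΛ hT hσ hs hν ht).const_add
    (ENNReal.ofReal (Real.exp (-r * t)) * ν A)
  rw [add_zero] at hlim
  refine tendsto_of_tendsto_of_tendsto_of_le_of_le tendsto_const_nhds hlim (fun n => ?_)
    fun n => ?_
  · have := (hbd n).1
    rwa [hpow] at this
  · have := (hbd n).2
    rwa [hpow] at this

/-- The grid laws have two limits, the killed law and `e^{-rt} ν`, so these agree. The conditioned
form follows by dividing by the total mass `e^{-rt}`. -/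
theorem IsKilledEigenmeasure.isQSDWithEigenvalue [hνp : IsProbabilityMeasure ν]
    (hk : IsKilledEigenmeasure (fun t => P.map (Y t)) ν r) (hY : IsLevyProcess Y P)
    (hν0 : ν (Iic 0) = 0) (hac : ν ≪ volume) : IsQSDWithEigenvalue Y P ν r := by
  have heig : ∀ (t : ℝ≥0) (A : Set ℝ), MeasurableSet A →
      killedLaw Y P ν t A = ENNReal.ofReal (Real.exp (-r * t)) * ν A := by
    intro t A hA
    rcases eq_or_ne t 0 with rfl | ht
    · rw [hY.killedLaw_zero hν0 hA]
      simp
    · have ht' := pos_iff_ne_zero.2 ht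
      exact tendsto_nhds_unique (hY.tendsto_iterate_killedStep hν0 hac ht' hA) (hk t ht' A hA)
  refine { isProbabilityMeasure := hνp, supported := hν0, conditioned := fun t A hA => ?_,
           eigenvalue := heig }
  rw [heig t A hA, heig t univ MeasurableSet.univ, measure_univ, mul_one, mul_comm]
  exact ENNReal.mul_div_cancel_right (ENNReal.ofReal_pos.2 (Real.exp_pos _)).ne'
    ENNReal.ofReal_ne_top

/-- The profile of a traveling wave is the density of a quasi-stationary distribution. -/
theorem IsTravelingWave.isQSDWithEigenvalue {Z : ℝ≥0 → Ω → ℝ} {c : ℝ} {w : ℝ → ℝ}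
    (hw : IsTravelingWave b σ Λ r c w) (hd : IsDensityOf w ν) (hZ : IsLevyProcess Z P)
    (hΛ : IsLevyMeasure Λ) (hT : HasLevyTriplet Z P b σ Λ) (hσ : 0 < σ) :
    IsQSDWithEigenvalue (drifted Z c) P ν r := by
  obtain ⟨hwc, ⟨hC, hE⟩, hv, hmass⟩ := isTravelingWave_iff.1 hw
  obtain ⟨hwm, hw0, hwd⟩ := hd
  have hY := hZ.drifted c
  have hTY := hT.drifted hZ.measurable c
  have hmass' : ∫ x, w x = 1 := by
    rw [← hmass]
    exact (setIntegral_eq_integral_of_forall_compl_eq_zero fun x hx => hv x (not_lt.1 hx)).symm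
  -- A non-integrable function has Bochner integral `0`, so the unit-mass condition already contains
  -- integrability.
  have hwi : Integrable w := by
    by_contra h
    rw [integral_undef h] at hmass'
    exact zero_ne_one hmass'
  have hνp : IsProbabilityMeasure ν := ⟨by
    rw [hwd, withDensity_apply _ MeasurableSet.univ, Measure.restrict_univ,
      ← ofReal_integral_eq_lintegral_ofReal hwi (ae_of_all _ hw0), hmass', ENNReal.ofReal_one]⟩
  have hν0 : ν (Iic 0) = 0 := by
    rw [hwd, withDensity_apply _ measurableSet_Iic]
    rw [setLIntegral_congr_fun (g := fun _ => 0) measurableSet_Iic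
      (fun x hx => by simp [hv x hx])]
    simp
  have heq : ∀ x, 0 < x → adjointGenerator (b - c) σ Λ w x + r * w x = 0 := fun x hx => by
    rw [adjointGenerator_sub_drift]
    exact (hE x hx).2
  have hs := (isWeaklyExcessive_of_density hΛ hwc hw0 hwi hC hv (fun x hx => (hE x hx).1) heq
    hwd).isSubinvariant hΛ (isLevySemigroup_map hY.measurable hTY)
  have hk := hY.isKilledEigenmeasure hΛ hTY hσ hν0 hs
    (isWeaklyInvariant_of_density hΛ hwc hw0 hwi hC heq hwd)
  exact hk.isQSDWithEigenvalue hY hν0 (hwd ▸ withDensity_absolutelyContinuous _ _)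

end WaveToQuasiStationary

/-! ### Uniqueness of the continuous density and conclusion. -/

/-- Continuous densities of the same measure coincide. -/
theorem IsDensityOf.eq_of_continuous {w w' : ℝ → ℝ} {ν : Measure ℝ} [IsFiniteMeasure ν]
    (h : IsDensityOf w ν) (h' : IsDensityOf w' ν) (hc : Continuous w) (hc' : Continuous w') :
    w = w' := by
  obtain ⟨hm, h0, hd⟩ := h
  obtain ⟨hm', h0', hd'⟩ := h'
  have hfin : ∫⁻ x, ENNReal.ofReal (w x) ≠ ⊤ := by
    have h1 : ν univ = ∫⁻ x, ENNReal.ofReal (w x) := by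
      conv_lhs => rw [hd]
      rw [withDensity_apply _ MeasurableSet.univ, Measure.restrict_univ]
    rw [← h1]
    exact measure_ne_top _ _
  have h1 := (withDensity_eq_iff (μ := volume) (by fun_prop) (by fun_prop) hfin).1 (hd.symm.trans hd')
  refine Continuous.ae_eq_iff_eq volume hc hc' |>.1 ?_
  filter_upwards [h1] with x hx
  exact (ENNReal.ofReal_eq_ofReal_iff (h0 x) (h0' x)).1 hx

/-- Quasi-stationary distributions of the drifted Lévy process are exactly the profiles of the
traveling waves of the generalized Durrett–Remenik free-boundary problem. Since a density is
determined only almost everywhere, the equivalence is stated for `ν` (with some density) and for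
each continuous density `w` of `ν`. -/
theorem mainTheorem1 {Ω : Type*} [MeasurableSpace Ω] (P : Measure Ω) [IsProbabilityMeasure P]
    (Z : ℝ≥0 → Ω → ℝ) (b σ : ℝ) (Λ : Measure ℝ)
    (hZ : IsLevyProcess Z P) (hΛ : IsLevyMeasure Λ) (hT : HasLevyTriplet Z P b σ Λ)
    (hσ : 0 < σ)
    (hexp : ∃ θ : ℝ, 0 < θ ∧ Integrable (fun ω => Real.exp (θ * Z 1 ω)) P)
    (hint : Integrable (Z 1) P) (hcentred : ∫ ω, Z 1 ω ∂P = 0)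
    (c : ℝ) (hc : 0 < c) (r : ℝ) (ν : Measure ℝ) :
    (IsQSDWithEigenvalue (drifted Z c) P ν r ↔
      ∃ w : ℝ → ℝ, IsDensityOf w ν ∧ IsTravelingWave b σ Λ r c w) ∧
    (∀ w : ℝ → ℝ, IsDensityOf w ν → Continuous w →
      (IsQSDWithEigenvalue (drifted Z c) P ν r ↔ IsTravelingWave b σ Λ r c w)) ∧
    (∀ w : ℝ → ℝ, IsDensityOf w ν → Continuous w →
      (IsQSDWithEigenvalue (drifted Z c) P ν r ∨ IsTravelingWave b σ Λ r c w) →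
        SolvesProfileEquation b σ Λ r c w) := by
  have hiff : ∀ w : ℝ → ℝ, IsDensityOf w ν → Continuous w →
      (IsQSDWithEigenvalue (drifted Z c) P ν r ↔ IsTravelingWave b σ Λ r c w) := by
    intro w hw hwc
    refine ⟨fun hq => ?_, fun ht => ht.isQSDWithEigenvalue hw hZ hΛ hT hσ⟩
    have := hq.isProbabilityMeasure
    -- The construction yields some continuous density; continuity forces it to be the given `w`.
    obtain ⟨w', hwc', hw', ht⟩ := hq.exists_isTravelingWave hZ hΛ hT hσ
    rwa [hw.eq_of_continuous hw' hwc hwc']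
  refine ⟨⟨fun hq => ?_, fun ⟨w, hw, ht⟩ => ht.isQSDWithEigenvalue hw hZ hΛ hT hσ⟩, hiff,
    fun w hw hwc h => ?_⟩
  · obtain ⟨w, -, hw, ht⟩ := hq.exists_isTravelingWave hZ hΛ hT hσ
    exact ⟨w, hw, ht⟩
  · exact (isTravelingWave_iff.1 (h.elim (hiff w hw hwc).1 id)).2.1
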